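/- **Setting.** Let $\chi>0$ and let $V:[0,\infty)\to[0,\infty)$ be continuous with $V(1)=0$ and $V(r)\ge\max\{0,\log r\}$ for all $r\ge 0$. For $n\ge1$ let $(x^{(n)}_1,\dots,x^{(n)}_n)$ be random points of $\mathbb C$ whose joint law is the probability measure proportional to $$\prod_{i<j}|x_i-x_j|^2\,e^{-2(n+\chi)\sum_{i=1}^n V(|x_i|)}\,d\ell_{\mathbb C}(x_1)\cdots d\ell_{\mathbb C}(x_n),$$ where $\ell_{\mathbb C}$ is Lebesgue measure (this weight has finite positive total mass). **Theorem (Finite limiting process).** Let $\alpha\ge 2\chi$, and suppose that $$V(r)>\log r\ \text{ for every } r>1,\qquad \lim_{r\to\infty}r^\alpha\,(V(r)-\log r)=\gamma\in(0,\infty).$$ Suppose also that there exist $L_+>0$ and $L_-\ge1$ such that $$\lim_{r\to1^+}\frac{V(r)}{r-1}=L_++1,\qquad \lim_{r\to1^-}\frac{V(r)}{1-r}=L_--1.$$ Define $a_k\ge 0$, $k=0,1,2,\dots$, by $$a_k^{-1}=\begin{cases}\infty & \text{if } 2k+2\chi>\alpha,\\ 2\pi\int_0^\infty r^{2k+2\chi-1}e^{-2\gamma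 r^\alpha}\,dr & \text{if } 2k+2\chi<\alpha,\\ \pi\left(\frac1{\alpha\gamma}+\frac1{L_+}+\frac1{L_-}\right) & \text{if } 2k+2\chi=\alpha.\end{cases}$$ 1. There exists a determinantal point process $\mathbb F=\mathbb F^\alpha_{L_-,L_+}$ on $\mathbb C\setminus\{0\}$ with respect to Lebesgue measure with kernel $$K(z,w)=\frac1{|z\bar w|^{\chi+1}}\sum_{k=0}^\infty\frac{a_k}{(z\bar w)^k}\,e^{-\gamma/|z|^\alpha}e^{-\gamma/|w|^\alpha}.$$ Any such process has the following properties 2–4. 2. As $n\to\infty$, the point process on $\mathbb C\setminus\{0\}$ formed by the points $n^{-1/\alpha}x^{(n)}_k$, $1\le k\le n$, converges in law to $\mathbb F$ (weak convergence of laws for the vague topology on locally finite configurations in $\mathbb C\setminus\{0\}$). 3. If $\alpha/2-\chi$ is not an integer, $\mathbb F$ has almost surely exactly $\lceil\alpha/2-\chi\rceil$ particles. If $N=\alpha/2-\chi$ is an integer, $\mathbb F$ has $N$ particles with probability $\pi\left(\frac1{L_+}+\frac1{L_-}\right)a_N$ and $N+1$ particles with probability $1-\pi\left(\frac1{L_+}+\frac1{L_-}\right)a_N$.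 4. As $n\to\infty$, $n^{-1/\alpha}\max\{|x^{(n)}_1|,\dots,|x^{(n)}_n|\}$ converges in law to the maximum of $|z|$ over the points $z$ of $\mathbb F$ (read as $0$ when $\mathbb F$ has no points). 5. Write $\Gamma(s,x)=\int_x^\infty u^{s-1}e^{-u}\,du$ and $\Gamma(s)=\Gamma(s,0)$. For every $t>0$, if $\alpha/2-\chi$ is not an integer, $$\lim_{n\to\infty}\mathbb P\left(n^{-1/\alpha}\max_k|x^{(n)}_k|\le t\right)=\prod_{k=0}^{\lfloor\alpha/2-\chi\rfloor}\frac{\Gamma\left(\frac{2k+2\chi}\alpha,\,2\gamma t^{-\alpha}\right)}{\Gamma\left(\frac{2k+2\chi}\alpha\right)},$$ and if $\alpha/2-\chi$ is an integer, $$\lim_{n\to\infty}\mathbb P\left(n^{-1/\alpha}\max_k|x^{(n)}_k|\le t\right)=\prod_{k=0}^{\alpha/2-\chi-1}\frac{\Gamma\left(\frac{2k+2\chi}\alpha,\,2\gamma t^{-\alpha}\right)}{\Gamma\left(\frac{2k+2\chi}\alpha\right)}\left[e^{-2\gamma t^{-\alpha}}+\left(1-e^{-2\gamma t^{-\alpha}}\right)\left(\frac1{L_+}+\frac1{L_-}\right)\left(\frac1{\alpha\gamma}+\frac1{L_+}+\frac1{L_-}\right)^{-1}\right].$$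 -/

import Mathlib

open MeasureTheory ProbabilityTheory Filter Topology Set
open scoped ENNReal CompactlySupported

noncomputable section

/-! ### Point processes -/

/-- Locally finite point configurations (with multiplicities) on `X`, viewed as their counting
measures: locally finite Borel measures taking values in `{0, 1, 2, …, ∞}`. -/
def Configuration (X : Type*) [TopologicalSpace X] [MeasurableSpace X] : Type _ :=
  {μ : Measure X // IsLocallyFiniteMeasure μ ∧
    ∀ s : Set X, MeasurableSet s → ∃ m : ℕ∞, μ s = (m : ℝ≥0∞)}

namespace Configuration

variable {X : Type*} [TopologicalSpace X] [MeasurableSpace X]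

/-- The number of points of the configuration in the set `s`. -/
def count (ξ : Configuration X) (s : Set X) : ℝ≥0∞ := ξ.1 s

/-- The vague topology: the coarsest topology for which `ξ ↦ ∑_{x ∈ ξ} f x` is continuous for
every continuous compactly supported `f`. -/
instance : TopologicalSpace (Configuration X) :=
  TopologicalSpace.induced (fun ξ (f : C_c(X, ℝ)) => ∫ x, f x ∂ξ.1) inferInstance

instance : MeasurableSpace (Configuration X) := borel _

instance : BorelSpace (Configuration X) := ⟨rfl⟩

end Configuration

/-- `P`, the law of a point process on `X`, is determinantal with respect to the reference
measure `μ` and the kernel `K`: the process is simple and, for every `m`, its `m`-point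
correlation function with respect to `μ` is `det (K (x i) (x j))`. -/
structure IsDeterminantal {X : Type*} [TopologicalSpace X] [MeasurableSpace X]
    (P : Measure (Configuration X)) (μ : Measure X) (K : X → X → ℂ) : Prop where
  simple : ∀ᵐ ξ ∂P, ∀ x, ξ.count {x} ≤ 1
  correlation_nonneg : ∀ m : ℕ, ∀ᵐ x ∂(Measure.pi fun _ : Fin m => μ),
    (Matrix.of fun i j => K (x i) (x j)).det.im = 0 ∧
      0 ≤ (Matrix.of fun i j => K (x i) (x j)).det.re
  correlation : ∀ (m : ℕ) (B : Fin m → Set X), (∀ i, MeasurableSet (B i)) →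
    Pairwise (fun i j => Disjoint (B i) (B j)) →
    ∫⁻ ξ, ∏ i, ξ.count (B i) ∂P =
      ∫⁻ x in Set.univ.pi B, ENNReal.ofReal (Matrix.of fun i j => K (x i) (x j)).det.re
        ∂(Measure.pi fun _ : Fin m => μ)

/-- The punctured plane `ℂ \ {0}`. -/
abbrev PuncturedPlane : Type := {z : ℂ // z ≠ 0}

/-- The Lebesgue measure on `ℂ \ {0}`. -/
def lebesguePunctured : Measure PuncturedPlane :=
  (volume : Measure ℂ).comap (Subtype.val : PuncturedPlane → ℂ)

/-- The configuration on `ℂ \ {0}` formed by those of the points `x 0, …, x (n - 1)` that are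
different from `0`. -/
def pointConfiguration {n : ℕ} (x : Fin n → ℂ) : Configuration PuncturedPlane :=
  ⟨∑ k, (open Classical in if h : x k ≠ 0 then Measure.dirac ⟨x k, h⟩ else 0), by
    classical
    have key : ∀ s : Set PuncturedPlane, MeasurableSet s → ∃ m : ℕ,
        (∑ k, (if h : x k ≠ 0 then Measure.dirac (⟨x k, h⟩ : PuncturedPlane) else 0)) s
          = (m : ℝ≥0∞) := by
      intro s hs
      refine ⟨∑ k, (if h : x k ≠ 0 then
        (if (⟨x k, h⟩ : PuncturedPlane) ∈ s then 1 else 0) else 0), ?_⟩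
      rw [Measure.finsetSum_apply, Nat.cast_sum]
      refine Finset.sum_congr rfl fun k _ => ?_
      by_cases h : x k ≠ 0
      · rw [dif_pos h, dif_pos h, Measure.dirac_apply' _ hs, Set.indicator_apply]
        split_ifs <;> simp
      · rw [dif_neg h, dif_neg h]
        simp
    constructor
    · obtain ⟨m, hm⟩ := key Set.univ MeasurableSet.univ
      have : IsFiniteMeasure (∑ k, (if h : x k ≠ 0 then
          Measure.dirac (⟨x k, h⟩ : PuncturedPlane) else 0)) := ⟨by rw [hm]; simp⟩
      infer_instance
    · intro s hs
      obtain ⟨m, hm⟩ := key s hs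
      exact ⟨(m : ℕ∞), by rw [hm]; simp⟩⟩

/-- The maximal modulus of the points of a configuration, with value `0` for the empty
configuration. (It is used for configurations with finitely many points.) -/
def Configuration.maxModulus (ξ : Configuration PuncturedPlane) : ℝ :=
  sSup {r : ℝ | ∃ z : PuncturedPlane, ξ.count {z} ≠ 0 ∧ ‖(z : ℂ)‖ = r}

/-! ### The Coulomb gas -/

/-- `max {|x_1|, …, |x_n|}` (with value `0` if `n = 0`). -/
def maxModulus {n : ℕ} (x : Fin n → ℂ) : ℝ := ⨆ k, ‖x k‖

/-- The weight `∏_{i<j} |x_i - x_j|² exp (-2 (n + χ) ∑_i V(|x_i|)) dx_1 ⋯ dx_n` on `ℂⁿ`. -/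
def coulombWeight (χ : ℝ) (V : ℝ → ℝ) (n : ℕ) : Measure (Fin n → ℂ) :=
  volume.withDensity fun x => ENNReal.ofReal
    ((∏ i, ∏ j ∈ Finset.Ioi i, ‖x i - x j‖ ^ 2) *
      Real.exp (-2 * ((n : ℝ) + χ) * ∑ i, V ‖x i‖))

/-- The law of the radial determinantal Coulomb gas of `n` particles. -/
def coulombGas (χ : ℝ) (V : ℝ → ℝ) (n : ℕ) : Measure (Fin n → ℂ) :=
  (coulombWeight χ V n Set.univ)⁻¹ • coulombWeight χ V n

/-- `V : [0, ∞) → [0, ∞)` is a circle potential. (Only the values of `V` on `[0, ∞)` matter.) -/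
structure IsCirclePotential (V : ℝ → ℝ) : Prop where
  continuousOn : ContinuousOn V (Set.Ici 0)
  one : V 1 = 0
  max_le : ∀ r, 0 ≤ r → max 0 (Real.log r) ≤ V r

/-! ### The limiting kernel -/

/-- The coefficients `a_k` of the limiting kernel; `a_k⁻¹ = ∞`, that is `a_k = 0`, if
`2 k + 2 χ > α`. -/
def limitCoeff (χ α γ Lminus Lplus : ℝ) (k : ℕ) : ℝ :=
  if 2 * (k : ℝ) + 2 * χ < α then
    (2 * Real.pi * ∫ r in Set.Ioi (0 : ℝ),
      r ^ (2 * (k : ℝ) + 2 * χ - 1) * Real.exp (-2 * γ * r ^ α))⁻¹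
  else if 2 * (k : ℝ) + 2 * χ = α then
    (Real.pi * (1 / (α * γ) + 1 / Lplus + 1 / Lminus))⁻¹
  else 0

/-- The kernel of the limiting process. -/
def limitKernel (χ α γ Lminus Lplus : ℝ) (z w : PuncturedPlane) : ℂ :=
  ((1 / ‖(z : ℂ) * star (w : ℂ)‖ ^ (χ + 1) : ℝ) : ℂ) *
    (∑' k : ℕ, (limitCoeff χ α γ Lminus Lplus k : ℂ) / ((z : ℂ) * star (w : ℂ)) ^ k) *
    (Real.exp (-γ / ‖(z : ℂ)‖ ^ α) : ℂ) * (Real.exp (-γ / ‖(w : ℂ)‖ ^ α) : ℂ)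

/-- The upper incomplete Gamma function `Γ(s, x)`. -/
def upperGamma (s x : ℝ) : ℝ :=
  ∫ u in Set.Ioi x, u ^ (s - 1) * Real.exp (-u)

end

/-! ### Hadamard's inequality and truncation of determinants -/

/-! The potential is radial, so the gas is a projection ensemble. The Vandermonde determinant turns
its density into |det ψ_k(x_i)|²/n!, where ψ_k is the normalised monomial of degree n-1-k times
exp(-(n+χ)V), and rotation invariance makes different degrees orthogonal. Such an ensemble is
studied through multiplicative functionals: Andréief's identity gives E ∏ f(x_i) = det(∫ ψ_j ψ̄_k f)
(`IsOrthonormalFamily.integral_prod`).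

The squared norm of mode k before normalisation has two sources. A layer of width 1/n around the
unit circle contributes about π(1/L₊ + 1/L₋)/n. The region |x| ~ n^(1/α) contributes about c_k
n^(-(2k+2χ)/α), with c_k = `limitMass`. Mode k therefore escapes if 2k+2χ < α, stays on the circle
if 2k+2χ > α, and is shared between both in case of equality. The escaping fraction is `occupation`,
p_k = a_k c_k (see `tendsto_radialMass`). If f = 1 near 0, rescaling by n^(1/α) makes the (j,k)
entry of the matrix converge to δ_jk + √(p_j p_k) M_jk, with M = `limitGram` (see
`tendsto_integral_gasMode`).

The size of the determinant grows with n, so convergence of entries is not enough. By Hadamard's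
inequality, replacing a column by a basis vector costs at most the norm of the difference. Bessel's
inequality bounds this norm by a geometric sequence in k, whose tail from T on vanishes in the limit
once 2T+2χ > α (`tendsto_integral_prod_coulombGas`). What is left is a determinant of fixed size.
With N = ⌈α/2-χ⌉ one has p_k = 1 for k < N, and p_k = 0 for k > N. The determinant is affine in p =
p_N, hence equals (1-p)E_N + pE_{N+1}, where E_m is the expectation of ∏ f in the projection
ensemble of the first m limit modes (`det_one_add_mul_mul`).

So the limit is a mixture of two finite projection processes, `mixedLaw`. The minors of the limiting
kernel are affine in the same p, so the mixture is determinantal with that kernel, and its number of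
points is visible. Taking f = exp(iφ) gives convergence of the point processes, through Lévy's
theorem for finitely many test functions and second countability of the configuration space. Taking
f to be the indicator of a disc gives the law of the maximum; the matrix is then diagonal, with
ratios of Gamma functions as entries.

The statements on an arbitrary process with this kernel follow from uniqueness
(`IsDeterminantal.eq_of_ae_count_le`): when the number of points is bounded, the law is determined
by factorial moments on finer and finer partitions. -/

/-- In the Gram–Schmidt basis of the columns the matrix is triangular, with diagonal ⟨b_i, f_i⟩.
Passing between orthonormal bases costs a factor of modulus one. Dependent columns need no separate
treatment. -/
theorem norm_det_le_prod_norm_col {n : ℕ} (A : Matrix (Fin n) (Fin n) ℂ) :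
    ‖A.det‖ ≤ ∏ j, ‖(WithLp.toLp 2 (fun i => A i j) : EuclideanSpace ℂ (Fin n))‖ := by
  classical
  set f : Fin n → EuclideanSpace ℂ (Fin n) := fun j => WithLp.toLp 2 fun i => A i j with hf
  have hfr : Module.finrank ℂ (EuclideanSpace ℂ (Fin n)) = Fintype.card (Fin n) := by simp
  set b := InnerProductSpace.gramSchmidtOrthonormalBasis hfr f
  set e := EuclideanSpace.basisFun (Fin n) ℂ
  have h1 : b.toBasis.det f = ∏ i, inner ℂ (b i) (f i) :=
    InnerProductSpace.gramSchmidtOrthonormalBasis_det hfr f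
  have h2 : e.toBasis.det f = A.det := by
    rw [Module.Basis.det_apply]
    congr 1
  have h3 : e.toBasis.det f = e.toBasis.det b * b.toBasis.det f := by
    rw [Module.Basis.det_apply, Module.Basis.det_apply, Module.Basis.det_apply,
      ← Matrix.det_mul]
    congr 1
    have := Module.Basis.toMatrix_mul_toMatrix e.toBasis b.toBasis f
    simpa using this.symm
  rw [← h2, h3, norm_mul, e.det_to_matrix_orthonormalBasis b, one_mul, h1, norm_prod]
  refine Finset.prod_le_prod (fun _ _ => norm_nonneg _) fun i _ => ?_
  calc _ ≤ ‖b i‖ * ‖f i‖ := norm_inner_le_norm _ _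
    _ = _ := by rw [b.orthonormal.1 i, one_mul]

/-- The smaller minor is the larger determinant with its last column replaced by a basis vector. By
linearity in that column the difference is a single determinant, to which Hadamard's inequality
applies. -/
theorem norm_det_succ_sub_det_le (g : ℕ → ℕ → ℂ) (n : ℕ) (b : ℝ) (hb : 0 ≤ b)
    (h1 : ∀ j < n, ∑ i ∈ Finset.range (n + 1), ‖g i j‖ ^ 2 ≤ 1)
    (h2 : ∑ i ∈ Finset.range (n + 1), ‖g i n - if i = n then 1 else 0‖ ^ 2 ≤ b ^ 2) :
    ‖(Matrix.of fun i j : Fin (n + 1) => g i j).det - (Matrix.of fun i j : Fin n => g i j).det‖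
      ≤ b := by
  set A : Matrix (Fin (n + 1)) (Fin (n + 1)) ℂ := Matrix.of fun i j => g i j with hA
  set e : Fin (n + 1) → ℂ := Pi.single (Fin.last n) 1 with he
  have hlast : (Matrix.of fun i j : Fin n => g i j).det = (A.updateCol (Fin.last n) e).det := by
    rw [Matrix.det_succ_column _ (Fin.last n), Finset.sum_eq_single (Fin.last n)]
    · have : ((-1 : ℂ)) ^ ((Fin.last n : ℕ) + (Fin.last n : ℕ)) = 1 := by
        rw [← two_mul, pow_mul]; simp
      rw [this]
      simp only [Matrix.updateCol_self, he, Pi.single_eq_same, one_mul]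
      congr 1
      ext i j
      simp [hA]
    · intro i _ hi
      simp [he, hi]
    · simp
  have hcol : A = A.updateCol (Fin.last n) (fun i => A i (Fin.last n)) := by
    simp
  have hsub : A.det - (Matrix.of fun i j : Fin n => g i j).det
      = (A.updateCol (Fin.last n) ((fun i => A i (Fin.last n)) - e)).det := by
    rw [hlast]
    have h := Matrix.det_updateCol_add A (Fin.last n) ((fun i => A i (Fin.last n)) - e) e
    rw [sub_add_cancel, ← hcol] at h
    rw [h]; ring
  rw [hsub]
  refine (norm_det_le_prod_norm_col _).trans ?_
  rw [Fin.prod_univ_castSucc]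
  have hl : ∏ j : Fin n, ‖(WithLp.toLp 2 (fun i => (A.updateCol (Fin.last n)
      ((fun i => A i (Fin.last n)) - e)) i j.castSucc) : EuclideanSpace ℂ (Fin (n + 1)))‖ ≤ 1 := by
    refine Finset.prod_le_one (fun _ _ => norm_nonneg _) fun j _ => ?_
    rw [EuclideanSpace.norm_eq, Real.sqrt_le_one]
    refine le_trans (le_of_eq ?_) (h1 j j.2)
    rw [← Fin.sum_univ_eq_sum_range (fun i => ‖g i j‖ ^ 2)]
    refine Finset.sum_congr rfl fun i _ => ?_
    simp [hA]
  refine (mul_le_of_le_one_left (norm_nonneg _) hl).trans ?_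
  rw [EuclideanSpace.norm_eq]
  refine Real.sqrt_le_iff.2 ⟨hb, le_trans (le_of_eq ?_) h2⟩
  rw [← Fin.sum_univ_eq_sum_range (fun i => ‖g i n - if i = n then 1 else 0‖ ^ 2)]
  refine Finset.sum_congr rfl fun i _ => ?_
  simp only [Matrix.updateCol_self, Pi.sub_apply, hA, Matrix.of_apply, he, Fin.val_last,
    Pi.single_apply, Fin.ext_iff]

/-- Telescoping over the minors of sizes N, …, n. The column bounds over all n rows restrict to
fewer rows. -/
theorem norm_det_sub_det_le (g : ℕ → ℕ → ℂ) (n N : ℕ) (hN : N ≤ n) (b : ℕ → ℝ) (hb : ∀ j, 0 ≤ b j)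
    (h1 : ∀ j < n, ∑ i ∈ Finset.range n, ‖g i j‖ ^ 2 ≤ 1)
    (h2 : ∀ j < n, N ≤ j →
      ∑ i ∈ Finset.range n, ‖g i j - if i = j then 1 else 0‖ ^ 2 ≤ b j ^ 2) :
    ‖(Matrix.of fun i j : Fin n => g i j).det - (Matrix.of fun i j : Fin N => g i j).det‖
      ≤ ∑ j ∈ Finset.Ico N n, b j := by
  have key : ∀ m, N ≤ m → m ≤ n → ‖(Matrix.of fun i j : Fin m => g i j).det
      - (Matrix.of fun i j : Fin N => g i j).det‖ ≤ ∑ j ∈ Finset.Ico N m, b j := by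
    intro m hm
    induction m, hm using Nat.le_induction with
    | base => simp
    | succ m hm ih =>
      intro hmn
      rw [Finset.sum_Ico_succ_top hm, add_comm (∑ k ∈ _, _)]
      have hss : Finset.range (m + 1) ⊆ Finset.range n := Finset.range_subset_range.2 hmn
      refine (norm_sub_le_norm_sub_add_norm_sub _ (Matrix.of fun i j : Fin m => g i j).det _).trans
        (add_le_add (norm_det_succ_sub_det_le g m (b m) (hb m) (fun j hj => ?_) ?_)
          (ih (by omega)))
      · exact (Finset.sum_le_sum_of_subset_of_nonneg hss fun _ _ _ => by positivity).trans
          (h1 j (by omega))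
      · exact (Finset.sum_le_sum_of_subset_of_nonneg hss fun _ _ _ => by positivity).trans
          (h2 m (by omega) hm)
  exact key n hN le_rfl

/-! ### Integrals of products of determinants -/

/-- Andréief's identity. After expanding both determinants and applying Fubini, the term of (σ, τ)
depends only on τσ⁻¹, so the sum over σ produces n!. -/
theorem integral_det_mul_det {E : Type*} [MeasurableSpace E] (μ : Measure E) [SigmaFinite μ]
    {n : ℕ} (f g : Fin n → E → ℂ) (hfg : ∀ j k, Integrable (fun x => f j x * g k x) μ) :
    ∫ x, (Matrix.of fun i j => f j (x i)).det * (Matrix.of fun i j => g j (x i)).det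
        ∂(Measure.pi fun _ : Fin n => μ)
      = (n.factorial : ℂ) * (Matrix.of fun j k => ∫ x, f j x * g k x ∂μ).det := by
  have hint : ∀ σ τ : Equiv.Perm (Fin n), Integrable
      (fun x : Fin n → E => ∏ i, (f (σ i) (x i) * g (τ i) (x i))) (Measure.pi fun _ => μ) :=
    fun σ τ => Integrable.fintype_prod (f := fun i x => f (σ i) x * g (τ i) x)
      fun i => hfg (σ i) (τ i)
  have hexp : ∀ x : Fin n → E, (Matrix.of fun i j => f j (x i)).det *
      (Matrix.of fun i j => g j (x i)).det = ∑ σ : Equiv.Perm (Fin n), ∑ τ : Equiv.Perm (Fin n),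
        ((Equiv.Perm.sign σ : ℤ) : ℂ) * ((Equiv.Perm.sign τ : ℤ) : ℂ) *
          ∏ i, (f (σ i) (x i) * g (τ i) (x i)) := by
    intro x
    rw [← Matrix.det_transpose, Matrix.det_apply', ← Matrix.det_transpose (Matrix.of _),
      Matrix.det_apply', Finset.sum_mul_sum]
    refine Finset.sum_congr rfl fun σ _ => Finset.sum_congr rfl fun τ _ => ?_
    simp only [Matrix.transpose_apply, Matrix.of_apply, Finset.prod_mul_distrib]
    ring
  simp_rw [hexp]
  rw [integral_finsetSum _ fun σ _ => integrable_finsetSum _ fun τ _ => (hint σ τ).const_mul _]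
  have hτ : ∀ σ : Equiv.Perm (Fin n), ∫ x : Fin n → E, ∑ τ : Equiv.Perm (Fin n),
        ((Equiv.Perm.sign σ : ℤ) : ℂ) * ((Equiv.Perm.sign τ : ℤ) : ℂ) *
          ∏ i, (f (σ i) (x i) * g (τ i) (x i)) ∂(Measure.pi fun _ => μ)
      = (Matrix.of fun j k => ∫ x, f j x * g k x ∂μ).det := by
    intro σ
    rw [integral_finsetSum _ fun τ _ => (hint σ τ).const_mul _]
    have h1 : ∀ τ : Equiv.Perm (Fin n), ∫ x : Fin n → E,
        ((Equiv.Perm.sign σ : ℤ) : ℂ) * ((Equiv.Perm.sign τ : ℤ) : ℂ) *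
          ∏ i, (f (σ i) (x i) * g (τ i) (x i)) ∂(Measure.pi fun _ => μ)
        = ((Equiv.Perm.sign (τ * σ⁻¹) : ℤ) : ℂ) *
          ∏ i, ∫ x, f i x * g ((τ * σ⁻¹) i) x ∂μ := by
      intro τ
      rw [integral_const_mul, integral_fintype_prod_eq_prod (fun i x => f (σ i) x * g (τ i) x)]
      congr 1
      · simp [mul_comm]
      · exact Fintype.prod_equiv σ _ _ fun i => by simp
    simp_rw [h1]
    rw [← Matrix.det_transpose, Matrix.det_apply']
    exact Fintype.sum_equiv (Equiv.mulRight σ⁻¹) _ _ fun τ => by simp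
  simp_rw [hτ]
  simp [Fintype.card_perm]

/-! ### Projection ensembles -/

/-- A finite orthonormal family of (measurable, complex) functions. -/
structure IsOrthonormalFamily {E : Type*} [MeasurableSpace E] (μ : Measure E) {n : ℕ}
    (ψ : Fin n → E → ℂ) : Prop where
  measurable : ∀ j, Measurable (ψ j)
  memLp : ∀ j, MemLp (ψ j) 2 μ
  integral_mul_star : ∀ j k, ∫ x, ψ j x * star (ψ k x) ∂μ = if j = k then 1 else 0

/-- The kernel of the orthogonal projection on the span of `ψ`. -/
def projectionKernel {E : Type*} {n : ℕ} (ψ : Fin n → E → ℂ) (x y : E) : ℂ :=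
  ∑ j, ψ j x * star (ψ j y)

/-- The law of `n` particles with density `|det (ψ_j (x_i))|² / n!`. -/
noncomputable def projectionEnsemble {E : Type*} [MeasurableSpace E] (μ : Measure E) {n : ℕ}
    (ψ : Fin n → E → ℂ) : Measure (Fin n → E) :=
  (Measure.pi fun _ => μ).withDensity fun x =>
    ENNReal.ofReal (‖(Matrix.of fun i j => ψ j (x i)).det‖ ^ 2 / n.factorial)

theorem measurable_det_of {E : Type*} [MeasurableSpace E] {ι : Type*} [Fintype ι] [DecidableEq ι]
    {A : E → ι → ι → ℂ} (hA : ∀ i j, Measurable fun x => A x i j) :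
    Measurable fun x => (Matrix.of (A x)).det := by
  simp_rw [Matrix.det_apply']
  exact Finset.measurable_sum _ fun σ _ => Measurable.const_mul
    (Finset.measurable_prod _ fun i _ => hA _ _) _

namespace IsOrthonormalFamily

variable {E : Type*} [MeasurableSpace E] {μ : Measure E} {n : ℕ} {ψ : Fin n → E → ℂ}

theorem integrable_mul_star (hψ : IsOrthonormalFamily μ ψ) (j k : Fin n) :
    Integrable (fun x => ψ j x * star (ψ k x)) μ :=
  (hψ.memLp j).integrable_mul (hψ.memLp k).star

theorem integrable_mul_star_mul (hψ : IsOrthonormalFamily μ ψ) (j k : Fin n) {h : E → ℂ}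
    (hh : Measurable h) {C : ℝ} (hC : ∀ x, ‖h x‖ ≤ C) :
    Integrable (fun x => ψ j x * star (ψ k x) * h x) μ :=
  (hψ.integrable_mul_star j k).mul_bdd hh.aestronglyMeasurable (ae_of_all _ hC)

theorem measurable_density (hψ : IsOrthonormalFamily μ ψ) :
    Measurable fun x : Fin n → E =>
      ENNReal.ofReal (‖(Matrix.of fun i j => ψ j (x i)).det‖ ^ 2 / n.factorial) := by
  refine ENNReal.measurable_ofReal.comp (Measurable.div_const (Measurable.pow_const
    (Measurable.norm ?_) 2) _)
  exact measurable_det_of fun i j => (hψ.measurable j).comp (measurable_pi_apply i)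

/-- Andréief's identity for the families h ψ_j and ψ̄_k: the factor ∏ h(x_i) is absorbed into the
rows of one determinant. All limits below are obtained through this formula. -/
theorem integral_prod [SigmaFinite μ] (hψ : IsOrthonormalFamily μ ψ) {h : E → ℂ}
    (hh : Measurable h) {C : ℝ} (hC : ∀ x, ‖h x‖ ≤ C) :
    ∫ x, ∏ i, h (x i) ∂(projectionEnsemble μ ψ)
      = (Matrix.of fun j k => ∫ x, ψ j x * star (ψ k x) * h x ∂μ).det := by
  have hn : (n.factorial : ℂ) ≠ 0 := by exact_mod_cast n.factorial_ne_zero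
  rw [projectionEnsemble, integral_withDensity_eq_integral_toReal_smul hψ.measurable_density
    (ae_of_all _ fun x => ENNReal.ofReal_lt_top)]
  have h1 : ∀ x : Fin n → E,
      (ENNReal.ofReal (‖(Matrix.of fun i j => ψ j (x i)).det‖ ^ 2 / n.factorial)).toReal •
        ∏ i, h (x i) = (n.factorial : ℂ)⁻¹ * ((Matrix.of fun i j => h (x i) * ψ j (x i)).det *
          (Matrix.of fun i j => star (ψ j (x i))).det) := by
    intro x
    rw [ENNReal.toReal_ofReal (by positivity)]
    have e1 : (Matrix.of fun i j => h (x i) * ψ j (x i)).det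
        = (∏ i, h (x i)) * (Matrix.of fun i j => ψ j (x i)).det :=
      Matrix.det_mul_column (fun i => h (x i)) (Matrix.of fun i j => ψ j (x i))
    have e2 : (Matrix.of fun i j => star (ψ j (x i))).det
        = star (Matrix.of fun i j => ψ j (x i)).det := by
      rw [← Matrix.det_conjTranspose, ← Matrix.det_transpose]
      congr 1
    have e3 : ((‖(Matrix.of fun i j => ψ j (x i)).det‖ ^ 2 : ℝ) : ℂ)
        = (Matrix.of fun i j => ψ j (x i)).det * star (Matrix.of fun i j => ψ j (x i)).det := by
      rw [Complex.star_def, Complex.mul_conj']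
      push_cast; rfl
    rw [e1, e2, Complex.real_smul, Complex.ofReal_div, e3]
    push_cast
    field_simp
  simp_rw [h1]
  rw [integral_const_mul, integral_det_mul_det μ (fun j x => h x * ψ j x) (fun j x => star (ψ j x)),
    ← mul_assoc, inv_mul_cancel₀ hn, one_mul]
  · congr 1
    ext j k
    simp only [Matrix.of_apply]
    exact integral_congr_ae (ae_of_all _ fun x => by ring)
  · intro j k
    exact (hψ.integrable_mul_star_mul j k hh hC).congr (ae_of_all _ fun x => by ring)

theorem isProbabilityMeasure [SigmaFinite μ] (hψ : IsOrthonormalFamily μ ψ) :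
    IsProbabilityMeasure (projectionEnsemble μ ψ) := by
  have h := hψ.integral_prod (h := fun _ => 1) measurable_const (C := 1) (by simp)
  have hm : (Matrix.of fun j k => ∫ x, ψ j x * star (ψ k x) * 1 ∂μ) = 1 := by
    ext j k
    simp only [Matrix.of_apply, mul_one, Matrix.one_apply]
    exact hψ.integral_mul_star j k
  rw [hm] at h
  simp only [Finset.prod_const_one, integral_const, Matrix.det_one, Complex.real_smul,
    mul_one] at h
  have h2 : (projectionEnsemble μ ψ).real Set.univ = 1 := by exact_mod_cast h
  exact ⟨by rwa [Measure.real, ENNReal.toReal_eq_one_iff] at h2⟩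

/-- The density itself vanishes when two points coincide, so the reference measure may have atoms.
-/
theorem ae_injective [SigmaFinite μ] (hψ : IsOrthonormalFamily μ ψ) :
    ∀ᵐ x ∂(projectionEnsemble μ ψ), Function.Injective x := by
  rw [projectionEnsemble, ae_withDensity_iff hψ.measurable_density]
  refine ae_of_all _ fun x hx i j hij => ?_
  by_contra hne
  refine hx ?_
  have : (Matrix.of fun i j => ψ j (x i)).det = 0 :=
    Matrix.det_zero_of_row_eq hne (by ext k; simp [hij])
  simp [this]

/-- **Bessel's inequality** for the matrix of a multiplication operator. -/
theorem sum_norm_sq_integral_le (hψ : IsOrthonormalFamily μ ψ) (k : Fin n) {h : E → ℂ}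
    (hh : Measurable h) {C : ℝ} (hC : ∀ x, ‖h x‖ ≤ C) :
    ∑ j, ‖∫ x, ψ j x * star (ψ k x) * h x ∂μ‖ ^ 2 ≤ ∫ x, ‖h x‖ ^ 2 * ‖ψ k x‖ ^ 2 ∂μ := by
  -- The coefficient ∫ ψ_j ψ̄_k h is the conjugate of ⟨ψ_j, ψ_k h̄⟩, which is why Bessel's
  -- inequality is applied to the vector ψ_k h̄.
  have hF : MemLp (fun x => ψ k x * star (h x)) 2 μ := by
    refine MemLp.mul (p := 2) (q := ⊤) (r := 2) ?_ (hψ.memLp k)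
    exact memLp_top_of_bound (continuous_star.measurable.comp hh).aestronglyMeasurable C (ae_of_all _ fun x => by simpa using hC x)
  have hO : Orthonormal ℂ fun j => (hψ.memLp j).toLp (ψ j) := by
    rw [orthonormal_iff_ite]
    intro i j
    rw [L2.inner_def]
    have : ∫ a, inner ℂ ((hψ.memLp i).toLp (ψ i) a) ((hψ.memLp j).toLp (ψ j) a) ∂μ
        = ∫ x, ψ j x * star (ψ i x) ∂μ := by
      refine integral_congr_ae ?_
      filter_upwards [(hψ.memLp i).coeFn_toLp, (hψ.memLp j).coeFn_toLp] with x h1 h2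
      rw [h1, h2]; rfl
    rw [this, hψ.integral_mul_star]
    simp [eq_comm]
  have hB := hO.sum_inner_products_le (s := Finset.univ) (hF.toLp _)
  have hn : ‖hF.toLp _‖ ^ 2 = ∫ x, ‖h x‖ ^ 2 * ‖ψ k x‖ ^ 2 ∂μ := by
    have h1 : ((‖hF.toLp _‖ ^ 2 : ℝ) : ℂ) = inner ℂ (hF.toLp _) (hF.toLp _) := by
      rw [inner_self_eq_norm_sq_to_K]; push_cast; rfl
    rw [L2.inner_def] at h1
    have h2 : ∫ a, inner ℂ (hF.toLp _ a) (hF.toLp _ a) ∂μ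
        = ∫ x, (((‖h x‖ ^ 2 * ‖ψ k x‖ ^ 2 : ℝ)) : ℂ) ∂μ := by
      refine integral_congr_ae ?_
      filter_upwards [hF.coeFn_toLp] with x h1
      rw [h1, inner_self_eq_norm_sq_to_K]
      simp only [norm_mul, norm_star]
      push_cast
      rw [mul_pow]
      exact mul_comm _ _
    rw [h2, integral_complex_ofReal] at h1
    exact_mod_cast h1
  rw [hn] at hB
  refine le_trans (le_of_eq ?_) hB
  refine Finset.sum_congr rfl fun j _ => ?_
  rw [← norm_inner_symm, L2.inner_def]
  congr 2
  refine integral_congr_ae ?_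
  filter_upwards [hF.coeFn_toLp, (hψ.memLp j).coeFn_toLp] with x h1 h2
  rw [h1, h2]
  simp only [RCLike.inner_apply, map_mul, Complex.star_def, Complex.conj_conj]
  ring

end IsOrthonormalFamily

/-! ### Correlation functions of projection ensembles -/

/-- Integrating out one variable in the determinant of a reproducing kernel. -/
theorem integral_det_cons {E : Type*} [MeasurableSpace E] {μ : Measure E} {K : E → E → ℂ} {c : ℂ}
    (h1 : Integrable (fun y => K y y) μ) (h1' : ∫ y, K y y ∂μ = c)
    (h2 : ∀ a b, Integrable (fun y => K a y * K y b) μ)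
    (h2' : ∀ a b, ∫ y, K a y * K y b ∂μ = K a b) {m : ℕ} (x : Fin m → E) :
    Integrable (fun y => (Matrix.of fun i j => K (Fin.cons (α := fun _ => E) y x i)
      (Fin.cons (α := fun _ => E) y x j)).det) μ ∧
    ∫ y, (Matrix.of fun i j => K (Fin.cons (α := fun _ => E) y x i)
      (Fin.cons (α := fun _ => E) y x j)).det ∂μ
      = (c - m) * (Matrix.of fun i j => K (x i) (x j)).det := by
  classical
  set S : Equiv.Perm (Fin m) → ℂ := fun σ => ((Equiv.Perm.sign σ : ℤ) : ℂ) with hS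
  set T : Equiv.Perm (Fin m) → ℂ := fun σ => ∏ i, K (x (σ i)) (x i) with hT
  set R : Equiv.Perm (Fin m) → Fin m → ℂ := fun σ i₀ => ∏ i ∈ Finset.univ.erase i₀,
    K (x (σ i)) (x i) with hR
  -- Permutations of m+1 letters are sorted by the image of the letter carrying y. If it is fixed,
  -- K(y,y) splits off. Otherwise y is inserted into a cycle of σ just before q: the sign flips, and
  -- K(x_q, x_{σ⁻¹q}) is replaced by K(x_q, y) K(y, x_{σ⁻¹q}).
  have hexp : ∀ y, (Matrix.of fun i j => K (Fin.cons (α := fun _ => E) y x i)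
      (Fin.cons (α := fun _ => E) y x j)).det
      = (∑ σ, S σ * T σ * K y y) - ∑ q : Fin m, ∑ σ : Equiv.Perm (Fin m),
        S σ * R σ (σ.symm q) * (K (x q) y * K y (x (σ.symm q))) := by
    intro y
    rw [Matrix.det_apply', Fintype.sum_equiv Equiv.Perm.decomposeFin _
      (fun pσ => ((Equiv.Perm.sign (Equiv.Perm.decomposeFin.symm pσ) : ℤ) : ℂ) *
        ∏ i, K (Fin.cons (α := fun _ => E) y x (Equiv.Perm.decomposeFin.symm pσ i))
          (Fin.cons (α := fun _ => E) y x i)) (fun σ => by simp), Fintype.sum_prod_type,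
      Fin.sum_univ_succ, sub_eq_add_neg, ← Finset.sum_neg_distrib]
    congr 1
    · refine Finset.sum_congr rfl fun σ _ => ?_
      rw [Fin.prod_univ_succ]
      simp [hS, hT]
      ring
    · refine Finset.sum_congr rfl fun q _ => ?_
      rw [← Finset.sum_neg_distrib]
      refine Finset.sum_congr rfl fun σ _ => ?_
      rw [Fin.prod_univ_succ, ← Finset.mul_prod_erase Finset.univ _ (Finset.mem_univ (σ.symm q))]
      have hprod : ∏ i ∈ Finset.univ.erase (σ.symm q), K (Fin.cons (α := fun _ => E) y x
            (Equiv.Perm.decomposeFin.symm (q.succ, σ) i.succ))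
            (Fin.cons (α := fun _ => E) y x i.succ) = R σ (σ.symm q) := by
        refine Finset.prod_congr rfl fun i hi => ?_
        have hi' : σ i ≠ q := by
          rintro rfl
          simp at hi
        rw [Equiv.Perm.decomposeFin_symm_apply_succ, Equiv.swap_apply_of_ne_of_ne
          (Fin.succ_ne_zero _) (by simpa using hi'), Fin.cons_succ, Fin.cons_succ]
      rw [hprod]
      simp [hS, Fin.succ_ne_zero]
      ring
  have hi1 : ∀ σ, Integrable (fun y => S σ * T σ * K y y) μ := fun σ => h1.const_mul _
  have hi2 : ∀ (q : Fin m) (σ : Equiv.Perm (Fin m)), Integrable (fun y =>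
      S σ * R σ (σ.symm q) * (K (x q) y * K y (x (σ.symm q)))) μ := fun q σ => (h2 _ _).const_mul _
  simp_rw [hexp]
  have hi1' := integrable_finsetSum Finset.univ fun σ _ => hi1 σ
  have hi2' := integrable_finsetSum Finset.univ fun q _ =>
    integrable_finsetSum Finset.univ fun σ _ => hi2 q σ
  refine ⟨hi1'.sub hi2', ?_⟩
  rw [integral_sub hi1' hi2', integral_finsetSum _ fun σ _ => hi1 σ,
    integral_finsetSum _ fun q _ => integrable_finsetSum Finset.univ fun σ _ => hi2 q σ]
  simp_rw [integral_finsetSum _ fun σ _ => hi2 _ σ, integral_const_mul, h1', h2']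
  have hdet : (Matrix.of fun i j => K (x i) (x j)).det = ∑ σ, S σ * T σ := by
    rw [Matrix.det_apply']; rfl
  -- Integrating y out restores the missing factor, so each of the m values of q gives minus the
  -- full determinant.
  have hRT : ∀ (q : Fin m) (σ : Equiv.Perm (Fin m)),
      S σ * R σ (σ.symm q) * K (x q) (x (σ.symm q)) = S σ * T σ := by
    intro q σ
    rw [hT]
    simp only
    rw [← Finset.mul_prod_erase Finset.univ _ (Finset.mem_univ (σ.symm q)),
      Equiv.apply_symm_apply]
    ring
  simp_rw [hRT, ← Finset.sum_mul, ← hdet]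
  simp
  ring

/-- With A = (ψ_j(x_i)) the matrix is A A*, hence positive semidefinite. -/
theorem det_projectionKernel_nonneg {E : Type*} {n m : ℕ} (ψ : Fin n → E → ℂ) (x : Fin m → E) :
    0 ≤ (Matrix.of fun i j => projectionKernel ψ (x i) (x j)).det.re ∧
      (Matrix.of fun i j => projectionKernel ψ (x i) (x j)).det.im = 0 := by
  open scoped ComplexOrder in
  have h : (Matrix.of fun i j => projectionKernel ψ (x i) (x j))
      = (Matrix.of fun i j => ψ j (x i)) * (Matrix.of fun i j => ψ j (x i)).conjTranspose := by
    ext i j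
    simp [Matrix.mul_apply, projectionKernel]
  have h2 : 0 ≤ (Matrix.of fun i j => projectionKernel ψ (x i) (x j)).det := by
    rw [h]
    exact (Matrix.posSemidef_self_mul_conjTranspose _).det_nonneg
  rw [Complex.nonneg_iff] at h2
  exact ⟨h2.1, h2.2.symm⟩

theorem det_projectionKernel_eq {E : Type*} {n : ℕ} (ψ : Fin n → E → ℂ) (x : Fin n → E) :
    (Matrix.of fun i j => projectionKernel ψ (x i) (x j)).det.re
      = ‖(Matrix.of fun i j => ψ j (x i)).det‖ ^ 2 := by
  have h : (Matrix.of fun i j => projectionKernel ψ (x i) (x j))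
      = (Matrix.of fun i j => ψ j (x i)) * (Matrix.of fun i j => ψ j (x i)).conjTranspose := by
    ext i j
    simp [Matrix.mul_apply, projectionKernel]
  rw [h, Matrix.det_mul, Matrix.det_conjTranspose, Complex.star_def, Complex.mul_conj']
  norm_cast

/-- The matrix factors through dimension n < m, so its rank is too small. -/
theorem det_projectionKernel_eq_zero {E : Type*} {n m : ℕ} (hnm : n < m) (ψ : Fin n → E → ℂ)
    (x : Fin m → E) : (Matrix.of fun i j => projectionKernel ψ (x i) (x j)).det = 0 := by
  have h : (Matrix.of fun i j => projectionKernel ψ (x i) (x j))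
      = (Matrix.of fun i j => ψ j (x i)) * (Matrix.of fun i j => ψ j (x i)).conjTranspose := by
    ext i j
    simp [Matrix.mul_apply, projectionKernel]
  by_contra hne
  have h1 := Matrix.rank_of_isUnit _ ((Matrix.isUnit_iff_isUnit_det _).2 (isUnit_iff_ne_zero.2 hne))
  rw [h] at h1
  have h2 := (Matrix.rank_mul_le_left (Matrix.of fun i j => ψ j (x i))
    (Matrix.of fun i j => ψ j (x i)).conjTranspose).trans (Matrix.rank_le_width _)
  simp at h1
  omega

theorem measurable_det_projectionKernel {E : Type*} [MeasurableSpace E] {n m : ℕ}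
    {ψ : Fin n → E → ℂ} (hψ : ∀ j, Measurable (ψ j)) :
    Measurable fun x : Fin m → E => (Matrix.of fun i j => projectionKernel ψ (x i) (x j)).det :=
  measurable_det_of fun i j => Finset.measurable_sum _ fun k _ =>
    ((hψ k).comp (measurable_pi_apply i)).mul
      (continuous_star.measurable.comp ((hψ k).comp (measurable_pi_apply j)))

namespace IsOrthonormalFamily

variable {E : Type*} [MeasurableSpace E] {μ : Measure E} {n : ℕ} {ψ : Fin n → E → ℂ}

theorem lintegral_det_cons (hψ : IsOrthonormalFamily μ ψ) {m : ℕ} (hm : m ≤ n) (x : Fin m → E) :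
    ∫⁻ y, ENNReal.ofReal (Matrix.of fun i j => projectionKernel ψ
      (Fin.cons (α := fun _ => E) y x i) (Fin.cons (α := fun _ => E) y x j)).det.re ∂μ
      = ((n - m : ℕ) : ℝ≥0∞) *
        ENNReal.ofReal (Matrix.of fun i j => projectionKernel ψ (x i) (x j)).det.re := by
  have h1 : Integrable (fun y => projectionKernel ψ y y) μ :=
    integrable_finsetSum _ fun j _ => hψ.integrable_mul_star j j
  have h1' : ∫ y, projectionKernel ψ y y ∂μ = n := by
    simp only [projectionKernel]
    rw [integral_finsetSum _ fun j _ => hψ.integrable_mul_star j j]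
    simp_rw [hψ.integral_mul_star]
    simp
  have hterm : ∀ a b y, projectionKernel ψ a y * projectionKernel ψ y b
      = ∑ j, ∑ k, ψ j a * star (ψ k b) * (ψ k y * star (ψ j y)) := by
    intro a b y
    rw [projectionKernel, projectionKernel, Finset.sum_mul_sum]
    exact Finset.sum_congr rfl fun j _ => Finset.sum_congr rfl fun k _ => by ring
  have hi : ∀ a b j k, Integrable (fun y => ψ j a * star (ψ k b) * (ψ k y * star (ψ j y))) μ :=
    fun a b j k => (hψ.integrable_mul_star k j).const_mul _
  have h2 : ∀ a b, Integrable (fun y => projectionKernel ψ a y * projectionKernel ψ y b) μ := by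
    intro a b
    simp_rw [hterm]
    exact integrable_finsetSum _ fun j _ => integrable_finsetSum _ fun k _ => hi a b j k
  have h2' : ∀ a b, ∫ y, projectionKernel ψ a y * projectionKernel ψ y b ∂μ
      = projectionKernel ψ a b := by
    intro a b
    simp_rw [hterm]
    rw [integral_finsetSum _ fun j _ => integrable_finsetSum _ fun k _ => hi a b j k]
    simp_rw [integral_finsetSum _ fun k _ => hi a b _ k, integral_const_mul,
      hψ.integral_mul_star]
    simp [projectionKernel]
  obtain ⟨hint, heq⟩ := integral_det_cons h1 h1' h2 h2' x
  refine (ofReal_integral_eq_lintegral_ofReal hint.re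
    (ae_of_all _ fun y => (det_projectionKernel_nonneg ψ _).1)).symm.trans ?_
  rw [integral_re hint, heq, ← ENNReal.ofReal_natCast, ← ENNReal.ofReal_mul (by positivity)]
  congr 1
  have : ((n : ℂ) - m) = (((n - m : ℕ) : ℝ) : ℂ) := by
    rw [Nat.cast_sub hm]; push_cast; rfl
  rw [this]
  exact Complex.re_ofReal_mul _ _

end IsOrthonormalFamily

/-! ### From the joint density to m-point correlations. -/

namespace IsOrthonormalFamily

variable {E : Type*} [MeasurableSpace E] {μ : Measure E} {n : ℕ} {ψ : Fin n → E → ℂ}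

theorem lintegral_tail_mul_det [SigmaFinite μ] (hψ : IsOrthonormalFamily μ ψ) {m : ℕ} (hm : m ≤ n)
    {g : (Fin m → E) → ℝ≥0∞} (hg : Measurable g) :
    ∫⁻ z : Fin (m + 1) → E, g (fun i => z i.succ) *
        ENNReal.ofReal (Matrix.of fun i j => projectionKernel ψ (z i) (z j)).det.re
        ∂(Measure.pi fun _ => μ)
      = ((n - m : ℕ) : ℝ≥0∞) * ∫⁻ x : Fin m → E, g x *
        ENNReal.ofReal (Matrix.of fun i j => projectionKernel ψ (x i) (x j)).det.re
        ∂(Measure.pi fun _ => μ) := by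
  have hmeas : ∀ k, Measurable fun x : Fin k → E => ENNReal.ofReal
      (Matrix.of fun i j => projectionKernel ψ (x i) (x j)).det.re := fun k =>
    ENNReal.measurable_ofReal.comp (Complex.measurable_re.comp
      (measurable_det_projectionKernel hψ.measurable))
  have hG : Measurable fun z : Fin (m + 1) → E => g (fun i => z i.succ) *
      ENNReal.ofReal (Matrix.of fun i j => projectionKernel ψ (z i) (z j)).det.re :=
    (hg.comp (measurable_pi_lambda _ fun i => measurable_pi_apply _)).mul (hmeas _)
  have he := (measurePreserving_piFinSuccAbove (fun _ : Fin (m + 1) => μ) 0).symm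
  refine (he.lintegral_comp hG).symm.trans
    ((lintegral_prod_symm _ (hG.comp he.measurable).aemeasurable).trans ?_)
  refine Eq.trans (lintegral_congr fun x => ?_) (lintegral_const_mul _ (hg.mul (hmeas m)))
  simp only [Function.comp_apply]
  have hcons : ∀ y, (MeasurableEquiv.piFinSuccAbove (fun _ : Fin (m + 1) => E) 0).symm (y, x)
      = Fin.cons (α := fun _ => E) y x := by
    intro y
    simp [MeasurableEquiv.piFinSuccAbove, Fin.insertNthEquiv, Fin.insertNth_zero']
  simp_rw [hcons, Fin.cons_succ]
  rw [lintegral_const_mul, hψ.lintegral_det_cons hm]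
  · ring
  · have h1 : Measurable fun y : E => (Fin.cons (α := fun _ => E) y x : Fin (m + 1) → E) :=
      measurable_pi_lambda _ fun i => Fin.cases (by simpa using measurable_id')
        (fun j => by simp) i
    exact (hmeas _).comp h1

/-- A permutation of the points changes the determinant only by a sign, so the law is exchangeable.
-/
theorem lintegral_comp_perm [SigmaFinite μ] (σ : Equiv.Perm (Fin n))
    {g : (Fin n → E) → ℝ≥0∞} (hg : Measurable g) (hψ : IsOrthonormalFamily μ ψ) :
    ∫⁻ x, g (fun i => x (σ i)) ∂(projectionEnsemble μ ψ)
      = ∫⁻ x, g x ∂(projectionEnsemble μ ψ) := by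
  have hσ : Measurable fun (x : Fin n → E) i => x (σ i) :=
    measurable_pi_lambda _ fun i => measurable_pi_apply _
  rw [projectionEnsemble, lintegral_withDensity_eq_lintegral_mul _ hψ.measurable_density
    (show Measurable fun x : Fin n → E => g fun i => x (σ i) from hg.comp hσ),
    lintegral_withDensity_eq_lintegral_mul _ hψ.measurable_density hg]
  have hmp : MeasurePreserving (fun (x : Fin n → E) i => x (σ i)) (Measure.pi fun _ => μ)
      (Measure.pi fun _ => μ) := by
    have h := measurePreserving_piCongrLeft (fun _ : Fin n => μ) σ.symm
    have he : ⇑(MeasurableEquiv.piCongrLeft (fun _ : Fin n => E) σ.symm)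
        = fun (x : Fin n → E) i => x (σ i) := by
      ext x i
      have := MeasurableEquiv.piCongrLeft_apply_apply (β := fun _ : Fin n => E) σ.symm x (σ i)
      simpa using this
    rwa [he] at h
  rw [← hmp.lintegral_comp (hψ.measurable_density.mul hg)]
  refine lintegral_congr fun x => ?_
  simp only [Pi.mul_apply]
  have : (Matrix.of fun i j => ψ j (x (σ i))).det
      = Equiv.Perm.sign σ * (Matrix.of fun i j => ψ j (x i)).det :=
    Matrix.det_permute σ (Matrix.of fun i j => ψ j (x i))
  rw [this, norm_mul]
  have hs : ‖((Equiv.Perm.sign σ : ℤ) : ℂ)‖ = 1 := by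
    rcases Int.units_eq_one_or (Equiv.Perm.sign σ) with h | h <;> simp [h]
  rw [hs, one_mul]

theorem lintegral_eq_lintegral_det [SigmaFinite μ] (hψ : IsOrthonormalFamily μ ψ)
    {g : (Fin n → E) → ℝ≥0∞} (hg : Measurable g) :
    (n.factorial : ℝ≥0∞) * ∫⁻ x, g x ∂(projectionEnsemble μ ψ)
      = ∫⁻ x : Fin n → E, g x *
        ENNReal.ofReal (Matrix.of fun i j => projectionKernel ψ (x i) (x j)).det.re
        ∂(Measure.pi fun _ => μ) := by
  rw [projectionEnsemble, lintegral_withDensity_eq_lintegral_mul _ hψ.measurable_density hg,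
    ← lintegral_const_mul _ (hψ.measurable_density.mul hg)]
  refine lintegral_congr fun x => ?_
  rw [det_projectionKernel_eq, Pi.mul_apply, ← mul_assoc, mul_comm, ← ENNReal.ofReal_natCast,
    ← ENNReal.ofReal_mul (by positivity)]
  congr 2
  have hn : (n.factorial : ℝ) ≠ 0 := by exact_mod_cast n.factorial_ne_zero
  field_simp

/-- Descending induction from m = n, where the minor is n! times the density. To go from m+1 to m,
one variable is integrated out, producing the factor n-m. The same factor counts the extensions of
an embedding of `Fin m` to `Fin (m + 1)`, and it cancels because m < n. -/
theorem sum_embedding_lintegral [SigmaFinite μ] (hψ : IsOrthonormalFamily μ ψ) {m : ℕ}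
    (hm : m ≤ n) : ∀ {g : (Fin m → E) → ℝ≥0∞}, Measurable g →
    ∑ ι : Fin m ↪ Fin n, ∫⁻ x, g (fun i => x (ι i)) ∂(projectionEnsemble μ ψ)
      = ∫⁻ x : Fin m → E, g x *
        ENNReal.ofReal (Matrix.of fun i j => projectionKernel ψ (x i) (x j)).det.re
        ∂(Measure.pi fun _ => μ) := by
  classical
  induction hm using Nat.decreasingInduction with
  | self =>
    intro g hg
    have h1 : ∀ ι : Fin n ↪ Fin n, ∫⁻ x, g (fun i => x (ι i)) ∂(projectionEnsemble μ ψ)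
        = ∫⁻ x, g x ∂(projectionEnsemble μ ψ) := fun ι =>
      lintegral_comp_perm ι.equivOfFiniteSelfEmbedding hg hψ
    simp_rw [h1]
    rw [← hψ.lintegral_eq_lintegral_det hg]
    simp [Fintype.card_embedding_eq, Nat.descFactorial_self]
  | of_succ m hm ih =>
    intro g hg
    have hg' : Measurable fun z : Fin (m + 1) → E => g (fun i => z i.succ) :=
      hg.comp (measurable_pi_lambda _ fun i => measurable_pi_apply _)
    have h1 := ih hg'
    rw [hψ.lintegral_tail_mul_det (Nat.le_of_succ_le hm) hg] at h1
    replace h1 := (Fintype.sum_equiv (Equiv.embeddingFinSucc m (Fin n)) _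
      (fun p => ∫⁻ x, g (fun i => x (p.1 i)) ∂(projectionEnsemble μ ψ)) (fun _ => rfl)).symm.trans h1
    rw [Fintype.sum_sigma] at h1
    have h2 : ∀ e : Fin m ↪ Fin n, Fintype.card {i // i ∉ Set.range e} = n - m := by
      intro e
      rw [Fintype.card_subtype_compl, Fintype.card_fin]
      congr 1
      exact (Set.card_range_of_injective e.injective).trans (Fintype.card_fin m)
    simp only [Finset.sum_const, Finset.card_univ, h2, nsmul_eq_mul, ← Finset.mul_sum] at h1
    have hne : ((n - m : ℕ) : ℝ≥0∞) ≠ 0 := by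
      have : 0 < n - m := Nat.sub_pos_of_lt hm
      exact_mod_cast this.ne'
    exact (ENNReal.mul_right_inj hne (ENNReal.natCast_ne_top _)).1 h1

/-- The correlation functions of a projection ensemble are the minors of its kernel. -/
theorem lintegral_prod_count [SigmaFinite μ] (hψ : IsOrthonormalFamily μ ψ) {m : ℕ}
    {B : Fin m → Set E} (hB : ∀ i, MeasurableSet (B i))
    (hd : Pairwise fun i j => Disjoint (B i) (B j)) :
    ∫⁻ x, ∏ i, ∑ k, (B i).indicator (1 : E → ℝ≥0∞) (x k) ∂(projectionEnsemble μ ψ)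
      = ∫⁻ x in Set.univ.pi B, ENNReal.ofReal
        (Matrix.of fun i j => projectionKernel ψ (x i) (x j)).det.re
        ∂(Measure.pi fun _ => μ) := by
  classical
  have hind : ∀ i, Measurable ((B i).indicator (1 : E → ℝ≥0∞)) := fun i =>
    measurable_one.indicator (hB i)
  have hg : Measurable fun y : Fin m → E => ∏ i, (B i).indicator (1 : E → ℝ≥0∞) (y i) :=
    Finset.measurable_prod _ fun i _ => (hind i).comp (measurable_pi_apply i)
  have h1 : ∀ x : Fin n → E, ∏ i, ∑ k, (B i).indicator (1 : E → ℝ≥0∞) (x k)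
      = ∑ ι : Fin m ↪ Fin n, ∏ i, (B i).indicator (1 : E → ℝ≥0∞) (x (ι i)) := by
    intro x
    rw [Finset.prod_univ_sum, Fintype.piFinset_univ]
    -- A particle cannot lie in two disjoint sets, so only injective choices of particles
    -- contribute.
    have h2 : ∑ f : Fin m → Fin n, ∏ i, (B i).indicator (1 : E → ℝ≥0∞) (x (f i))
        = ∑ f : Fin m → Fin n with Function.Injective f,
          ∏ i, (B i).indicator (1 : E → ℝ≥0∞) (x (f i)) := by
      refine (Finset.sum_filter_of_ne fun f _ hf => ?_).symm
      intro i j hij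
      by_contra hne
      have hi := Finset.prod_ne_zero_iff.1 hf i (Finset.mem_univ _)
      have hj := Finset.prod_ne_zero_iff.1 hf j (Finset.mem_univ _)
      have hi' : x (f i) ∈ B i := by
        by_contra h; exact hi (Set.indicator_of_notMem h _)
      have hj' : x (f j) ∈ B j := by
        by_contra h; exact hj (Set.indicator_of_notMem h _)
      rw [hij] at hi'
      exact Set.disjoint_left.1 (hd hne) hi' hj'
    rw [h2]
    refine Finset.sum_bij' (fun f hf => ⟨f, (Finset.mem_filter.1 hf).2⟩) (fun ι _ => ⇑ι)
      (fun _ _ => Finset.mem_univ _) (fun ι _ => by simp [ι.injective]) (fun _ _ => rfl)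
      (fun _ _ => rfl) (fun _ _ => rfl)
  simp_rw [h1]
  have hgι : ∀ ι : Fin m ↪ Fin n, Measurable fun x : Fin n → E =>
      ∏ i, (B i).indicator (1 : E → ℝ≥0∞) (x (ι i)) := fun ι => hg.comp
    (measurable_pi_lambda (fun (x : Fin n → E) i => x (ι i)) fun i => measurable_pi_apply _)
  rw [lintegral_finsetSum _ fun ι _ => hgι ι]
  rcases le_or_gt m n with hm | hm
  · rw [hψ.sum_embedding_lintegral hm hg, ← lintegral_indicator
      (MeasurableSet.univ_pi hB)]
    refine lintegral_congr fun y => ?_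
    by_cases hy : y ∈ Set.univ.pi B
    · rw [Set.indicator_of_mem hy, Finset.prod_eq_one fun i _ => ?_, one_mul]
      exact Set.indicator_of_mem (hy i (Set.mem_univ i)) _
    · rw [Set.indicator_of_notMem hy]
      simp only [Set.mem_univ_pi, not_forall] at hy
      obtain ⟨i, hi⟩ := hy
      rw [Finset.prod_eq_zero (Finset.mem_univ i) (Set.indicator_of_notMem hi _), zero_mul]
  -- With more sets than particles, no embedding exists and the minors vanish for reasons of rank.
  · have : IsEmpty (Fin m ↪ Fin n) := by
      rw [← Fintype.card_eq_zero_iff, Fintype.card_embedding_eq]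
      simpa using hm
    rw [Finset.univ_eq_empty, Finset.sum_empty]
    simp_rw [det_projectionKernel_eq_zero hm]
    simp

end IsOrthonormalFamily

/-! ### The space of configurations -/

namespace Configuration

section Linear

variable {X : Type*} [TopologicalSpace X] [MeasurableSpace X]

instance isLocallyFiniteMeasure (ξ : Configuration X) : IsLocallyFiniteMeasure ξ.1 := ξ.2.1

theorem integrable [OpensMeasurableSpace X] (ξ : Configuration X) (f : C_c(X, ℝ)) : Integrable f ξ.1 :=
  f.continuous.integrable_of_hasCompactSupport f.hasCompactSupport

theorem continuous_integral (f : C_c(X, ℝ)) :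
    Continuous fun ξ : Configuration X => ∫ x, f x ∂ξ.1 :=
  (continuous_apply f).comp
    (continuous_induced_dom (f := fun (ξ : Configuration X) (f : C_c(X, ℝ)) => ∫ x, f x ∂ξ.1))

theorem abs_integral_sub_le [OpensMeasurableSpace X] (ξ : Configuration X) {f g h : C_c(X, ℝ)} {δ : ℝ}
    (hfg : ∀ x, |f x - g x| ≤ δ * h x) :
    |∫ x, f x ∂ξ.1 - ∫ x, g x ∂ξ.1| ≤ δ * ∫ x, h x ∂ξ.1 := by
  rw [← integral_sub (ξ.integrable f) (ξ.integrable g), ← integral_const_mul, ← Real.norm_eq_abs]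
  exact norm_integral_le_of_norm_le ((ξ.integrable h).const_mul δ)
    (ae_of_all _ fun x => hfg x)

end Linear

section SecondCountable

variable {X : Type*} [TopologicalSpace X] [LocallyCompactSpace X] [T2Space X]
  [SecondCountableTopology X]

/-- A countable family of test functions determining the vague topology. -/
theorem exists_countable_approx : ∃ D : Set (C_c(X, ℝ)), D.Countable ∧
    ∀ f : C_c(X, ℝ), ∃ h ∈ D, ∀ δ > 0, ∃ g ∈ D, ∀ x, |f x - g x| ≤ δ * h x := by
  classical
  let K : CompactExhaustion X := default
  have hh : ∀ n, ∃ f : C(X, ℝ), EqOn f 1 (K n) ∧ HasCompactSupport f ∧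
      ∀ x, f x ∈ Icc (0 : ℝ) 1 := fun n => by
    obtain ⟨f, h1, -, h2, h3⟩ := exists_continuous_one_zero_of_isCompact (K.isCompact n)
      isClosed_empty (disjoint_empty _)
    exact ⟨f, h1, h2, h3⟩
  choose h h1 hc hI using hh
  let d : ℕ → C(X, ℝ) := TopologicalSpace.denseSeq C(X, ℝ)
  let H : ℕ → C_c(X, ℝ) := fun n => ⟨h n, hc n⟩
  let G : ℕ → ℕ → C_c(X, ℝ) := fun l n => ⟨d l * h n, (hc n).mul_left⟩
  refine ⟨range H ∪ range fun p : ℕ × ℕ => G p.1 p.2,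
    (countable_range _).union (countable_range _), fun f => ?_⟩
  -- A bump equal to 1 on the support of f satisfies f = f h. Approximating f by a dense sequence on
  -- the compact support of h, then multiplying by h, gives an error at most δh.
  obtain ⟨n, hn⟩ := K.exists_superset_of_isCompact f.hasCompactSupport
  refine ⟨H n, Or.inl ⟨n, rfl⟩, fun δ hδ => ?_⟩
  have h2 : ∀ᶠ g : C(X, ℝ) in 𝓝 (f : C(X, ℝ)), ∀ x ∈ tsupport (h n), dist (f x) (g x) < δ := by
    have := ContinuousMap.tendsto_iff_forall_isCompact_tendstoUniformlyOn.1
      (tendsto_id (x := 𝓝 (f : C(X, ℝ)))) _ (hc n)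
    exact Metric.tendstoUniformlyOn_iff.1 this δ hδ
  obtain ⟨l, hl⟩ := (TopologicalSpace.denseRange_denseSeq C(X, ℝ)).exists_mem_open
    isOpen_interior ⟨_, mem_interior_iff_mem_nhds.2 h2⟩
  have hl' := interior_subset hl
  refine ⟨G l n, Or.inr ⟨(l, n), rfl⟩, fun x => ?_⟩
  change |f x - d l x * h n x| ≤ δ * h n x
  have hfh : f x = f x * h n x := by
    by_cases hx : x ∈ tsupport f
    · rw [h1 n (hn hx)]; simp
    · rw [image_eq_zero_of_notMem_tsupport hx]; simp
  rw [hfh, ← sub_mul, abs_mul, abs_of_nonneg (hI n x).1]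
  by_cases hx : x ∈ tsupport (h n)
  · exact mul_le_mul_of_nonneg_right (hl' x hx).le (hI n x).1
  · rw [image_eq_zero_of_notMem_tsupport hx]; simp

/-- The vague topology is induced by countably many functionals. If |f - g| ≤ δh, then ∫ f and ∫ g
differ by at most δ∫h, and ∫h stays bounded near a given configuration. -/
instance secondCountableTopology [MeasurableSpace X] [OpensMeasurableSpace X] :
    SecondCountableTopology (Configuration X) := by
  obtain ⟨D, hD, happ⟩ := exists_countable_approx (X := X)
  have : Countable D := hD.to_subtype
  set Φ : Configuration X → D → ℝ := fun ξ f => ∫ x, f.1 x ∂ξ.1 with hΦ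
  have key : (inferInstance : TopologicalSpace (Configuration X))
      = TopologicalSpace.induced Φ inferInstance := by
    refine le_antisymm ?_ ?_
    · rw [← continuous_iff_le_induced]
      exact continuous_pi fun f => continuous_integral f.1
    · change TopologicalSpace.induced Φ inferInstance ≤ TopologicalSpace.induced
        (fun (ξ : Configuration X) (f : C_c(X, ℝ)) => ∫ x, f x ∂ξ.1) inferInstance
      rw [← continuous_iff_le_induced]
      let τ : TopologicalSpace (Configuration X) := TopologicalSpace.induced Φ inferInstance
      have hc : ∀ f ∈ D, Continuous fun ξ : Configuration X => ∫ x, f x ∂ξ.1 := fun f hf =>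
        (continuous_apply (⟨f, hf⟩ : D)).comp (continuous_induced_dom (f := Φ))
      refine continuous_pi fun f => continuous_iff_continuousAt.2 fun ξ₀ => ?_
      obtain ⟨h, hhD, hh⟩ := happ f
      rw [ContinuousAt, Metric.tendsto_nhds]
      intro ε hε
      set M := |∫ x, h x ∂ξ₀.1| + 1 with hM
      have hMpos : 0 < M := by positivity
      obtain ⟨g, hgD, hg⟩ := hh (ε / (4 * M)) (by positivity)
      have e1 := Metric.tendsto_nhds.1 ((hc h hhD).continuousAt (x := ξ₀)) 1 one_pos
      have e2 := Metric.tendsto_nhds.1 ((hc g hgD).continuousAt (x := ξ₀)) (ε / 2) (by positivity)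
      filter_upwards [e1, e2] with ξ h1 h2
      rw [Real.dist_eq] at h1 h2 ⊢
      have b1 := abs_integral_sub_le ξ hg
      have b2 := abs_integral_sub_le ξ₀ hg
      have c1 : ∫ x, h x ∂ξ.1 ≤ M := by
        have := abs_lt.1 h1
        have := le_abs_self (∫ x, h x ∂ξ₀.1)
        rw [hM]; linarith
      have c2 : ∫ x, h x ∂ξ₀.1 ≤ M := by
        have := le_abs_self (∫ x, h x ∂ξ₀.1)
        rw [hM]; linarith
      have hδ : 0 ≤ ε / (4 * M) := by positivity
      have d1 := b1.trans (mul_le_mul_of_nonneg_left c1 hδ)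
      have d2 := b2.trans (mul_le_mul_of_nonneg_left c2 hδ)
      have hmul : ε / (4 * M) * M = ε / 4 := by field_simp
      rw [hmul] at d1 d2
      rw [abs_lt] at h2 ⊢
      rw [abs_le] at d1 d2
      constructor <;> linarith [h2.1, h2.2, d1.1, d1.2, d2.1, d2.2]
  have := TopologicalSpace.secondCountableTopology_induced (Configuration X) (D → ℝ) Φ
  rwa [← key] at this

end SecondCountable

/-! ### Measurability of the counting maps. -/

section Measurable

variable {X : Type*} [MetricSpace X] [MeasurableSpace X] [BorelSpace X]
  [LocallyCompactSpace X] [SecondCountableTopology X]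

/-- An open set is an increasing union of compact sets. Bumps equal to 1 on these sets and 0 off U
express the count as a countable supremum of vaguely continuous functionals. -/
theorem measurable_count_of_isOpen {U : Set X} (hU : IsOpen U) :
    Measurable fun ξ : Configuration X => ξ.count U := by
  obtain ⟨F, hFc, hFU, hFi, hFm⟩ := hU.exists_iUnion_isClosed
  let K : CompactExhaustion X := default
  have hK : ∀ n, IsCompact (F n ∩ K n) := fun n => (K.isCompact n).inter_left (hFc n)
  have hf : ∀ n, ∃ f : C_c(X, ℝ), EqOn f 1 (F n ∩ K n) ∧ EqOn f 0 Uᶜ ∧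
      ∀ x, f x ∈ Icc (0 : ℝ) 1 := fun n => by
    obtain ⟨f, h1, h2, h3, h4⟩ := exists_continuous_one_zero_of_isCompact (hK n)
      hU.isClosed_compl (disjoint_compl_right_iff_subset.2 (inter_subset_left.trans (hFU n)))
    exact ⟨⟨f, h3⟩, h1, h2, h4⟩
  choose f h1 h0 hI using hf
  have key : (fun ξ : Configuration X => ξ.count U)
      = fun ξ => ⨆ n, ENNReal.ofReal (∫ x, f n x ∂ξ.1) := by
    ext ξ
    have hlint : ∀ n, ENNReal.ofReal (∫ x, f n x ∂ξ.1) = ∫⁻ x, ENNReal.ofReal (f n x) ∂ξ.1 :=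
      fun n => ofReal_integral_eq_lintegral_ofReal (ξ.integrable _)
        (ae_of_all _ fun x => (hI n x).1)
    refine le_antisymm ?_ (iSup_le fun n => ?_)
    · have hU' : U = ⋃ n, F n ∩ K n := by
        refine Subset.antisymm (fun x hx => ?_)
          (iUnion_subset fun n => inter_subset_left.trans (hFU n))
        rw [← hFi] at hx
        obtain ⟨n, hn⟩ := mem_iUnion.1 hx
        obtain ⟨m, hm⟩ := K.exists_mem x
        exact mem_iUnion.2 ⟨max n m, hFm (le_max_left n m) hn, K.subset (le_max_right n m) hm⟩
      rw [count, hU', Monotone.measure_iUnion fun a b hab =>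
        inter_subset_inter (hFm hab) (K.subset hab)]
      refine iSup_mono fun n => ?_
      rw [hlint, ← lintegral_indicator_one (hK n).measurableSet]
      refine lintegral_mono fun x => indicator_le (f := 1) (s := F n ∩ K n)
        (g := fun x => ENNReal.ofReal (f n x)) (fun y hy => ?_) x
      rw [h1 n hy]; simp
    · rw [hlint, count, ← lintegral_indicator_one hU.measurableSet]
      refine lintegral_mono fun x => ?_
      by_cases hx : x ∈ U
      · rw [indicator_of_mem hx]
        exact ENNReal.ofReal_le_one.2 (hI n x).2
      · rw [h0 n hx]; simp
  rw [key]
  exact .iSup fun n => ENNReal.measurable_ofReal.comp (continuous_integral (f n)).measurable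

/-- Open sets form a generating π-system. Restricting to the interiors of a compact exhaustion makes
the measures finite, so that the π-system argument applies. -/
theorem measurable_count {B : Set X} (hB : MeasurableSet B) :
    Measurable fun ξ : Configuration X => ξ.count B := by
  let K : CompactExhaustion X := default
  have hfin : ∀ (n : ℕ) (ξ : Configuration X), IsFiniteMeasure (ξ.1.restrict (interior (K n))) :=
    fun n ξ => ⟨by
      rw [Measure.restrict_apply_univ]
      exact (measure_mono interior_subset).trans_lt (K.isCompact n).measure_lt_top⟩
  have hn : ∀ n, Measurable fun ξ : Configuration X => ξ.1.restrict (interior (K n)) := fun n => by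
    refine Measurable.measure_of_isPiSystem (S := {s | IsOpen s}) (BorelSpace.measurable_eq (α := X)) isPiSystem_isOpen (fun s hs => ?_) ?_
    · simp_rw [Measure.restrict_apply (IsOpen.measurableSet hs)]
      exact measurable_count_of_isOpen (IsOpen.inter hs isOpen_interior)
    · simp_rw [Measure.restrict_apply_univ]
      exact measurable_count_of_isOpen isOpen_interior
  have hU : ⋃ n, interior (K n) = univ := by
    refine eq_univ_of_forall fun x => ?_
    obtain ⟨n, hn⟩ := K.exists_mem x
    exact mem_iUnion.2 ⟨n + 1, K.subset_interior_succ n hn⟩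
  have key : (fun ξ : Configuration X => ξ.count B)
      = fun ξ => ⨆ n, ξ.1.restrict (interior (K n)) B := by
    ext ξ
    simp_rw [Measure.restrict_apply hB]
    rw [count, ← Monotone.measure_iUnion fun a b hab => inter_subset_inter_right _
      (interior_mono (K.subset hab)), ← inter_iUnion, hU, inter_univ]
  rw [key]
  exact .iSup fun n => (Measure.measurable_coe hB).comp (hn n)

end Measurable

end Configuration

/-! ### Weak convergence of point processes -/

namespace Configuration

section Levy

variable {X : Type*} [TopologicalSpace X] [MeasurableSpace X]

/-- The integrals of finitely many test functions. -/
noncomputable def finiteIntegrals (J : Finset (C_c(X, ℝ))) (ξ : Configuration X) :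
    EuclideanSpace ℝ J :=
  WithLp.toLp 2 fun f => ∫ x, f.1 x ∂ξ.1

theorem continuous_finiteIntegrals (J : Finset (C_c(X, ℝ))) :
    Continuous (finiteIntegrals (X := X) J) :=
  (PiLp.continuous_toLp 2 _).comp (continuous_pi fun f => continuous_integral f.1)

variable [OpensMeasurableSpace X]

/-- By linearity in the test function, the characteristic function of a finite-dimensional marginal
is a value of the characteristic functional. One-function convergence thus controls joint laws. -/
theorem charFun_map_finiteIntegrals (J : Finset (C_c(X, ℝ)))
    (μ : Measure (Configuration X)) (t : EuclideanSpace ℝ J) :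
    charFun (μ.map (finiteIntegrals J)) t
      = ∫ ξ, Complex.exp (Complex.I * (∫ x, (∑ f : J, t f • f.1 : C_c(X, ℝ)) x ∂ξ.1 : ℝ)) ∂μ := by
  rw [charFun_apply, integral_map (continuous_finiteIntegrals J).measurable.aemeasurable]
  · refine integral_congr_ae (ae_of_all _ fun ξ => ?_)
    simp only
    rw [mul_comm]
    congr 3
    have h1 : ∫ x, (∑ f : J, t f • f.1 : C_c(X, ℝ)) x ∂ξ.1
        = ∫ x, ∑ f : J, t f * f.1 x ∂ξ.1 := by
      refine integral_congr_ae (ae_of_all _ fun x => ?_)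
      simp [CompactlySupportedContinuousMap.sum_apply]
    rw [h1, integral_finsetSum _ fun f _ => (ξ.integrable f.1).const_mul _]
    simp_rw [integral_const_mul]
    simp [PiLp.inner_apply, finiteIntegrals]
  · exact Continuous.aestronglyMeasurable (by fun_prop)

variable [LocallyCompactSpace X] [T2Space X] [SecondCountableTopology X]

/-- Cylinders over finitely many test functions form a neighbourhood base stable under finite
unions. Up to a small loss of μ-mass, an open set contains one cylinder, and on it Lévy's theorem in
finite dimension gives the bound. The limit is a given probability measure, so no tightness argument
is needed. -/
theorem le_liminf_of_tendsto_integral_exp {μs : ℕ → ProbabilityMeasure (Configuration X)}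
    {μ : ProbabilityMeasure (Configuration X)}
    (h : ∀ f : C_c(X, ℝ), Tendsto
      (fun n => ∫ ξ, Complex.exp (Complex.I * (∫ x, f x ∂ξ.1 : ℝ)) ∂(μs n : Measure (Configuration X))) atTop
      (𝓝 (∫ ξ, Complex.exp (Complex.I * (∫ x, f x ∂ξ.1 : ℝ)) ∂(μ : Measure (Configuration X)))))
    {G : Set (Configuration X)} (hG : IsOpen G) :
    μ G ≤ liminf (fun n => μs n G) atTop := by
  classical
  set S : Set (Set (Configuration X)) := {A | ∃ J : Finset (C_c(X, ℝ)),
    ∃ O : Set (EuclideanSpace ℝ J), IsOpen O ∧ A = finiteIntegrals J ⁻¹' O} with hS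
  have hmono : ∀ {J J' : Finset (C_c(X, ℝ))}, J ⊆ J' → ∀ O : Set (EuclideanSpace ℝ J), IsOpen O →
      ∃ O' : Set (EuclideanSpace ℝ J'), IsOpen O' ∧
        finiteIntegrals J ⁻¹' O = finiteIntegrals J' ⁻¹' O' := by
    intro J J' hJ O hO
    refine ⟨(fun v => WithLp.toLp 2 fun f : J => v ⟨f.1, hJ f.2⟩) ⁻¹' O, hO.preimage ?_, rfl⟩
    exact (PiLp.continuous_toLp 2 _).comp (continuous_pi fun f => by fun_prop)
  have hnhds : ∀ u : Set (Configuration X), IsOpen u → ∀ ξ ∈ u, ∃ s ∈ S, s ∈ 𝓝 ξ ∧ s ⊆ u := by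
    intro u hu ξ hξ
    obtain ⟨O, hO, rfl⟩ := isOpen_induced_iff.1 hu
    obtain ⟨J, v, hv, hvO⟩ := isOpen_pi_iff.1 hO _ hξ
    have hop : IsOpen {w : EuclideanSpace ℝ J | ∀ f : J, w f ∈ v f.1} := by
      simp only [ofPred_forall]
      exact isOpen_iInter_of_finite fun f => (hv f.1 f.2).1.preimage (by fun_prop)
    refine ⟨_, ⟨J, _, hop, rfl⟩, (hop.preimage (continuous_finiteIntegrals J)).mem_nhds
      fun f => (hv f.1 f.2).2, fun ζ hζ => hvO fun f hf => hζ ⟨f, hf⟩⟩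
  have hunion : ∀ T : Finset (Set (Configuration X)), (∀ t ∈ T, t ∈ S) → (⋃ t ∈ T, t) ∈ S := by
    intro T hT
    induction T using Finset.induction_on with
    | empty => exact ⟨∅, ∅, isOpen_empty, by simp⟩
    | insert a T _ ih =>
      obtain ⟨J, O, hO, h1⟩ := ih fun t ht => hT t (Finset.mem_insert_of_mem ht)
      obtain ⟨J', O', hO', h2⟩ := hT a (Finset.mem_insert_self _ _)
      obtain ⟨U, hU, h3⟩ := hmono (Finset.subset_union_left (s₁ := J) (s₂ := J')) O hO
      obtain ⟨U', hU', h4⟩ := hmono (Finset.subset_union_right (s₁ := J) (s₂ := J')) O' hO'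
      refine ⟨J ∪ J', U' ∪ U, hU'.union hU, ?_⟩
      rw [Finset.set_biUnion_insert, h1, h2, h3, h4, preimage_union]
  refine (le_liminf_iff (isCoboundedUnder_ge_of_le (x := 1) atTop (by simp))
    (by isBoundedDefault)).2 fun r hr => ?_
  obtain ⟨T, hTS, hrT, hTG⟩ := μ.exists_lt_measure_biUnion_of_isOpen hnhds hG hr
  obtain ⟨J, O, hO, hTO⟩ := hunion T hTS
  have hm : ∀ ν : Measure (Configuration X), AEMeasurable (finiteIntegrals J) ν := fun ν =>
    (continuous_finiteIntegrals J).measurable.aemeasurable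
  have hconv : Tendsto (fun n => (μs n).map (hm (μs n))) atTop
      (𝓝 (μ.map (hm μ))) := by
    refine ProbabilityMeasure.tendsto_of_tendsto_charFun fun t => ?_
    simp only [ProbabilityMeasure.toMeasure_map, charFun_map_finiteIntegrals]
    exact h _
  have hlim := ProbabilityMeasure.le_liminf_measure_open_of_tendsto hconv hO
  have hlt : (r : ℝ≥0∞) < liminf (fun n => ((μs n).map (hm (μs n)) :
      Measure (EuclideanSpace ℝ J)) O) atTop := by
    refine lt_of_lt_of_le ?_ hlim
    rw [ProbabilityMeasure.toMeasure_map, Measure.map_apply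
      (continuous_finiteIntegrals J).measurable hO.measurableSet, ← hTO,
      ← ProbabilityMeasure.ennreal_coeFn_eq_coeFn_toMeasure]
    exact_mod_cast hrT
  filter_upwards [eventually_lt_of_lt_liminf hlt] with n hn
  rw [ProbabilityMeasure.toMeasure_map, Measure.map_apply
    (continuous_finiteIntegrals J).measurable hO.measurableSet, ← hTO,
    ← ProbabilityMeasure.ennreal_coeFn_eq_coeFn_toMeasure] at hn
  exact (ENNReal.coe_lt_coe.1 hn).trans_le ((μs n).apply_mono hTG)

theorem tendsto_of_tendsto_integral_exp {μs : ℕ → ProbabilityMeasure (Configuration X)}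
    {μ : ProbabilityMeasure (Configuration X)}
    (h : ∀ f : C_c(X, ℝ), Tendsto
      (fun n => ∫ ξ, Complex.exp (Complex.I * (∫ x, f x ∂ξ.1 : ℝ)) ∂(μs n : Measure (Configuration X))) atTop
      (𝓝 (∫ ξ, Complex.exp (Complex.I * (∫ x, f x ∂ξ.1 : ℝ)) ∂(μ : Measure (Configuration X))))) :
    Tendsto μs atTop (𝓝 μ) :=
  tendsto_of_forall_isOpen_le_liminf fun _ hG => le_liminf_of_tendsto_integral_exp h hG

/-- A constant sequence in the preceding bound compares the two measures on open sets, in both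
directions. -/
theorem ext_of_integral_exp {μ ν : Measure (Configuration X)} [IsProbabilityMeasure μ]
    [IsProbabilityMeasure ν]
    (h : ∀ f : C_c(X, ℝ), ∫ ξ, Complex.exp (Complex.I * (∫ x, f x ∂ξ.1 : ℝ)) ∂μ
      = ∫ ξ, Complex.exp (Complex.I * (∫ x, f x ∂ξ.1 : ℝ)) ∂ν) : μ = ν := by
  have key : ∀ {μ ν : Measure (Configuration X)} [IsProbabilityMeasure μ] [IsProbabilityMeasure ν],
      (∀ f : C_c(X, ℝ), ∫ ξ, Complex.exp (Complex.I * (∫ x, f x ∂ξ.1 : ℝ)) ∂μ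
      = ∫ ξ, Complex.exp (Complex.I * (∫ x, f x ∂ξ.1 : ℝ)) ∂ν) →
      ∀ {G : Set (Configuration X)}, IsOpen G → μ G ≤ ν G := by
    intro μ ν _ _ h G hG
    let μ' : ProbabilityMeasure (Configuration X) := ⟨μ, inferInstance⟩
    let ν' : ProbabilityMeasure (Configuration X) := ⟨ν, inferInstance⟩
    have h1 : μ' G ≤ liminf (fun _ : ℕ => ν' G) atTop :=
      le_liminf_of_tendsto_integral_exp (fun f => by
        simp only [μ', ν', ProbabilityMeasure.coe_mk, h f]; exact tendsto_const_nhds) hG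
    rw [liminf_const] at h1
    have h2 : ((μ' G : NNReal) : ℝ≥0∞) ≤ (ν' G : NNReal) := ENNReal.coe_le_coe.2 h1
    rw [ProbabilityMeasure.ennreal_coeFn_eq_coeFn_toMeasure,
      ProbabilityMeasure.ennreal_coeFn_eq_coeFn_toMeasure] at h2
    exact h2
  refine ext_of_generate_finite _ (BorelSpace.measurable_eq (α := Configuration X))
    isPiSystem_isOpen (fun G hG => le_antisymm (key h hG) (key (fun f => (h f).symm) hG)) (by simp)

end Levy

end Configuration

/-! ### Uniqueness of determinantal processes with boundedly many points -/

/-- The membership pattern of a point in the first `l` sets of a sequence. -/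
noncomputable def membershipCode {X : Type*} (b : ℕ → Set X) (l : ℕ) (x : X) : Fin l → Bool :=
  open Classical in fun i => decide (x ∈ b i)

/-- The points with a given membership pattern. -/
def membershipCell {X : Type*} (b : ℕ → Set X) (l : ℕ) (s : Fin l → Bool) : Set X :=
  {x | membershipCode b l x = s}

theorem mem_membershipCell_code {X : Type*} (b : ℕ → Set X) (l : ℕ) (x : X) :
    x ∈ membershipCell b l (membershipCode b l x) := rfl

theorem disjoint_membershipCell {X : Type*} (b : ℕ → Set X) (l : ℕ) {s t : Fin l → Bool}
    (hst : s ≠ t) : Disjoint (membershipCell b l s) (membershipCell b l t) :=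
  Set.disjoint_left.2 fun _ hx hy => hst (hx.symm.trans hy)

theorem measurableSet_membershipCell {X : Type*} [MeasurableSpace X] {b : ℕ → Set X}
    (hb : ∀ i, MeasurableSet (b i)) (l : ℕ) (s : Fin l → Bool) :
    MeasurableSet (membershipCell b l s) := by
  classical
  have : membershipCell b l s = ⋂ i : Fin l, {x | x ∈ b i ↔ s i = true} := by
    ext x
    simp only [membershipCell, membershipCode, mem_ofPred_eq, mem_iInter, funext_iff]
    refine forall_congr' fun i => ?_
    by_cases h : x ∈ b i <;> cases s i <;> simp [h]
  rw [this]
  refine MeasurableSet.iInter fun i => ?_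
  by_cases h : s i = true
  · simpa [h] using hb i
  · have : {x | x ∈ b i ↔ s i = true} = (b i)ᶜ := by ext; simp [h]
    rw [this]
    exact (hb i).compl

theorem mem_of_membershipCode_eq {X : Type*} {b : ℕ → Set X} {l i : ℕ} (hi : i < l) {x y : X}
    (h : membershipCode b l x = membershipCode b l y) (hx : x ∈ b i) : y ∈ b i := by
  have := congrFun h ⟨i, hi⟩
  simpa [membershipCode, hx] using this

/-- A basis separates any two distinct points, and finitely many pairs need only finitely many basis
elements. -/
theorem eventually_injOn_membershipCode {X : Type*} [TopologicalSpace X] [T1Space X]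
    {b : ℕ → Set X} (hb : TopologicalSpace.IsTopologicalBasis (range b)) (T : Finset X) :
    ∀ᶠ l in atTop, InjOn (membershipCode b l) T := by
  have h1 : ∀ x ∈ T, ∀ y ∈ T, ∀ᶠ l in atTop, membershipCode b l x = membershipCode b l y → x = y := by
    intro x _ y _
    by_cases hxy : x = y
    · exact Eventually.of_forall fun _ _ => hxy
    · obtain ⟨_, ⟨i, rfl⟩, hxi, hiy⟩ := hb.exists_subset_of_mem_open
        (show x ∈ ({y}ᶜ : Set X) from hxy) isOpen_compl_singleton
      filter_upwards [eventually_gt_atTop i] with l hl h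
      exact absurd rfl (hiy (mem_of_membershipCode_eq hl h hxi))
  have h2 := (Filter.eventually_all_finset T).2 fun x hx => (Filter.eventually_all_finset T).2 (h1 x hx)
  filter_upwards [h2] with l hl x hx y hy h
  exact hl x hx y hy h

namespace Configuration

theorem count_eq_zero_or_one_le {X : Type*} [TopologicalSpace X] [MeasurableSpace X] (ξ : Configuration X) {s : Set X} (hs : MeasurableSet s) :
    ξ.count s = 0 ∨ 1 ≤ ξ.count s := by
  obtain ⟨m, hm⟩ := ξ.2.2 s hs
  rw [count, hm]
  by_cases h : m = 0
  · left; simp [h]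
  · right
    have : 1 ≤ m := Order.one_le_iff_ne_zero.2 h
    exact_mod_cast this

variable {X : Type*} [MetricSpace X] [MeasurableSpace X] [BorelSpace X]
  [SecondCountableTopology X]

/-- Counts are integers. Around a point that is not an atom, the measure of small closed balls tends
to 0, so some ball has count below 1, that is 0. Locally null sets are null by second countability.
-/
theorem count_compl_atoms (ξ : Configuration X) : ξ.count {x | ξ.count {x} ≠ 0}ᶜ = 0 := by
  refine measure_null_of_locally_null _ fun x hx => ?_
  have hx0 : ξ.1 {x} = 0 := by simpa [count] using hx
  obtain ⟨V, hV, hVfin⟩ := ξ.1.finiteAt_nhds x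
  obtain ⟨R, hR, hRV⟩ := Metric.nhds_basis_closedBall.mem_iff.1 hV
  have hlim := tendsto_measure_cthickening_of_isClosed (μ := ξ.1) (s := {x})
    ⟨R, hR, by
      rw [Metric.cthickening_singleton _ hR.le]
      exact ((measure_mono hRV).trans_lt hVfin).ne⟩ isClosed_singleton
  rw [hx0] at hlim
  have h1 := (hlim.eventually_lt_const one_pos).filter_mono
    (nhdsWithin_le_nhds (s := Ioi (0 : ℝ)))
  obtain ⟨r, hr1, hr0⟩ := (h1.and self_mem_nhdsWithin).exists
  replace hr0 : 0 < r := hr0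
  rw [Metric.cthickening_singleton _ hr0.le] at hr1
  refine ⟨Metric.closedBall x r, mem_nhdsWithin_of_mem_nhds (Metric.closedBall_mem_nhds x hr0), ?_⟩
  rcases ξ.count_eq_zero_or_one_le (Metric.isClosed_closedBall (x := x) (ε := r)).measurableSet
    with h | h
  · exact h
  · exact absurd h (not_le.2 hr1)

theorem eq_sum_dirac_of_finite_atoms (ξ : Configuration X) (hξ : ∀ x, ξ.count {x} ≤ 1)
    (T : Finset X) (hT : {x | ξ.count {x} ≠ 0} = T) : ξ.1 = ∑ z ∈ T, Measure.dirac z := by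
  refine Measure.ext fun s hs => ?_
  have h0 : ξ.1 (T : Set X)ᶜ = 0 := by
    rw [← hT]; exact ξ.count_compl_atoms
  have h2 : ξ.1 (s \ T) = 0 := measure_mono_null (fun x hx => hx.2) h0
  rw [← measure_inter_add_sdiff s T.measurableSet, h2, add_zero, Measure.finsetSum_apply]
  have h1 : s ∩ T = ⋃ z ∈ T, s ∩ {z} := by ext; simp
  rw [h1, measure_biUnion_finset (fun x _ y _ hxy => Disjoint.mono inter_subset_right
    inter_subset_right (disjoint_singleton.2 hxy)) fun z _ => hs.inter (measurableSet_singleton z)]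
  refine Finset.sum_congr rfl fun z hz => ?_
  rw [Measure.dirac_apply' _ hs]
  by_cases hzs : z ∈ s
  · rw [inter_eq_self_of_subset_right (singleton_subset_iff.2 hzs), indicator_of_mem hzs, Pi.one_apply]
    have hz' : z ∈ {x | ξ.count {x} ≠ 0} := by rw [hT]; exact hz
    exact le_antisymm (hξ z) ((ξ.count_eq_zero_or_one_le (measurableSet_singleton z)).resolve_left
      hz')
  · rw [inter_singleton_eq_empty.2 hzs, indicator_of_notMem hzs, measure_empty]

/-- Distinct atoms eventually occupy distinct cells, so a bound on the number of occupied cells,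
uniform in the level, bounds the number of atoms. -/
theorem exists_finset_eq_sum_dirac {b : ℕ → Set X} (hb : TopologicalSpace.IsTopologicalBasis (range b))
    (ξ : Configuration X) (hξ : ∀ x, ξ.count {x} ≤ 1) (M : ℕ)
    (hM : ∀ l, ∀ s : Finset (Fin l → Bool), (∀ t ∈ s, ξ.count (membershipCell b l t) ≠ 0) →
      s.card ≤ M) :
    ∃ T : Finset X, T.card ≤ M ∧ ξ.1 = ∑ z ∈ T, Measure.dirac z := by
  classical
  set S : Set X := {x | ξ.count {x} ≠ 0} with hS
  have hcard : ∀ T : Finset X, (T : Set X) ⊆ S → T.card ≤ M := by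
    intro T hTS
    obtain ⟨l, hl⟩ := (eventually_injOn_membershipCode hb T).exists
    rw [← Finset.card_image_of_injOn hl]
    refine hM l _ fun t ht => ?_
    obtain ⟨x, hx, rfl⟩ := Finset.mem_image.1 ht
    have h1 : ξ.count {x} ≠ 0 := hTS hx
    refine fun h0 => h1 (measure_mono_null ?_ h0)
    exact singleton_subset_iff.2 (mem_membershipCell_code b l x)
  have hfin : S.Finite := by
    by_contra hinf
    obtain ⟨T, hTS, hTc⟩ := Set.Infinite.exists_subset_card_eq hinf (M + 1)
    have := hcard T hTS
    omega
  refine ⟨hfin.toFinset, hcard _ (by simp), ξ.eq_sum_dirac_of_finite_atoms hξ _ (by simp [hS])⟩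

end Configuration

/-! ### Factorial moments on cells and the characteristic functional. -/

namespace Configuration

/-- The product of `exp (i f)` over the points of a configuration, computed on the cells. -/
noncomputable def cellProduct {X : Type*} [TopologicalSpace X] [MeasurableSpace X] (b : ℕ → Set X) (c : ∀ l, (Fin l → Bool) → ℂ) (l : ℕ)
    (ξ : Configuration X) : ℂ :=
  ∏ s, (1 + c l s * ((ξ.count (membershipCell b l s)).toReal : ℂ))

theorem toReal_count_eq_sum {X : Type*} [TopologicalSpace X] [MeasurableSpace X]
    {ξ : Configuration X} {T : Finset X}
    (hT : ξ.1 = ∑ z ∈ T, Measure.dirac z) {B : Set X} (hB : MeasurableSet B) :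
    (ξ.count B).toReal = ∑ z ∈ T, B.indicator (1 : X → ℝ) z := by
  rw [count, hT, Measure.finsetSum_apply, ENNReal.toReal_sum]
  · refine Finset.sum_congr rfl fun z _ => ?_
    rw [Measure.dirac_apply' _ hB]
    by_cases hz : z ∈ B <;> simp [hz]
  · intro z _
    exact measure_ne_top _ _

theorem norm_cellProduct_le {X : Type*} [TopologicalSpace X] [MeasurableSpace X] {b : ℕ → Set X} (hb : ∀ i, MeasurableSet (b i))
    {c : ∀ l, (Fin l → Bool) → ℂ} (hc : ∀ l s, ‖c l s‖ ≤ 2) {M : ℕ} {ξ : Configuration X}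
    {T : Finset X} (hTM : T.card ≤ M) (hT : ξ.1 = ∑ z ∈ T, Measure.dirac z) (l : ℕ) :
    ‖cellProduct b c l ξ‖ ≤ Real.exp (2 * M) := by
  classical
  rw [cellProduct, norm_prod]
  have h1 : ∀ s : Fin l → Bool, ‖1 + c l s * ((ξ.count (membershipCell b l s)).toReal : ℂ)‖
      ≤ Real.exp (2 * (ξ.count (membershipCell b l s)).toReal) := fun s => by
    refine (norm_add_le _ _).trans ?_
    rw [norm_mul, norm_one, Complex.norm_real, Real.norm_of_nonneg ENNReal.toReal_nonneg]
    have := mul_le_mul_of_nonneg_right (hc l s)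
      (ENNReal.toReal_nonneg (a := ξ.count (membershipCell b l s)))
    have := Real.add_one_le_exp (2 * (ξ.count (membershipCell b l s)).toReal)
    linarith
  refine (Finset.prod_le_prod (fun _ _ => norm_nonneg _) fun s _ => h1 s).trans ?_
  rw [← Real.exp_sum, ← Finset.mul_sum]
  refine Real.exp_le_exp.2 (mul_le_mul_of_nonneg_left ?_ two_pos.le)
  simp_rw [toReal_count_eq_sum hT (measurableSet_membershipCell hb l _)]
  rw [Finset.sum_comm]
  have h2 : ∀ z ∈ T, ∑ s : Fin l → Bool, (membershipCell b l s).indicator (1 : X → ℝ) z = 1 := by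
    intro z _
    rw [Finset.sum_eq_single (membershipCode b l z)]
    · exact indicator_of_mem (mem_membershipCell_code b l z) _
    · exact fun s _ hs => indicator_of_notMem (fun h => hs h.symm) _
    · simp
  rw [Finset.sum_congr rfl h2]
  simpa using hTM

variable {X : Type*} [MetricSpace X] [MeasurableSpace X] [BorelSpace X]
  [SecondCountableTopology X]

/-- Once the points lie in different cells, every count is 0 or 1 and the product runs over the
points, with f evaluated at another point y of the same cell. Since the cells refine a basis, y
tends to the actual point. -/
theorem tendsto_cellProduct {b : ℕ → Set X} (hb : TopologicalSpace.IsTopologicalBasis (range b))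
    (hbm : ∀ i, MeasurableSet (b i)) (f : C_c(X, ℝ)) {c : ∀ l, (Fin l → Bool) → ℂ}
    (hc : ∀ l z, ∃ y, membershipCode b l y = membershipCode b l z ∧
      1 + c l (membershipCode b l z) = Complex.exp (Complex.I * f y))
    {ξ : Configuration X} {T : Finset X} (hT : ξ.1 = ∑ z ∈ T, Measure.dirac z) :
    Tendsto (fun l => cellProduct b c l ξ) atTop
      (𝓝 (Complex.exp (Complex.I * (∫ x, f x ∂ξ.1 : ℝ)))) := by
  classical
  choose y hy hcy using hc
  have hylim : ∀ z, Tendsto (fun l => y l z) atTop (𝓝 z) := by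
    intro z
    rw [tendsto_nhds]
    intro U hU hz
    obtain ⟨_, ⟨i, rfl⟩, hzi, hiU⟩ := hb.exists_subset_of_mem_open hz hU
    filter_upwards [eventually_gt_atTop i] with l hl
    exact hiU (mem_of_membershipCode_eq hl (hy l z).symm hzi)
  have hint : ∫ x, f x ∂ξ.1 = ∑ z ∈ T, f z := by
    rw [hT, integral_finsetSum_measure fun z _ => ?_]
    · exact Finset.sum_congr rfl fun z _ => integral_dirac _ _
    · exact integrable_dirac (by simp)
  have hlim : Tendsto (fun l => ∏ z ∈ T, Complex.exp (Complex.I * f (y l z))) atTop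
      (𝓝 (Complex.exp (Complex.I * (∫ x, f x ∂ξ.1 : ℝ)))) := by
    rw [hint]
    push_cast
    rw [Finset.mul_sum, Complex.exp_sum]
    refine tendsto_finsetProd _ fun z _ => ?_
    have hcont : Continuous fun x => Complex.exp (Complex.I * f x) := by
      have := f.continuous
      fun_prop
    exact (hcont.tendsto z).comp (hylim z)
  refine hlim.congr' ?_
  filter_upwards [eventually_injOn_membershipCode hb T] with l hl
  have hcount : ∀ s, (ξ.count (membershipCell b l s)).toReal
      = if s ∈ T.image (membershipCode b l) then 1 else 0 := by
    intro s
    rw [toReal_count_eq_sum hT (measurableSet_membershipCell hbm l s)]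
    split_ifs with hs
    · obtain ⟨z, hz, rfl⟩ := Finset.mem_image.1 hs
      rw [Finset.sum_eq_single_of_mem z hz]
      · exact indicator_of_mem (mem_membershipCell_code b l z) _
      · exact fun w hw hwz => indicator_of_notMem
          (fun h : w ∈ membershipCell b l _ => hwz (hl hw hz h)) _
    · exact Finset.sum_eq_zero fun z hz =>
        indicator_of_notMem
          (fun h : z ∈ membershipCell b l s => hs (Finset.mem_image.2 ⟨z, hz, h⟩)) _
  rw [cellProduct, ← Finset.prod_subset (Finset.subset_univ (T.image (membershipCode b l)))]
  · rw [Finset.prod_image hl]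
    refine Finset.prod_congr rfl fun z hz => ?_
    rw [hcount, if_pos (Finset.mem_image_of_mem _ hz), ← hcy l z]
    simp
  · intro s _ hs
    rw [hcount, if_neg hs]
    simp

theorem lintegral_prod_count_finset {X : Type*} [TopologicalSpace X] [MeasurableSpace X]
    {ι : Type*} [Finite ι] {F F₀ : Measure (Configuration X)}
    (h : ∀ (m : ℕ) (B : Fin m → Set X), (∀ i, MeasurableSet (B i)) →
      Pairwise (fun i j => Disjoint (B i) (B j)) →
      ∫⁻ ξ, ∏ i, ξ.count (B i) ∂F = ∫⁻ ξ, ∏ i, ξ.count (B i) ∂F₀)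
    {B : ι → Set X} (hB : ∀ i, MeasurableSet (B i)) (hd : Pairwise fun i j => Disjoint (B i) (B j))
    (t : Finset ι) :
    ∫⁻ ξ, ∏ i ∈ t, ξ.count (B i) ∂F = ∫⁻ ξ, ∏ i ∈ t, ξ.count (B i) ∂F₀ := by
  have key : ∀ ξ : Configuration X, ∏ i ∈ t, ξ.count (B i)
      = ∏ k : Fin t.card, ξ.count (B (t.equivFin.symm k)) := by
    intro ξ
    rw [← Finset.prod_coe_sort]
    exact Fintype.prod_equiv t.equivFin _ _ fun i => by simp
  simp_rw [key]
  refine h _ _ (fun i => hB _) fun i j hij => hd fun h => hij ?_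
  exact t.equivFin.symm.injective (Subtype.ext h)

variable [LocallyCompactSpace X]

/-- If the product of counts over any M+1 distinct cells is almost surely zero, at most M cells are
occupied at each level. -/
theorem ae_exists_finset {F : Measure (Configuration X)} {b : ℕ → Set X}
    (hb : TopologicalSpace.IsTopologicalBasis (range b)) (hbm : ∀ i, MeasurableSet (b i))
    (hsimple : ∀ᵐ ξ ∂F, ∀ x, ξ.count {x} ≤ 1) (M : ℕ)
    (h : ∀ (l : ℕ) (t : Finset (Fin l → Bool)), t.card = M + 1 →
      ∫⁻ ξ, ∏ s ∈ t, ξ.count (membershipCell b l s) ∂F = 0) :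
    ∀ᵐ ξ ∂F, ∃ T : Finset X, T.card ≤ M ∧ ξ.1 = ∑ z ∈ T, Measure.dirac z := by
  have h1 : ∀ᵐ ξ ∂F, ∀ (l : ℕ) (t : Finset (Fin l → Bool)), t.card = M + 1 →
      ∏ s ∈ t, ξ.count (membershipCell b l s) = 0 := by
    refine ae_all_iff.2 fun l => ae_all_iff.2 fun t => ?_
    by_cases ht : t.card = M + 1
    · have := (lintegral_eq_zero_iff (Finset.measurable_prod t fun s _ =>
        measurable_count (measurableSet_membershipCell hbm l s))).1 (h l t ht)
      filter_upwards [this] with ξ hξ _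
      simpa using hξ
    · exact ae_of_all _ fun ξ h => absurd h ht
  filter_upwards [hsimple, h1] with ξ hs h2
  refine exists_finset_eq_sum_dirac hb ξ hs M fun l s hsne => ?_
  by_contra hcard
  obtain ⟨t, hts, htc⟩ := Finset.exists_subset_card_eq (Nat.succ_le_of_lt (not_le.1 hcard))
  have := h2 l t htc
  rw [Finset.prod_eq_zero_iff] at this
  obtain ⟨u, hu, h0⟩ := this
  exact hsne u (hts hu) h0

/-- Expanding ∏(1 + c_s ξ(s)) over subsets of cells leaves joint moments of counts on disjoint sets,
which the correlation functions determine. The bound on the number of points makes every term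
integrable. -/
theorem integral_cellProduct {F : Measure (Configuration X)} [IsFiniteMeasure F] {b : ℕ → Set X}
    (hbm : ∀ i, MeasurableSet (b i)) (M : ℕ)
    (hF : ∀ᵐ ξ ∂F, ∃ T : Finset X, T.card ≤ M ∧ ξ.1 = ∑ z ∈ T, Measure.dirac z)
    (c : ∀ l, (Fin l → Bool) → ℂ) (l : ℕ) :
    ∫ ξ, cellProduct b c l ξ ∂F = ∑ t : Finset (Fin l → Bool), (∏ s ∈ t, c l s) *
      ((∫⁻ ξ, ∏ s ∈ t, ξ.count (membershipCell b l s) ∂F).toReal : ℂ) := by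
  classical
  have hexp : ∀ ξ : Configuration X, cellProduct b c l ξ = ∑ t : Finset (Fin l → Bool),
      (∏ s ∈ t, c l s) * ((∏ s ∈ t, (ξ.count (membershipCell b l s)).toReal : ℝ) : ℂ) := by
    intro ξ
    rw [cellProduct, Finset.prod_one_add, Finset.powerset_univ]
    refine Finset.sum_congr rfl fun t _ => ?_
    rw [Finset.prod_mul_distrib]
    push_cast
    rfl
  have hmeas : ∀ s, Measurable fun ξ : Configuration X => ξ.count (membershipCell b l s) :=
    fun s => measurable_count (measurableSet_membershipCell hbm l s)
  have hle : ∀ᵐ ξ ∂F, ∀ s, ξ.count (membershipCell b l s) ≤ (M : ℝ≥0∞) := by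
    filter_upwards [hF] with ξ ⟨T, hTM, hT⟩ s
    refine (measure_mono (subset_univ _)).trans ?_
    rw [hT, Measure.finsetSum_apply]
    simpa using hTM
  have hint : ∀ t : Finset (Fin l → Bool), Integrable (fun ξ : Configuration X =>
      ((∏ s ∈ t, (ξ.count (membershipCell b l s)).toReal : ℝ) : ℂ)) F := by
    intro t
    refine Integrable.ofReal ?_
    refine Integrable.of_bound (Finset.measurable_prod t fun s _ =>
      (hmeas s).ennreal_toReal).aestronglyMeasurable ((M : ℝ) ^ t.card) ?_
    filter_upwards [hle] with ξ hξ
    change ‖∏ s ∈ t, (ξ.count (membershipCell b l s)).toReal‖ ≤ _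
    rw [Real.norm_of_nonneg (Finset.prod_nonneg fun _ _ => ENNReal.toReal_nonneg)]
    rw [← Finset.prod_const]
    refine Finset.prod_le_prod (fun s _ => ENNReal.toReal_nonneg) fun s _ => ?_
    exact ENNReal.toReal_le_of_le_ofReal (by positivity) (by simpa using hξ s)
  simp_rw [hexp]
  rw [integral_finsetSum _ fun t _ => (hint t).const_mul _]
  refine Finset.sum_congr rfl fun t _ => ?_
  rw [integral_const_mul, integral_complex_ofReal]
  congr 2
  rw [← integral_toReal (Finset.measurable_prod t fun s _ => hmeas s).aemeasurable]
  · simp_rw [ENNReal.toReal_prod]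
  · filter_upwards [hle] with ξ hξ
    exact ENNReal.prod_lt_top fun s _ => (hξ s).trans_lt (ENNReal.natCast_lt_top M)

end Configuration

theorem Configuration.card_le_of_count_univ_le {X : Type*} [TopologicalSpace X]
    [MeasurableSpace X] {b : ℕ → Set X} (hbm : ∀ i, MeasurableSet (b i))
    {ξ : Configuration X} {M : ℕ} (hξ : ξ.count univ ≤ (M : ℝ≥0∞)) (l : ℕ)
    (t : Finset (Fin l → Bool)) (ht : ∀ s ∈ t, ξ.count (membershipCell b l s) ≠ 0) :
    t.card ≤ M := by
  have h1 : ∀ s ∈ t, 1 ≤ ξ.count (membershipCell b l s) := fun s hs =>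
    (ξ.count_eq_zero_or_one_le (measurableSet_membershipCell hbm l s)).resolve_left (ht s hs)
  have h2 : ∑ s ∈ t, ξ.count (membershipCell b l s) ≤ ξ.count univ := by
    simp only [Configuration.count]
    rw [← measure_biUnion_finset (fun x _ y _ hxy => disjoint_membershipCell b l hxy)
      fun s _ => measurableSet_membershipCell hbm l s]
    exact measure_mono (subset_univ _)
  have h3 : (t.card : ℝ≥0∞) ≤ M := by
    refine le_trans ?_ (h2.trans hξ)
    simpa using Finset.card_nsmul_le_sum t _ 1 h1
  exact Nat.cast_le.1 h3

theorem exists_isTopologicalBasis_range (X : Type*) [TopologicalSpace X]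
    [SecondCountableTopology X] :
    ∃ b : ℕ → Set X, TopologicalSpace.IsTopologicalBasis (range b) := by
  obtain ⟨b, hb⟩ := ((TopologicalSpace.countable_countableBasis X).insert ∅).exists_eq_range
    (insert_nonempty _ _)
  exact ⟨b, hb ▸ (TopologicalSpace.isBasis_countableBasis X).insert_empty⟩

/-- A simple configuration with finitely many points is a finite sum of Dirac measures. -/
theorem Configuration.exists_finset_of_count_univ_le {X : Type*} [MetricSpace X]
    [MeasurableSpace X] [BorelSpace X] [SecondCountableTopology X] {ξ : Configuration X} (hs : ∀ x, ξ.count {x} ≤ 1)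
    {M : ℕ} (hξ : ξ.count univ ≤ (M : ℝ≥0∞)) :
    ∃ T : Finset X, T.card ≤ M ∧ ξ.1 = ∑ z ∈ T, Measure.dirac z := by
  obtain ⟨b, hb⟩ := exists_isTopologicalBasis_range X
  exact Configuration.exists_finset_eq_sum_dirac hb ξ hs M
    (Configuration.card_le_of_count_univ_le (fun i => (hb.isOpen ⟨i, rfl⟩).measurableSet) hξ)

/-- Equal correlations give equal moments on disjoint cells. These first force F to have at most M
points as well, through the vanishing of moments over M+1 cells. They then identify the integrals of
the cell products, whose limits are the characteristic functionals; exp(2M) dominates them. -/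
theorem IsDeterminantal.eq_of_ae_count_le {X : Type*} [MetricSpace X] [MeasurableSpace X]
    [BorelSpace X] [SecondCountableTopology X] [LocallyCompactSpace X]
    {F F₀ : Measure (Configuration X)} [IsProbabilityMeasure F] [IsProbabilityMeasure F₀]
    {μ : Measure X} {K : X → X → ℂ} (hF : IsDeterminantal F μ K) (hF₀ : IsDeterminantal F₀ μ K)
    (M : ℕ) (hM : ∀ᵐ ξ ∂F₀, ξ.count univ ≤ (M : ℝ≥0∞)) : F = F₀ := by
  classical
  obtain ⟨b, hb⟩ := exists_isTopologicalBasis_range X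
  have hbm : ∀ i, MeasurableSet (b i) := fun i => (hb.isOpen ⟨i, rfl⟩).measurableSet
  have hcorr : ∀ (m : ℕ) (B : Fin m → Set X), (∀ i, MeasurableSet (B i)) →
      Pairwise (fun i j => Disjoint (B i) (B j)) →
      ∫⁻ ξ, ∏ i, ξ.count (B i) ∂F = ∫⁻ ξ, ∏ i, ξ.count (B i) ∂F₀ := fun m B hB hd => by
    rw [hF.correlation m B hB hd, hF₀.correlation m B hB hd]
  have hcell : ∀ (l : ℕ) (t : Finset (Fin l → Bool)),
      ∫⁻ ξ, ∏ s ∈ t, ξ.count (membershipCell b l s) ∂F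
        = ∫⁻ ξ, ∏ s ∈ t, ξ.count (membershipCell b l s) ∂F₀ := fun l t =>
    Configuration.lintegral_prod_count_finset hcorr
      (fun s => measurableSet_membershipCell hbm l s)
      (fun s t hst => disjoint_membershipCell b l hst) t
  have hzero : ∀ (l : ℕ) (t : Finset (Fin l → Bool)), t.card = M + 1 →
      ∫⁻ ξ, ∏ s ∈ t, ξ.count (membershipCell b l s) ∂F₀ = 0 := by
    intro l t ht
    rw [lintegral_eq_zero_iff (Finset.measurable_prod t fun s _ =>
      Configuration.measurable_count (measurableSet_membershipCell hbm l s))]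
    filter_upwards [hM] with ξ hξ
    by_contra hne
    have h1 := Configuration.card_le_of_count_univ_le hbm hξ l t (Finset.prod_ne_zero_iff.1 hne)
    omega
  have hfin := Configuration.ae_exists_finset hb hbm hF.simple M
    fun l t ht => (hcell l t).trans (hzero l t ht)
  have hfin₀ := Configuration.ae_exists_finset hb hbm hF₀.simple M hzero
  refine Configuration.ext_of_integral_exp fun f => ?_
  -- On each nonempty cell exp(if) is replaced by its value at a chosen point; empty cells
  -- contribute the neutral factor.
  let c : ∀ l, (Fin l → Bool) → ℂ := fun l s =>
    if h : (membershipCell b l s).Nonempty then Complex.exp (Complex.I * f h.some) - 1 else 0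
  have hc2 : ∀ l s, ‖c l s‖ ≤ 2 := by
    intro l s
    simp only [c]
    split_ifs with h
    · refine (norm_sub_le _ _).trans ?_
      rw [mul_comm, Complex.norm_exp_ofReal_mul_I]
      norm_num
    · simp
  have hc : ∀ l z, ∃ y, membershipCode b l y = membershipCode b l z ∧
      1 + c l (membershipCode b l z) = Complex.exp (Complex.I * f y) := by
    intro l z
    have h : (membershipCell b l (membershipCode b l z)).Nonempty := ⟨z, rfl⟩
    exact ⟨h.some, h.some_mem, by simp only [c, dif_pos h]; ring⟩
  have hlim : ∀ {G : Measure (Configuration X)} [IsProbabilityMeasure G],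
      (∀ᵐ ξ ∂G, ∃ T : Finset X, T.card ≤ M ∧ ξ.1 = ∑ z ∈ T, Measure.dirac z) →
      Tendsto (fun l => ∫ ξ, Configuration.cellProduct b c l ξ ∂G) atTop
        (𝓝 (∫ ξ, Complex.exp (Complex.I * (∫ x, f x ∂ξ.1 : ℝ)) ∂G)) := by
    intro G _ hG
    refine tendsto_integral_of_dominated_convergence (fun _ => Real.exp (2 * M)) (fun l => ?_)
      (integrable_const _) (fun l => ?_) ?_
    · refine Measurable.aestronglyMeasurable (Finset.measurable_prod _ fun s _ =>
        measurable_const.add (measurable_const.mul (Complex.measurable_ofReal.comp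
          (Configuration.measurable_count (measurableSet_membershipCell hbm l s)).ennreal_toReal)))
    · filter_upwards [hG] with ξ ⟨T, hTM, hT⟩
      exact Configuration.norm_cellProduct_le hbm hc2 hTM hT l
    · filter_upwards [hG] with ξ ⟨T, hTM, hT⟩
      exact Configuration.tendsto_cellProduct hb hbm f hc hT
  refine tendsto_nhds_unique (hlim hfin) ((hlim hfin₀).congr fun l => ?_)
  rw [Configuration.integral_cellProduct hbm M hfin, Configuration.integral_cellProduct hbm M hfin₀]
  simp_rw [hcell]

/-! ### Point configurations in the punctured plane -/

theorem isOpen_puncturedPlane : IsOpen {z : ℂ | z ≠ 0} := isOpen_compl_singleton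

instance : LocallyCompactSpace PuncturedPlane :=
  isOpen_puncturedPlane.isOpenEmbedding_subtypeVal.locallyCompactSpace

theorem measurableEmbedding_puncturedPlane :
    MeasurableEmbedding (Subtype.val : PuncturedPlane → ℂ) :=
  MeasurableEmbedding.subtype_coe isOpen_puncturedPlane.measurableSet

theorem measurePreserving_puncturedPlane :
    MeasurePreserving (Subtype.val : PuncturedPlane → ℂ) lebesguePunctured volume := by
  refine ⟨measurable_subtype_coe, ?_⟩
  rw [lebesguePunctured, measurableEmbedding_puncturedPlane.map_comap]
  refine Measure.restrict_eq_self_of_ae_mem ?_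
  have h : ∀ᵐ z : ℂ, z ∈ ({0} : Set ℂ)ᶜ := compl_mem_ae_iff.2 (measure_singleton 0)
  filter_upwards [h] with z hz
  exact ⟨⟨z, hz⟩, rfl⟩

/-- The extension by zero to `ℂ` of a function on the punctured plane. -/
noncomputable def extendZero (f : PuncturedPlane → ℝ) : ℂ → ℝ :=
  Function.extend Subtype.val f 0

theorem extendZero_apply (f : PuncturedPlane → ℝ) {z : ℂ} (hz : z ≠ 0) :
    extendZero f z = f ⟨z, hz⟩ :=
  Subtype.val_injective.extend_apply f 0 (⟨z, hz⟩ : PuncturedPlane)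

theorem extendZero_zero (f : PuncturedPlane → ℝ) : extendZero f 0 = 0 :=
  Function.extend_apply' _ _ _ fun ⟨z, hz⟩ => z.2 hz

theorem continuous_extendZero (f : C_c(PuncturedPlane, ℝ)) : Continuous (extendZero f) :=
  f.hasCompactSupport.continuous_extend_zero isOpen_puncturedPlane f.continuous

/-- Test functions on the punctured plane stay away from 0, so exp(if) is 1 near the origin. This is
the condition under which multiplicative functionals of the rescaled gas converge. -/
theorem exists_extendZero_eq_zero (f : C_c(PuncturedPlane, ℝ)) :
    ∃ ε > 0, ∀ z : ℂ, ‖z‖ ≤ ε → extendZero f z = 0 := by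
  have hc : IsCompact (Subtype.val '' tsupport f) :=
    f.hasCompactSupport.isCompact.image continuous_subtype_val
  have h0 : (0 : ℂ) ∈ (Subtype.val '' tsupport f)ᶜ := fun ⟨z, _, hz⟩ => z.2 hz
  obtain ⟨ε, hε, hsub⟩ := Metric.nhds_basis_closedBall.mem_iff.1
    (hc.isClosed.isOpen_compl.mem_nhds h0)
  refine ⟨ε, hε, fun z hz => ?_⟩
  by_cases hz0 : z = 0
  · rw [hz0, extendZero_zero]
  · rw [extendZero_apply _ hz0]
    refine image_eq_zero_of_notMem_tsupport fun hmem => ?_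
    exact hsub (mem_closedBall_zero_iff.2 hz) ⟨_, hmem, rfl⟩

theorem count_pointConfiguration {n : ℕ} (x : Fin n → ℂ) {B : Set PuncturedPlane}
    (hB : MeasurableSet B) :
    (pointConfiguration x).count B
      = ∑ k, (Subtype.val '' B).indicator (1 : ℂ → ℝ≥0∞) (x k) := by
  classical
  rw [Configuration.count, pointConfiguration, Measure.finsetSum_apply]
  refine Finset.sum_congr rfl fun k _ => ?_
  by_cases h : x k ≠ 0
  · rw [dif_pos h, Measure.dirac_apply' _ hB]
    by_cases hk : (⟨x k, h⟩ : PuncturedPlane) ∈ B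
    · rw [indicator_of_mem hk, indicator_of_mem (show x k ∈ Subtype.val '' B from ⟨_, hk, rfl⟩)]
      rfl
    · rw [indicator_of_notMem hk, indicator_of_notMem]
      rintro ⟨z, hz, hzk⟩
      exact hk (by convert hz; exact hzk.symm)
  · rw [dif_neg h, indicator_of_notMem]
    · simp
    · rintro ⟨z, _, hzk⟩
      exact h (hzk ▸ z.2)

theorem integral_pointConfiguration {n : ℕ} (x : Fin n → ℂ) (f : C_c(PuncturedPlane, ℝ)) :
    ∫ z, f z ∂(pointConfiguration x).1 = ∑ k, extendZero f (x k) := by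
  classical
  have hi := (pointConfiguration x).integrable f
  rw [pointConfiguration] at hi ⊢
  rw [integral_finsetSum_measure]
  · refine Finset.sum_congr rfl fun k _ => ?_
    by_cases h : x k ≠ 0
    · rw [dif_pos h, integral_dirac, extendZero_apply]
    · rw [dif_neg h, integral_zero_measure, not_not.1 h, extendZero_zero]
  · exact integrable_finsetSum_measure.1 hi

theorem continuous_pointConfiguration (n : ℕ) :
    Continuous (pointConfiguration : (Fin n → ℂ) → Configuration PuncturedPlane) := by
  refine continuous_induced_rng.2 (continuous_pi fun f => ?_)
  have h : ((fun (ξ : Configuration PuncturedPlane) (f : C_c(PuncturedPlane, ℝ)) =>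
      ∫ x, f x ∂ξ.1) ∘ pointConfiguration : (Fin n → ℂ) → _)
      = fun x (f : C_c(PuncturedPlane, ℝ)) => ∑ k, extendZero f (x k) := by
    ext x f
    exact integral_pointConfiguration x f
  rw [h]
  exact continuous_finsetSum _ fun k _ =>
    (continuous_extendZero f).comp (continuous_apply k)

theorem measurable_pointConfiguration (n : ℕ) :
    Measurable (pointConfiguration : (Fin n → ℂ) → Configuration PuncturedPlane) :=
  (continuous_pointConfiguration n).measurable

/-! ### Existence of the limiting determinantal process -/

/-- Bordering A by one row and one column puts c into a single column, so the determinant is affine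
in c. -/
theorem det_add_smul_vecMulVec {m : Type*} [Fintype m] [DecidableEq m] (A : Matrix m m ℂ)
    (u v : m → ℂ) (c : ℂ) :
    (A + c • Matrix.vecMulVec u v).det
      = (1 - c) * A.det + c * (A + Matrix.vecMulVec u v).det := by
  have key : ∀ c : ℂ, (A + c • Matrix.vecMulVec u v).det
      = ((Matrix.fromBlocks A 0 (Matrix.of fun _ j => -v j) (1 : Matrix Unit Unit ℂ)).updateCol
        (Sum.inr ()) (Sum.elim (c • u) 1)).det := by
    intro c
    have h : (Matrix.fromBlocks A 0 (Matrix.of fun _ j => -v j) (1 : Matrix Unit Unit ℂ)).updateCol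
        (Sum.inr ()) (Sum.elim (c • u) 1)
        = Matrix.fromBlocks A (Matrix.of fun i _ => c * u i) (Matrix.of fun _ j => -v j) 1 := by
      ext (i | i) (j | j) <;> simp
    rw [h, Matrix.det_fromBlocks_one₂₂]
    congr 1
    ext i j
    simp [Matrix.mul_apply, Matrix.vecMulVec_apply, mul_assoc]
  have hcol : (Sum.elim (c • u) 1 : m ⊕ Unit → ℂ)
      = (1 - c) • Sum.elim ((0 : ℂ) • u) 1 + c • Sum.elim ((1 : ℂ) • u) 1 := by
    ext (i | i) <;> simp
  have h0 := key 0
  have h1 := key 1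
  rw [zero_smul, add_zero] at h0
  rw [one_smul] at h1
  rw [key c, hcol, Matrix.det_updateCol_add, Matrix.det_updateCol_smul, Matrix.det_updateCol_smul,
    ← h0, ← h1]

theorem setLIntegral_pi_puncturedPlane {m : ℕ} {B : Fin m → Set PuncturedPlane}
    (hB : ∀ i, MeasurableSet (B i)) {G : (Fin m → ℂ) → ℝ≥0∞} (hG : Measurable G) :
    ∫⁻ x in univ.pi B, G (fun i => (x i : ℂ)) ∂(Measure.pi fun _ => lebesguePunctured)
      = ∫⁻ y in univ.pi fun i => Subtype.val '' B i, G y ∂(Measure.pi fun _ => volume) := by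
  have hmp := measurePreserving_pi (fun _ : Fin m => lebesguePunctured)
    (fun _ : Fin m => (volume : Measure ℂ)) fun _ => measurePreserving_puncturedPlane
  have hpre : univ.pi B = (fun (x : Fin m → PuncturedPlane) i => (x i : ℂ)) ⁻¹'
      univ.pi fun i => Subtype.val '' B i := by
    ext x
    simp only [mem_univ_pi, mem_preimage, Subtype.val_injective.mem_set_image]
  rw [hpre]
  exact hmp.setLIntegral_comp_preimage (MeasurableSet.univ_pi fun i =>
    measurableEmbedding_puncturedPlane.measurableSet_image.2 (hB i)) hG

theorem lintegral_prod_count_map_pointConfiguration {n : ℕ} {φ : Fin n → ℂ → ℂ}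
    (hφ : IsOrthonormalFamily volume φ) {m : ℕ} {B : Fin m → Set PuncturedPlane}
    (hB : ∀ i, MeasurableSet (B i)) (hd : Pairwise fun i j => Disjoint (B i) (B j)) :
    ∫⁻ ξ, ∏ i, ξ.count (B i) ∂((projectionEnsemble volume φ).map pointConfiguration)
      = ∫⁻ x in univ.pi B, ENNReal.ofReal
        (Matrix.of fun i j => projectionKernel φ (x i) (x j)).det.re
        ∂(Measure.pi fun _ => lebesguePunctured) := by
  rw [lintegral_map (Finset.measurable_prod _ fun i _ => Configuration.measurable_count (hB i))
    (measurable_pointConfiguration n)]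
  simp_rw [count_pointConfiguration _ (hB _)]
  rw [hφ.lintegral_prod_count (fun i => measurableEmbedding_puncturedPlane.measurableSet_image.2
    (hB i)) fun i j hij => (disjoint_image_iff Subtype.val_injective).2 (hd hij)]
  exact (setLIntegral_pi_puncturedPlane hB (ENNReal.measurable_ofReal.comp
    (Complex.measurable_re.comp (measurable_det_projectionKernel hφ.measurable)))).symm

/-- Simplicity is a condition on uncountably many points. It is deduced from a measurable one: at
some level every cell contains at most one point. -/
theorem ae_simple_map_pointConfiguration {n : ℕ} {P : Measure (Fin n → ℂ)}
    (hP : ∀ᵐ x ∂P, Function.Injective x) :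
    ∀ᵐ ξ ∂(P.map pointConfiguration), ∀ z : PuncturedPlane, ξ.count {z} ≤ 1 := by
  classical
  obtain ⟨b, hb⟩ := exists_isTopologicalBasis_range PuncturedPlane
  have hbm : ∀ i, MeasurableSet (b i) := fun i => (hb.isOpen ⟨i, rfl⟩).measurableSet
  have hcell := fun l s => measurableSet_membershipCell hbm l s
  have hE : MeasurableSet {ξ : Configuration PuncturedPlane |
      ∃ l, ∀ s : Fin l → Bool, ξ.count (membershipCell b l s) ≤ 1} := by
    simp only [ofPred_exists, ofPred_forall]
    exact MeasurableSet.iUnion fun l => MeasurableSet.iInter fun s =>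
      measurableSet_le (Configuration.measurable_count (hcell l s)) measurable_const
  have h1 : ∀ᵐ ξ ∂(P.map pointConfiguration),
      ∃ l, ∀ s : Fin l → Bool, ξ.count (membershipCell b l s) ≤ 1 := by
    rw [ae_map_iff (measurable_pointConfiguration n).aemeasurable hE]
    filter_upwards [hP] with x hx
    have hinj : Function.Injective fun k : {k // x k ≠ 0} => (⟨x k, k.2⟩ : PuncturedPlane) :=
      fun k k' h => Subtype.ext (hx (congrArg Subtype.val h))
    obtain ⟨l, hl⟩ := (eventually_injOn_membershipCode hb
      (Finset.univ.map ⟨_, hinj⟩)).exists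
    refine ⟨l, fun s => ?_⟩
    rw [count_pointConfiguration _ (hcell l s)]
    have h2 : ∑ k, (Subtype.val '' membershipCell b l s).indicator (1 : ℂ → ℝ≥0∞) (x k)
        = ((Finset.univ.filter fun k => x k ∈ Subtype.val '' membershipCell b l s).card : ℝ≥0∞) := by
      rw [Finset.card_filter, Nat.cast_sum]
      exact Finset.sum_congr rfl fun k _ => by simp [indicator_apply]
    rw [h2]
    refine Nat.cast_le_one.2 (Finset.card_le_one.2 fun k hk k' hk' => ?_)
    simp only [Finset.mem_filter, Finset.mem_univ, true_and] at hk hk'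
    obtain ⟨z, hz, hzk⟩ := hk
    obtain ⟨z', hz', hzk'⟩ := hk'
    have e1 : x k ≠ 0 := hzk ▸ z.2
    have e2 : x k' ≠ 0 := hzk' ▸ z'.2
    have m1 : z ∈ (Finset.univ.map ⟨_, hinj⟩ : Finset PuncturedPlane) :=
      Finset.mem_map.2 ⟨⟨k, e1⟩, Finset.mem_univ _, Subtype.ext hzk.symm⟩
    have m2 : z' ∈ (Finset.univ.map ⟨_, hinj⟩ : Finset PuncturedPlane) :=
      Finset.mem_map.2 ⟨⟨k', e2⟩, Finset.mem_univ _, Subtype.ext hzk'.symm⟩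
    have hzz : z = z' := hl m1 m2 (Eq.trans hz (Eq.symm hz'))
    exact hx (by rw [← hzk, ← hzk', hzz])
  filter_upwards [h1] with ξ ⟨l, hl⟩ z
  exact (measure_mono (singleton_subset_iff.2 (mem_membershipCell_code b l z))).trans (hl _)

/-- A mixture of the projection processes on the first `N` and on the first `N + 1` functions. -/
noncomputable def mixedLaw (φ : ℕ → ℂ → ℂ) (N : ℕ) (p : ℝ) :
    Measure (Configuration PuncturedPlane) :=
  ENNReal.ofReal (1 - p) •
      (projectionEnsemble volume fun k : Fin N => φ k).map pointConfiguration +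
    ENNReal.ofReal p •
      (projectionEnsemble volume fun k : Fin (N + 1) => φ k).map pointConfiguration

/-- The kernel is that of the first N functions plus p times a rank-one term, so its minors are
affine in p. At p = 0 and p = 1 they are the correlation functions of the two projection processes.
-/
theorem isDeterminantal_mixedLaw {φ : ℕ → ℂ → ℂ} {N : ℕ}
    (hφ : IsOrthonormalFamily volume fun k : Fin N => φ k)
    (hφ' : IsOrthonormalFamily volume fun k : Fin (N + 1) => φ k) {p : ℝ} (hp0 : 0 ≤ p)
    (hp1 : p ≤ 1) {K : PuncturedPlane → PuncturedPlane → ℂ}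
    (hK : ∀ z w : PuncturedPlane, K z w = projectionKernel (fun k : Fin N => φ k) (z : ℂ) w
      + p * (φ N z * star (φ N w))) :
    IsDeterminantal (mixedLaw φ N p) lebesguePunctured K := by
  have hK' : ∀ {m : ℕ} (x : Fin m → PuncturedPlane), (Matrix.of fun i j => K (x i) (x j)).det
      = (1 - p) * (Matrix.of fun i j => projectionKernel (fun k : Fin N => φ k)
          (x i : ℂ) (x j)).det
        + p * (Matrix.of fun i j => projectionKernel (fun k : Fin (N + 1) => φ k)
          (x i : ℂ) (x j)).det := by
    intro m x
    have e1 : (Matrix.of fun i j => K (x i) (x j))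
        = (Matrix.of fun i j => projectionKernel (fun k : Fin N => φ k) (x i : ℂ) (x j))
          + (p : ℂ) • Matrix.vecMulVec (fun i => φ N (x i)) (fun j => star (φ N (x j))) := by
      ext i j
      simp [hK, Matrix.vecMulVec_apply]
    have e2 : (Matrix.of fun i j => projectionKernel (fun k : Fin (N + 1) => φ k)
          (x i : ℂ) (x j))
        = (Matrix.of fun i j => projectionKernel (fun k : Fin N => φ k) (x i : ℂ) (x j))
          + Matrix.vecMulVec (fun i => φ N (x i)) (fun j => star (φ N (x j))) := by
      ext i j
      simp [projectionKernel, Matrix.vecMulVec_apply, Fin.sum_univ_castSucc]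
    rw [e1, e2, det_add_smul_vecMulVec]
  have hre : ∀ {m : ℕ} (x : Fin m → PuncturedPlane),
      (Matrix.of fun i j => K (x i) (x j)).det.re
      = (1 - p) * (Matrix.of fun i j => projectionKernel (fun k : Fin N => φ k)
          (x i : ℂ) (x j)).det.re
        + p * (Matrix.of fun i j => projectionKernel (fun k : Fin (N + 1) => φ k)
          (x i : ℂ) (x j)).det.re := by
    intro m x
    rw [hK']
    have : (1 - p : ℂ) = ((1 - p : ℝ) : ℂ) := by push_cast; rfl
    rw [this, Complex.add_re, Complex.re_ofReal_mul, Complex.re_ofReal_mul]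
  have h1p : 0 ≤ 1 - p := sub_nonneg.2 hp1
  have hnn := fun {m : ℕ} (x : Fin m → PuncturedPlane) =>
    det_projectionKernel_nonneg (fun k : Fin N => φ k) fun i => (x i : ℂ)
  have hnn' := fun {m : ℕ} (x : Fin m → PuncturedPlane) =>
    det_projectionKernel_nonneg (fun k : Fin (N + 1) => φ k) fun i => (x i : ℂ)
  refine ⟨?_, fun m => ae_of_all _ fun x => ⟨?_, ?_⟩, fun m B hB hd => ?_⟩
  · rw [mixedLaw, ae_add_measure_iff]
    exact ⟨Measure.ae_smul_measure (ae_simple_map_pointConfiguration hφ.ae_injective) _,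
      Measure.ae_smul_measure (ae_simple_map_pointConfiguration hφ'.ae_injective) _⟩
  · rw [hK']
    have : (1 - p : ℂ) = ((1 - p : ℝ) : ℂ) := by push_cast; rfl
    rw [this, Complex.add_im, Complex.im_ofReal_mul, Complex.im_ofReal_mul, (hnn x).2, (hnn' x).2]
    simp
  · rw [hre]
    exact add_nonneg (mul_nonneg h1p (hnn x).1) (mul_nonneg hp0 (hnn' x).1)
  · have hmeas : ∀ {n : ℕ} {ψ : Fin n → ℂ → ℂ}, IsOrthonormalFamily volume ψ →
        Measurable fun x : Fin m → PuncturedPlane => ENNReal.ofReal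
          (Matrix.of fun i j => projectionKernel ψ (x i : ℂ) (x j)).det.re := fun hψ =>
      ENNReal.measurable_ofReal.comp (Complex.measurable_re.comp
        ((measurable_det_projectionKernel hψ.measurable).comp (measurable_pi_lambda _ fun i =>
          measurable_subtype_coe.comp (measurable_pi_apply i))))
    rw [mixedLaw, lintegral_add_measure, lintegral_smul_measure, lintegral_smul_measure,
      lintegral_prod_count_map_pointConfiguration hφ hB hd,
      lintegral_prod_count_map_pointConfiguration hφ' hB hd, smul_eq_mul, smul_eq_mul,
      ← lintegral_const_mul _ (hmeas hφ), ← lintegral_const_mul _ (hmeas hφ'),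
      ← lintegral_add_left ((hmeas hφ).const_mul _)]
    refine lintegral_congr fun x => ?_
    rw [hre, ENNReal.ofReal_add (mul_nonneg h1p (hnn x).1) (mul_nonneg hp0 (hnn' x).1),
      ENNReal.ofReal_mul h1p, ENNReal.ofReal_mul hp0]

/-! ### Asymptotics of the radial weights -/

/-- The assumptions on the potential in the limit theorem. -/
structure IsAdmissiblePotential (χ : ℝ) (V : ℝ → ℝ) (α γ Lplus Lminus : ℝ) : Prop where
  chi_pos : 0 < χ
  circle : IsCirclePotential V
  le_alpha : 2 * χ ≤ α
  log_lt : ∀ r : ℝ, 1 < r → Real.log r < V r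
  gamma_pos : 0 < γ
  tendsto_atTop : Tendsto (fun r : ℝ => r ^ α * (V r - Real.log r)) atTop (𝓝 γ)
  Lplus_pos : 0 < Lplus
  one_le_Lminus : 1 ≤ Lminus
  tendsto_right : Tendsto (fun r : ℝ => V r / (r - 1)) (𝓝[>] 1) (𝓝 (Lplus + 1))
  tendsto_left : Tendsto (fun r : ℝ => V r / (1 - r)) (𝓝[<] 1) (𝓝 (Lminus - 1))

/-- The radial weight of the monomial of degree `n - 1 - k`. -/
noncomputable def radialWeight (χ : ℝ) (V : ℝ → ℝ) (n k : ℕ) (r : ℝ) : ℝ :=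
  r ^ (-(2 * (k : ℝ) + 2 * χ + 1)) * Real.exp (-2 * ((n : ℝ) + χ) * (V r - Real.log r))

theorem radialWeight_nonneg (χ : ℝ) (V : ℝ → ℝ) (n k : ℕ) {r : ℝ} (hr : 0 ≤ r) :
    0 ≤ radialWeight χ V n k r :=
  mul_nonneg (Real.rpow_nonneg hr _) (Real.exp_nonneg _)

/-- The defining form, with V - log, is adapted to infinity; this form, with a nonnegative power
when k < n apart from a possible r⁻¹-free boundary case, is adapted to r ≤ 1. -/
theorem radialWeight_eq (χ : ℝ) (V : ℝ → ℝ) {n k : ℕ} {r : ℝ} (hr : 0 < r) :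
    radialWeight χ V n k r
      = r ^ (2 * (n : ℝ) - 2 * k - 1) * Real.exp (-2 * ((n : ℝ) + χ) * V r) := by
  rw [radialWeight, Real.rpow_def_of_pos hr, Real.rpow_def_of_pos hr, ← Real.exp_add,
    ← Real.exp_add]
  congr 1
  ring

theorem integrableOn_rpow_mul_exp_neg {α q c : ℝ} (hα : 0 < α) (hq : 0 < q) (hc : 0 < c) :
    IntegrableOn (fun ρ : ℝ => ρ ^ (-(q + 1)) * Real.exp (-c * ρ ^ (-α))) (Ioi 0) := by
  have h1 := integrableOn_rpow_mul_exp_neg_mul_rpow (p := α) (s := q - 1) (b := c)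
    (by linarith) hα hc
  rw [← integrableOn_Ioi_comp_rpow_iff _ (show (-1 : ℝ) ≠ 0 by norm_num)] at h1
  refine h1.congr_fun (fun ρ hρ => ?_) measurableSet_Ioi
  have hρ0 : 0 < ρ := hρ
  simp only [abs_neg, abs_one, one_mul, smul_eq_mul]
  rw [← Real.rpow_mul hρ0.le, ← Real.rpow_mul hρ0.le, ← mul_assoc, ← Real.rpow_add hρ0]
  congr 2
  · ring
  · ring_nf

namespace IsAdmissiblePotential

variable {χ : ℝ} {V : ℝ → ℝ} {α γ Lplus Lminus : ℝ}
  (h : IsAdmissiblePotential χ V α γ Lplus Lminus)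

include h

theorem alpha_pos : 0 < α := by
  have := h.chi_pos
  have := h.le_alpha
  linarith

theorem log_le {r : ℝ} (hr : 0 ≤ r) : Real.log r ≤ V r :=
  (le_max_right _ _).trans (h.circle.max_le r hr)

theorem nonneg {r : ℝ} (hr : 0 ≤ r) : 0 ≤ V r :=
  (le_max_left _ _).trans (h.circle.max_le r hr)

theorem radialWeight_le (n k : ℕ) {r : ℝ} (hr : 0 < r) :
    radialWeight χ V n k r ≤ r ^ (-(2 * (k : ℝ) + 2 * χ + 1)) := by
  refine mul_le_of_le_one_right (Real.rpow_nonneg hr.le _) (Real.exp_le_one_iff.2 ?_)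
  have h1 : 0 ≤ V r - Real.log r := sub_nonneg.2 (h.log_le hr.le)
  have h2 : 0 ≤ (n : ℝ) + χ := by have := h.chi_pos; positivity
  nlinarith [mul_nonneg h2 h1]

theorem continuousOn_radialWeight (n k : ℕ) :
    ContinuousOn (radialWeight χ V n k) (Ioi 0) := by
  have h1 : ContinuousOn V (Ioi 0) := h.circle.continuousOn.mono Ioi_subset_Ici_self
  have h2 : ContinuousOn Real.log (Ioi 0) := fun r hr =>
    (Real.continuousAt_log (ne_of_gt hr)).continuousWithinAt
  have h3 : ContinuousOn (fun r : ℝ => r ^ (-(2 * (k : ℝ) + 2 * χ + 1))) (Ioi 0) := fun r hr =>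
    (Real.continuousAt_rpow_const _ _ (Or.inl (ne_of_gt hr))).continuousWithinAt
  exact h3.mul (Real.continuous_exp.comp_continuousOn ((h1.sub h2).const_mul _))

theorem integrableOn_radialWeight_Ioi (n k : ℕ) {c : ℝ} (hc : 0 < c) :
    IntegrableOn (radialWeight χ V n k) (Ioi c) := by
  refine Integrable.mono' (integrableOn_Ioi_rpow_of_lt (a := -(2 * (k : ℝ) + 2 * χ + 1)) ?_ hc)
    (((h.continuousOn_radialWeight n k).mono (Ioi_subset_Ioi hc.le)).aestronglyMeasurable
      measurableSet_Ioi) ?_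
  · have := h.chi_pos
    have : (0 : ℝ) ≤ k := k.cast_nonneg
    linarith
  · refine (ae_restrict_iff' measurableSet_Ioi).2 (ae_of_all _ fun r hr => ?_)
    have hr0 : 0 < r := hc.trans hr
    rw [Real.norm_of_nonneg (radialWeight_nonneg χ V n k hr0.le)]
    exact h.radialWeight_le n k hr0

theorem integrableOn_radialWeight {n k : ℕ} (hk : k < n) :
    IntegrableOn (radialWeight χ V n k) (Ioi 0) := by
  rw [← Ioc_union_Ioi_eq_Ioi zero_le_one]
  refine IntegrableOn.union ?_ (h.integrableOn_radialWeight_Ioi n k one_pos)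
  have hfin : IsFiniteMeasure (volume.restrict (Ioc (0 : ℝ) 1)) := ⟨by simp⟩
  refine Integrable.of_bound (((h.continuousOn_radialWeight n k).mono
    Ioc_subset_Ioi_self).aestronglyMeasurable measurableSet_Ioc) 1 ?_
  refine (ae_restrict_iff' measurableSet_Ioc).2 (ae_of_all _ fun r hr => ?_)
  rw [Real.norm_of_nonneg (radialWeight_nonneg χ V n k hr.1.le), radialWeight_eq χ V hr.1]
  have hkn : (k : ℝ) + 1 ≤ n := by exact_mod_cast hk
  have h1 : 0 ≤ (n : ℝ) + χ := by have := h.chi_pos; positivity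
  refine mul_le_one₀ (Real.rpow_le_one hr.1.le hr.2 (by linarith)) (Real.exp_nonneg _)
    (Real.exp_le_one_iff.2 ?_)
  nlinarith [mul_nonneg h1 (h.nonneg hr.1.le)]

/-- At scale s = n^(1/α) one has s^α = n, so n(V - log)(sρ) = ρ^(-α) (sρ)^α (V - log)(sρ). -/
theorem tendsto_far_exponent {ρ : ℝ} (hρ : 0 < ρ) :
    Tendsto (fun n : ℕ => ((n : ℝ) + χ) * (V ((n : ℝ) ^ (1 / α) * ρ)
      - Real.log ((n : ℝ) ^ (1 / α) * ρ))) atTop (𝓝 (γ * ρ ^ (-α))) := by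
  have hα := h.alpha_pos
  have h1 : Tendsto (fun n : ℕ => (n : ℝ) ^ (1 / α) * ρ) atTop atTop :=
    ((tendsto_rpow_atTop (by positivity)).comp tendsto_natCast_atTop_atTop).atTop_mul_const hρ
  have h2 := h.tendsto_atTop.comp h1
  have h3 : Tendsto (fun n : ℕ => 1 + χ / (n : ℝ)) atTop (𝓝 (1 + 0)) :=
    tendsto_const_nhds.add (tendsto_const_div_atTop_nhds_zero_nat χ)
  have h4 := (h3.mul h2).mul_const (ρ ^ (-α))
  rw [add_zero, one_mul] at h4
  refine h4.congr' ?_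
  filter_upwards [eventually_gt_atTop 0] with n hn
  have hn' : (0 : ℝ) < n := by exact_mod_cast hn
  simp only [Function.comp_apply]
  rw [Real.mul_rpow (by positivity) hρ.le, ← Real.rpow_mul hn'.le, one_div_mul_cancel hα.ne',
    Real.rpow_one, Real.rpow_neg hρ.le]
  have := (Real.rpow_pos_of_pos hρ α).ne'
  field_simp

theorem exists_far_bound : ∃ R > 1, ∀ r, R < r → γ / 2 * r ^ (-α) ≤ V r - Real.log r := by
  have h1 := h.tendsto_atTop.eventually_const_lt (half_lt_self h.gamma_pos)
  obtain ⟨R, hR⟩ := eventually_atTop.1 h1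
  refine ⟨max R 2, lt_max_of_lt_right one_lt_two, fun r hr => ?_⟩
  have h2 := hR r ((le_max_left _ _).trans hr.le)
  have hr0 : 0 < r := two_pos.trans ((le_max_right R 2).trans_lt hr)
  have h3 := Real.rpow_pos_of_pos hr0 α
  rw [Real.rpow_neg hr0.le, ← div_eq_mul_inv, div_le_iff₀ h3]
  linarith

/-- Substitution r = n^(1/α)ρ and dominated convergence. The indicator records that the lower bound
on V - log is available only for r > R. -/
theorem tendsto_integral_far (k : ℕ) {R : ℝ} (hR : 0 < R)
    (hb : ∀ r, R < r → γ / 2 * r ^ (-α) ≤ V r - Real.log r) :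
    Tendsto (fun n : ℕ => ((n : ℝ) ^ (1 / α)) ^ (2 * (k : ℝ) + 2 * χ) *
        ∫ r in Ioi R, radialWeight χ V n k r) atTop
      (𝓝 (∫ ρ in Ioi (0 : ℝ), ρ ^ (-(2 * (k : ℝ) + 2 * χ + 1)) *
        Real.exp (-2 * γ * ρ ^ (-α)))) := by
  have hα := h.alpha_pos
  have hχ := h.chi_pos
  have hγ := h.gamma_pos
  set q : ℝ := 2 * (k : ℝ) + 2 * χ with hq
  have hq0 : 0 < q := by positivity
  have key : ∀ n : ℕ, 0 < n → ((n : ℝ) ^ (1 / α)) ^ q * ∫ r in Ioi R, radialWeight χ V n k r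
      = ∫ ρ in Ioi (0 : ℝ), (Ioi (R / (n : ℝ) ^ (1 / α))).indicator (fun ρ : ℝ =>
        ρ ^ (-(q + 1)) * Real.exp (-2 * (((n : ℝ) + χ) * (V ((n : ℝ) ^ (1 / α) * ρ)
      - Real.log ((n : ℝ) ^ (1 / α) * ρ))))) ρ := by
    intro n hn
    have hs : 0 < (n : ℝ) ^ (1 / α) := Real.rpow_pos_of_pos (by exact_mod_cast hn) _
    set s := (n : ℝ) ^ (1 / α)
    have hRs : 0 < R / s := by positivity
    rw [setIntegral_indicator measurableSet_Ioi,
      inter_eq_self_of_subset_right (Ioi_subset_Ioi hRs.le)]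
    have h1 := integral_comp_mul_left_Ioi (radialWeight χ V n k) (R / s) hs
    rw [mul_div_cancel₀ _ hs.ne', smul_eq_mul] at h1
    have h2 : ∫ r in Ioi R, radialWeight χ V n k r
        = s * ∫ ρ in Ioi (R / s), radialWeight χ V n k (s * ρ) := by
      rw [h1, mul_inv_cancel_left₀ hs.ne']
    rw [h2, ← mul_assoc, ← integral_const_mul]
    refine setIntegral_congr_fun measurableSet_Ioi fun ρ hρ => ?_
    have hρ0 : 0 < ρ := hRs.trans hρ
    simp only [radialWeight]
    rw [← hq, Real.mul_rpow hs.le hρ0.le, Real.rpow_neg hs.le, Real.rpow_add hs q 1, Real.rpow_one]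
    have := (Real.rpow_pos_of_pos hs q).ne'
    field_simp
  refine Tendsto.congr' (f₁ := fun n : ℕ => ∫ ρ in Ioi (0 : ℝ),
    (Ioi (R / (n : ℝ) ^ (1 / α))).indicator (fun ρ : ℝ =>
        ρ ^ (-(q + 1)) * Real.exp (-2 * (((n : ℝ) + χ) * (V ((n : ℝ) ^ (1 / α) * ρ)
      - Real.log ((n : ℝ) ^ (1 / α) * ρ))))) ρ) ?_ ?_
  · filter_upwards [eventually_gt_atTop 0] with n hn using (key n hn).symm
  -- The bound γ/2 · r^(-α) becomes γ/(2n) · ρ^(-α) at r = n^(1/α)ρ; multiplied by 2(n+χ) ≥ 2n it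
  -- yields the rate γ.
  refine tendsto_integral_filter_of_dominated_convergence
    (fun ρ => ρ ^ (-(q + 1)) * Real.exp (-γ * ρ ^ (-α))) ?_ ?_
    (integrableOn_rpow_mul_exp_neg hα hq0 hγ) ?_
  · filter_upwards [eventually_gt_atTop 0] with n hn
    have hs : 0 < (n : ℝ) ^ (1 / α) := Real.rpow_pos_of_pos (by exact_mod_cast hn) _
    refine AEStronglyMeasurable.indicator ?_ measurableSet_Ioi
    refine ContinuousOn.aestronglyMeasurable ?_ measurableSet_Ioi
    have hmaps : MapsTo (fun ρ => (n : ℝ) ^ (1 / α) * ρ) (Ioi 0) (Ioi 0) := fun ρ hρ =>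
      mul_pos hs hρ
    have h1 : ContinuousOn (fun r => V r - Real.log r) (Ioi 0) :=
      (h.circle.continuousOn.mono Ioi_subset_Ici_self).sub fun r hr =>
        (Real.continuousAt_log (ne_of_gt hr)).continuousWithinAt
    have h2 := h1.comp (by fun_prop : ContinuousOn (fun ρ => (n : ℝ) ^ (1 / α) * ρ) (Ioi 0)) hmaps
    have h3 : ContinuousOn (fun r : ℝ => r ^ (-(q + 1))) (Ioi 0) := fun r hr =>
      (Real.continuousAt_rpow_const _ _ (Or.inl (ne_of_gt hr))).continuousWithinAt
    exact h3.mul (Real.continuous_exp.comp_continuousOn ((h2.const_mul _).const_mul _))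
  · filter_upwards [eventually_gt_atTop 0] with n hn
    have hn' : (0 : ℝ) < n := by exact_mod_cast hn
    have hs : 0 < (n : ℝ) ^ (1 / α) := Real.rpow_pos_of_pos hn' _
    refine (ae_restrict_iff' measurableSet_Ioi).2 (ae_of_all _ fun ρ hρ => ?_)
    have hρ0 : 0 < ρ := hρ
    have hpos : 0 ≤ ρ ^ (-(q + 1)) := Real.rpow_nonneg hρ0.le _
    by_cases hmem : ρ ∈ Ioi (R / (n : ℝ) ^ (1 / α))
    · rw [indicator_of_mem hmem, Real.norm_of_nonneg (mul_nonneg hpos (Real.exp_nonneg _))]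
      refine mul_le_mul_of_nonneg_left (Real.exp_le_exp.2 ?_) hpos
      have h1 := hb ((n : ℝ) ^ (1 / α) * ρ) (by rw [mul_comm]; exact (div_lt_iff₀ hs).1 hmem)
      rw [Real.mul_rpow hs.le hρ0.le, ← Real.rpow_mul hn'.le,
        show 1 / α * -α = -1 by field_simp, Real.rpow_neg_one] at h1
      have h2 : 0 ≤ ρ ^ (-α) := Real.rpow_nonneg hρ0.le _
      have h3 : γ / 2 * ρ ^ (-α) ≤ (n : ℝ) * (V ((n : ℝ) ^ (1 / α) * ρ)
          - Real.log ((n : ℝ) ^ (1 / α) * ρ)) := by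
        have := mul_le_mul_of_nonneg_left h1 hn'.le
        calc γ / 2 * ρ ^ (-α) = n * (γ / 2 * ((n : ℝ)⁻¹ * ρ ^ (-α))) := by field_simp
          _ ≤ _ := this
      have h4 : 0 ≤ V ((n : ℝ) ^ (1 / α) * ρ) - Real.log ((n : ℝ) ^ (1 / α) * ρ) :=
        sub_nonneg.2 (h.log_le (by positivity))
      nlinarith [mul_nonneg hχ.le h4]
    · rw [indicator_of_notMem hmem, norm_zero]
      positivity
  · refine (ae_restrict_iff' measurableSet_Ioi).2 (ae_of_all _ fun ρ hρ => ?_)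
    have hρ0 : 0 < ρ := hρ
    have h1 : Tendsto (fun n : ℕ => R / (n : ℝ) ^ (1 / α)) atTop (𝓝 0) :=
      ((tendsto_rpow_atTop (by positivity)).comp tendsto_natCast_atTop_atTop).const_div_atTop R
    have h2 := (((h.tendsto_far_exponent hρ0).const_mul (-2)).rexp).const_mul (ρ ^ (-(q + 1)))
    rw [show -2 * (γ * ρ ^ (-α)) = -2 * γ * ρ ^ (-α) by ring] at h2
    refine h2.congr' ?_
    filter_upwards [h1.eventually_lt_const hρ0] with n hn
    rw [indicator_of_mem (show ρ ∈ Ioi _ from hn)]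

end IsAdmissiblePotential

/-! ### Laplace asymptotics at the unit circle. -/

theorem integrable_ite_exp {a b : ℝ} (ha : 0 < a) (hb : 0 < b) :
    Integrable fun u : ℝ => if u ≤ 0 then Real.exp (a * u) else Real.exp (-b * u) := by
  rw [← integrableOn_univ, ← Iic_union_Ioi (a := (0 : ℝ))]
  refine IntegrableOn.union ?_ ?_
  · exact (integrableOn_exp_mul_Iic ha 0).congr_fun (fun u hu => (if_pos hu).symm)
      measurableSet_Iic
  · exact (integrableOn_exp_mul_Ioi (neg_lt_zero.2 hb) 0).congr_fun
      (fun u hu => (if_neg (not_le.2 hu)).symm) measurableSet_Ioi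

theorem integral_ite_exp {a b : ℝ} (ha : 0 < a) (hb : 0 < b) :
    ∫ u : ℝ, (if u ≤ 0 then Real.exp (a * u) else Real.exp (-b * u)) = 1 / a + 1 / b := by
  have e1 : ∫ u in Iic (0 : ℝ), (if u ≤ 0 then Real.exp (a * u) else Real.exp (-b * u))
      = ∫ u in Iic (0 : ℝ), Real.exp (a * u) :=
    setIntegral_congr_fun measurableSet_Iic fun u hu => if_pos hu
  have e2 : ∫ u in Ioi (0 : ℝ), (if u ≤ 0 then Real.exp (a * u) else Real.exp (-b * u))
      = ∫ u in Ioi (0 : ℝ), Real.exp (-b * u) :=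
    setIntegral_congr_fun measurableSet_Ioi fun u hu => if_neg (not_le.2 hu)
  rw [← intervalIntegral.integral_Iic_add_Ioi (b := 0) (integrable_ite_exp ha hb).integrableOn
    (integrable_ite_exp ha hb).integrableOn, e1, e2, integral_exp_mul_Iic ha,
    integral_exp_mul_Ioi (neg_lt_zero.2 hb)]
  simp

theorem tendsto_nat_mul_log_one_add_div (u : ℝ) :
    Tendsto (fun n : ℕ => (n : ℝ) * Real.log (1 + u / n)) atTop (𝓝 u) :=
  (Real.tendsto_mul_log_one_add_div_atTop u).comp tendsto_natCast_atTop_atTop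

namespace IsAdmissiblePotential

variable {χ : ℝ} {V : ℝ → ℝ} {α γ Lplus Lminus : ℝ}
  (h : IsAdmissiblePotential χ V α γ Lplus Lminus)

include h

/-- Close to 1 the right slope of V exceeds 1 + L₊/2, while log r ≤ r - 1. On the remaining compact
interval V - log is continuous and positive, hence bounded below. -/
theorem exists_near_bound (R : ℝ) (hR : 1 < R) :
    ∃ δ > 0, ∀ r, 1 < r → r ≤ R → δ * (r - 1) ≤ V r - Real.log r := by
  have hL := h.Lplus_pos
  have h1 := h.tendsto_right.eventually_const_lt (show Lplus / 2 + 1 < Lplus + 1 by linarith)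
  obtain ⟨b, hb, hb'⟩ := mem_nhdsGT_iff_exists_Ioo_subset.1 h1
  have hb1 : (1 : ℝ) < b := hb
  have hcont : ContinuousOn (fun r => V r - Real.log r) (Icc (min b R) R) := by
    have hsub : Icc (min b R) R ⊆ Ioi 0 := fun r hr =>
      (zero_lt_one.trans (lt_min hb1 hR)).trans_le hr.1
    exact (h.circle.continuousOn.mono (hsub.trans Ioi_subset_Ici_self)).sub fun r hr =>
        (Real.continuousAt_log (ne_of_gt (hsub hr))).continuousWithinAt
  obtain ⟨r₀, hr₀, hmin⟩ := isCompact_Icc.exists_isMinOn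
    (nonempty_Icc.2 (min_le_right b R)) hcont
  have hm : 0 < V r₀ - Real.log r₀ :=
    sub_pos.2 (h.log_lt r₀ ((lt_min hb1 hR).trans_le hr₀.1))
  set m := V r₀ - Real.log r₀
  have hR1 : 0 < R - 1 := by linarith
  refine ⟨min (Lplus / 2) (m / (R - 1)), by positivity, fun r hr hrR => ?_⟩
  have hr1 : 0 < r - 1 := by linarith
  rcases lt_or_ge r b with hrb | hrb
  · have h2 : Lplus / 2 + 1 < V r / (r - 1) := hb' ⟨hr, hrb⟩
    rw [lt_div_iff₀ hr1] at h2
    have h3 := Real.log_le_sub_one_of_pos (zero_lt_one.trans hr)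
    have h4 := mul_le_mul_of_nonneg_right (min_le_left (Lplus / 2) (m / (R - 1))) hr1.le
    linarith
  · have h2 : m ≤ V r - Real.log r := hmin ⟨(min_le_left _ _).trans hrb, hrR⟩
    have h4 := mul_le_mul_of_nonneg_right (min_le_right (Lplus / 2) (m / (R - 1))) hr1.le
    have h5 : m / (R - 1) * (r - 1) ≤ m / (R - 1) * (R - 1) :=
      mul_le_mul_of_nonneg_left (by linarith) (by positivity)
    rw [div_mul_cancel₀ _ hR1.ne'] at h5
    linarith

/-- The logarithm contributes slope 1 on both sides. It turns the slopes L₊ + 1 and L₋ - 1 of V into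
the rates L₊ and L₋. -/
theorem tendsto_near_exponent (u : ℝ) :
    Tendsto (fun n : ℕ => ((n : ℝ) + χ) * (V (1 + u / n) - Real.log (1 + u / n))) atTop
      (𝓝 (if u ≤ 0 then -Lminus * u else Lplus * u)) := by
  have h3 : Tendsto (fun n : ℕ => 1 + χ / (n : ℝ)) atTop (𝓝 (1 + 0)) :=
    tendsto_const_nhds.add (tendsto_const_div_atTop_nhds_zero_nat χ)
  have h0 : Tendsto (fun n : ℕ => 1 + u / (n : ℝ)) atTop (𝓝 1) := by
    simpa using tendsto_const_nhds.add (tendsto_const_div_atTop_nhds_zero_nat u)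
  have hlog := tendsto_nat_mul_log_one_add_div u
  have hV : Tendsto (fun n : ℕ => (n : ℝ) * V (1 + u / n)) atTop
      (𝓝 (if u ≤ 0 then (Lminus - 1) * -u else (Lplus + 1) * u)) := by
    rcases lt_trichotomy u 0 with hu | hu | hu
    · rw [if_pos hu.le]
      have h1 : Tendsto (fun n : ℕ => 1 + u / (n : ℝ)) atTop (𝓝[<] 1) := by
        refine tendsto_nhdsWithin_iff.2 ⟨h0, ?_⟩
        filter_upwards [eventually_gt_atTop 0] with n hn
        have : u / (n : ℝ) < 0 := div_neg_of_neg_of_pos hu (by exact_mod_cast hn)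
        simpa using this
      refine ((h.tendsto_left.comp h1).mul_const (-u)).congr' ?_
      filter_upwards [eventually_gt_atTop 0] with n hn
      have hn' : (n : ℝ) ≠ 0 := by exact_mod_cast hn.ne'
      simp only [Function.comp_apply]
      rw [show 1 - (1 + u / (n : ℝ)) = -u / n by ring]
      have := hu.ne
      field_simp
    · simp [hu, h.circle.one]
    · rw [if_neg (not_le.2 hu)]
      have h1 : Tendsto (fun n : ℕ => 1 + u / (n : ℝ)) atTop (𝓝[>] 1) := by
        refine tendsto_nhdsWithin_iff.2 ⟨h0, ?_⟩
        filter_upwards [eventually_gt_atTop 0] with n hn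
        have : 0 < u / (n : ℝ) := div_pos hu (by exact_mod_cast hn)
        simpa using this
      refine ((h.tendsto_right.comp h1).mul_const u).congr' ?_
      filter_upwards [eventually_gt_atTop 0] with n hn
      have hn' : (n : ℝ) ≠ 0 := by exact_mod_cast hn.ne'
      simp only [Function.comp_apply]
      rw [show 1 + u / (n : ℝ) - 1 = u / n by ring]
      have := hu.ne'
      field_simp
  have h4 := h3.mul (hV.sub hlog)
  have e : (1 + 0) * ((if u ≤ 0 then (Lminus - 1) * -u else (Lplus + 1) * u) - u)
      = if u ≤ 0 then -Lminus * u else Lplus * u := by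
    split_ifs <;> ring
  rw [e] at h4
  refine h4.congr' ?_
  filter_upwards [eventually_gt_atTop 0] with n hn
  have hn' : (n : ℝ) ≠ 0 := by exact_mod_cast hn.ne'
  field_simp

/-- Substitution r = 1 + u/n. The limiting integrand is a two-sided exponential with rates 2L₋ and
2L₊. -/
theorem tendsto_integral_near (k : ℕ) {R : ℝ} (hR : 1 < R) :
    Tendsto (fun n : ℕ => (n : ℝ) * ∫ r in Ioc 0 R, radialWeight χ V n k r) atTop
      (𝓝 (1 / (2 * Lminus) + 1 / (2 * Lplus))) := by
  have hχ := h.chi_pos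
  have hL := h.Lplus_pos
  have hL' := h.one_le_Lminus
  obtain ⟨δ, hδ, hδ'⟩ := h.exists_near_bound R hR
  have key : ∀ n : ℕ, 0 < n → (n : ℝ) * ∫ r in Ioc 0 R, radialWeight χ V n k r
      = ∫ u : ℝ, (Ioc 0 R).indicator (radialWeight χ V n k) (1 + u / n) := by
    intro n hn
    have hn' : (0 : ℝ) < n := by exact_mod_cast hn
    rw [Measure.integral_comp_div (fun u => (Ioc 0 R).indicator (radialWeight χ V n k) (1 + u)),
      integral_add_left_eq_self (fun u => (Ioc 0 R).indicator (radialWeight χ V n k) u) 1,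
      integral_indicator measurableSet_Ioc, abs_of_pos hn', smul_eq_mul]
  refine Tendsto.congr' (f₁ := fun n : ℕ =>
    ∫ u : ℝ, (Ioc 0 R).indicator (radialWeight χ V n k) (1 + u / n)) ?_ ?_
  · filter_upwards [eventually_gt_atTop 0] with n hn using (key n hn).symm
  rw [← integral_ite_exp (a := 2 * Lminus) (b := 2 * Lplus) (by positivity) (by positivity)]
  refine tendsto_integral_filter_of_dominated_convergence
    (fun u => if u ≤ 0 then Real.exp (1 * u) else Real.exp (-(2 * δ) * u)) ?_ ?_
    (integrable_ite_exp one_pos (by positivity)) ?_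
  · filter_upwards [eventually_gt_atTop 0] with n hn
    have h1 : AEStronglyMeasurable ((Ioc 0 R).indicator (radialWeight χ V n k)) volume :=
      (aestronglyMeasurable_indicator_iff measurableSet_Ioc).2
        (((h.continuousOn_radialWeight n k).mono Ioc_subset_Ioi_self).aestronglyMeasurable
          measurableSet_Ioc)
    have hn' : (n : ℝ) ≠ 0 := by exact_mod_cast hn.ne'
    refine h1.comp_quasiMeasurePreserving
      ((measurePreserving_add_left volume (1 : ℝ)).quasiMeasurePreserving.comp ?_)
    simp_rw [div_eq_inv_mul]
    exact Measure.quasiMeasurePreserving_smul volume (inv_ne_zero hn')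
  -- For n ≥ 2k+1 the exponent 2n-2k-1 is at least n, so for u ≤ 0 the power is at most (1+u/n)^n ≤
  -- e^u.
  · filter_upwards [eventually_ge_atTop (2 * k + 1)] with n hn
    have hn0 : 0 < n := by omega
    have hn' : (0 : ℝ) < n := by exact_mod_cast hn0
    have hnk : 2 * (k : ℝ) + 1 ≤ n := by exact_mod_cast hn
    refine ae_of_all _ fun u => ?_
    by_cases hmem : 1 + u / n ∈ Ioc 0 R
    swap
    · rw [indicator_of_notMem hmem, norm_zero]
      split_ifs <;> positivity
    rw [indicator_of_mem hmem, Real.norm_of_nonneg (radialWeight_nonneg χ V n k hmem.1.le)]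
    split_ifs with hu
    · rw [radialWeight_eq χ V hmem.1]
      have h1 : 1 + u / n ≤ 1 := by
        have := div_nonpos_of_nonpos_of_nonneg hu hn'.le
        linarith
      have h2 : (1 + u / (n : ℝ)) ^ (2 * (n : ℝ) - 2 * k - 1) ≤ Real.exp (1 * u) := by
        calc (1 + u / (n : ℝ)) ^ (2 * (n : ℝ) - 2 * k - 1) ≤ (1 + u / (n : ℝ)) ^ (n : ℝ) :=
              Real.rpow_le_rpow_of_exponent_ge hmem.1 h1 (by linarith)
          _ ≤ Real.exp (u / n) ^ (n : ℝ) :=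
              Real.rpow_le_rpow hmem.1.le (by linarith [Real.add_one_le_exp (u / (n : ℝ))]) hn'.le
          _ = Real.exp (1 * u) := by
              rw [← Real.exp_mul]
              field_simp
      have h3 : Real.exp (-2 * ((n : ℝ) + χ) * V (1 + u / n)) ≤ 1 := by
        refine Real.exp_le_one_iff.2 ?_
        have := mul_nonneg (show 0 ≤ (n : ℝ) + χ by positivity) (h.nonneg hmem.1.le)
        linarith
      exact (mul_le_mul h2 h3 (Real.exp_nonneg _) (Real.exp_nonneg _)).trans_eq (mul_one _)
    · rw [not_le] at hu
      have hun : 0 < u / n := by positivity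
      have h2 : (1 + u / (n : ℝ)) ^ (-(2 * (k : ℝ) + 2 * χ + 1)) ≤ 1 :=
        Real.rpow_le_one_of_one_le_of_nonpos (by linarith) (by
          have : (0 : ℝ) ≤ k := k.cast_nonneg
          linarith)
      have h3 := hδ' (1 + u / n) (by linarith) hmem.2
      have h4 : Real.exp (-2 * ((n : ℝ) + χ) * (V (1 + u / n) - Real.log (1 + u / n)))
          ≤ Real.exp (-(2 * δ) * u) := by
        refine Real.exp_le_exp.2 ?_
        have h5 : δ * u ≤ (n : ℝ) * (V (1 + u / n) - Real.log (1 + u / n)) := by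
          have := mul_le_mul_of_nonneg_left h3 hn'.le
          calc δ * u = n * (δ * (1 + u / n - 1)) := by field_simp; ring
            _ ≤ _ := this
        have h6 := mul_nonneg hχ.le (sub_nonneg.2 (h.log_le hmem.1.le))
        linarith
      exact (mul_le_mul h2 h4 (Real.exp_nonneg _) zero_le_one).trans_eq (one_mul _)
  · refine ae_of_all _ fun u => ?_
    have h0 : Tendsto (fun n : ℕ => 1 + u / (n : ℝ)) atTop (𝓝 1) := by
      simpa using tendsto_const_nhds.add (tendsto_const_div_atTop_nhds_zero_nat u)
    have h1 := (Real.continuousAt_rpow_const 1 (-(2 * (k : ℝ) + 2 * χ + 1))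
      (Or.inl one_ne_zero)).tendsto.comp h0
    have h2 := h1.mul (((h.tendsto_near_exponent u).const_mul (-2)).rexp)
    have e : (1 : ℝ) ^ (-(2 * (k : ℝ) + 2 * χ + 1)) *
        Real.exp (-2 * (if u ≤ 0 then -Lminus * u else Lplus * u))
        = if u ≤ 0 then Real.exp (2 * Lminus * u) else Real.exp (-(2 * Lplus) * u) := by
      rw [Real.one_rpow, one_mul]
      split_ifs <;> ring_nf
    rw [e] at h2
    refine h2.congr' ?_
    filter_upwards [h0.eventually_const_lt one_pos, h0.eventually_lt_const hR] with n hn1 hn2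
    rw [indicator_of_mem (show 1 + u / (n : ℝ) ∈ Ioc 0 R from ⟨hn1, hn2.le⟩), radialWeight, Function.comp_apply, mul_assoc (-2 : ℝ)]

end IsAdmissiblePotential

/-- The total mass of the weight `|x| ^ (2 (n - 1 - k)) exp (-2 (n + χ) V |x|)` on `ℂ`. -/
noncomputable def radialMass (χ : ℝ) (V : ℝ → ℝ) (n k : ℕ) : ℝ :=
  2 * Real.pi * ∫ r in Ioi 0, radialWeight χ V n k r

/-- The total mass of `|z| ^ (-2 k - 2 χ - 2) exp (-2 γ / |z| ^ α)` on `ℂ`. -/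
noncomputable def limitMass (χ α γ : ℝ) (k : ℕ) : ℝ :=
  2 * Real.pi * ∫ ρ in Ioi (0 : ℝ), ρ ^ (-(2 * (k : ℝ) + 2 * χ + 1)) *
    Real.exp (-2 * γ * ρ ^ (-α))

theorem limitMass_eq (χ α γ : ℝ) (k : ℕ) :
    limitMass χ α γ k = 2 * Real.pi * ∫ r in Ioi (0 : ℝ),
      r ^ (2 * (k : ℝ) + 2 * χ - 1) * Real.exp (-2 * γ * r ^ α) := by
  rw [limitMass, ← integral_comp_rpow_Ioi _ (show (-1 : ℝ) ≠ 0 by norm_num)]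
  congr 1
  refine setIntegral_congr_fun measurableSet_Ioi fun ρ hρ => ?_
  have hρ0 : 0 < ρ := hρ
  simp only [abs_neg, abs_one, one_mul, smul_eq_mul]
  rw [← Real.rpow_mul hρ0.le, ← Real.rpow_mul hρ0.le, ← mul_assoc, ← Real.rpow_add hρ0]
  congr 2
  · ring
  · ring_nf

theorem integral_Ioi_pos {f : ℝ → ℝ} {a : ℝ} (hf : IntegrableOn f (Ioi a))
    (hpos : ∀ r ∈ Ioi a, 0 < f r) : 0 < ∫ r in Ioi a, f r := by
  rw [setIntegral_pos_iff_support_of_nonneg_ae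
    ((ae_restrict_iff' measurableSet_Ioi).2 (ae_of_all _ fun r hr => (hpos r hr).le)) hf,
    inter_eq_self_of_subset_right (show Ioi a ⊆ Function.support f from
      fun r hr => (hpos r hr).ne')]
  simp

theorem limitMass_pos {χ α γ : ℝ} (hχ : 0 < χ) (hα : 0 < α) (hγ : 0 < γ) (k : ℕ) :
    0 < limitMass χ α γ k := by
  have h1 : ∀ ρ ∈ Ioi (0 : ℝ), 0 < ρ ^ (-(2 * (k : ℝ) + 2 * χ + 1)) *
      Real.exp (-(2 * γ) * ρ ^ (-α)) := fun ρ hρ =>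
    mul_pos (Real.rpow_pos_of_pos hρ _) (Real.exp_pos _)
  have h2 := integrableOn_rpow_mul_exp_neg (q := 2 * (k : ℝ) + 2 * χ) (c := 2 * γ) hα
    (by positivity) (by positivity)
  have h3 := integral_Ioi_pos h2 h1
  simp only [← neg_mul] at h3
  rw [limitMass]
  positivity

theorem limitMass_of_eq {χ α γ : ℝ} (hα : 0 < α) (hγ : 0 < γ) {k : ℕ}
    (hk : 2 * (k : ℝ) + 2 * χ = α) : limitMass χ α γ k = Real.pi / (α * γ) := by
  rw [limitMass_eq, hk]
  have h1 := integral_rpow_mul_exp_neg_mul_rpow (p := α) (q := α - 1) (b := 2 * γ) hα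
    (by linarith) (by positivity)
  simp only [← neg_mul] at h1
  rw [h1, sub_add_cancel, neg_div, div_self hα.ne', Real.Gamma_one, Real.rpow_neg_one]
  field_simp

theorem rpow_one_div_rpow {x α q : ℝ} (hx : 0 ≤ x) : (x ^ (1 / α)) ^ q = x ^ (q / α) := by
  rw [← Real.rpow_mul hx, one_div_mul_eq_div]

/-! ### Comparison of the two contributions to the radial mass. -/

namespace IsAdmissiblePotential

variable {χ : ℝ} {V : ℝ → ℝ} {α γ Lplus Lminus : ℝ}
  (h : IsAdmissiblePotential χ V α γ Lplus Lminus)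

include h

/-- On the interval (1, 1+1/n] the power of r is at least 1 for every k < n and V is at most
(L₊+2)/n, so the weight is bounded below. The uniformity in k is what the tail estimate of the
determinant needs. -/
theorem exists_le_radialMass :
    ∃ c > 0, ∀ᶠ n : ℕ in atTop, ∀ k < n, c / n ≤ radialMass χ V n k := by
  have hχ := h.chi_pos
  have hL := h.Lplus_pos
  have h1 := h.tendsto_right.eventually_lt_const (show Lplus + 1 < Lplus + 2 by linarith)
  obtain ⟨b, hb, hb'⟩ := mem_nhdsGT_iff_exists_Ioo_subset.1 h1
  have hb1 : 0 < b - 1 := sub_pos.2 hb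
  set c₀ := Real.exp (-2 * (1 + χ) * (Lplus + 2))
  refine ⟨2 * Real.pi * c₀, by positivity, ?_⟩
  filter_upwards [eventually_gt_atTop 0, (tendsto_one_div_atTop_nhds_zero_nat
    (𝕜 := ℝ)).eventually_lt_const hb1] with n hn hnb k hk
  have hn' : (0 : ℝ) < n := by exact_mod_cast hn
  have hn1 : (1 : ℝ) ≤ n := by exact_mod_cast hn
  have hkn : (k : ℝ) + 1 ≤ n := by exact_mod_cast hk
  have hsub : Ioc (1 : ℝ) (1 + 1 / n) ⊆ Ioi 0 := fun r hr => zero_lt_one.trans hr.1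
  have h2 : ∀ r ∈ Ioc (1 : ℝ) (1 + 1 / n), c₀ ≤ radialWeight χ V n k r := by
    intro r hr
    have hr0 : 0 < r := hsub hr
    rw [radialWeight_eq χ V hr0]
    have h3 : 1 ≤ r ^ (2 * (n : ℝ) - 2 * k - 1) := Real.one_le_rpow hr.1.le (by linarith)
    have h4 : V r / (r - 1) < Lplus + 2 := hb' ⟨hr.1, by linarith [hr.2]⟩
    have hr1 : 0 < r - 1 := sub_pos.2 hr.1
    rw [div_lt_iff₀ hr1] at h4
    have h5 : V r ≤ (Lplus + 2) * (1 / n) :=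
      h4.le.trans (mul_le_mul_of_nonneg_left (by linarith [hr.2]) (by linarith))
    have h6 : c₀ ≤ Real.exp (-2 * ((n : ℝ) + χ) * V r) := by
      refine Real.exp_le_exp.2 ?_
      have h7 : ((n : ℝ) + χ) * V r ≤ ((n : ℝ) + χ) * ((Lplus + 2) * (1 / n)) :=
        mul_le_mul_of_nonneg_left h5 (by positivity)
      have h8 : ((n : ℝ) + χ) * ((Lplus + 2) * (1 / n)) = (1 + χ / n) * (Lplus + 2) := by
        field_simp
      have h9 : χ / n ≤ χ := div_le_self hχ.le hn1
      have h10 := mul_le_mul_of_nonneg_right h9 (show 0 ≤ Lplus + 2 by linarith)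
      linarith
    calc c₀ = 1 * c₀ := (one_mul _).symm
      _ ≤ _ := mul_le_mul h3 h6 (Real.exp_nonneg _) (by linarith)
  have h3 : c₀ * (1 / n) ≤ ∫ r in Ioi 0, radialWeight χ V n k r :=
    calc c₀ * (1 / n) = ∫ _ in Ioc (1 : ℝ) (1 + 1 / n), c₀ := by
          rw [setIntegral_const, measureReal_def, Real.volume_Ioc, add_sub_cancel_left,
            ENNReal.toReal_ofReal (by positivity), smul_eq_mul, mul_comm]
      _ ≤ ∫ r in Ioc (1 : ℝ) (1 + 1 / n), radialWeight χ V n k r :=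
          setIntegral_mono_on (by simp) ((h.integrableOn_radialWeight hk).mono_set hsub)
            measurableSet_Ioc h2
      _ ≤ _ := setIntegral_mono_set (h.integrableOn_radialWeight hk)
          ((ae_restrict_iff' measurableSet_Ioi).2 (ae_of_all _ fun r hr =>
            radialWeight_nonneg χ V n k (le_of_lt hr))) hsub.eventuallyLE
  rw [radialMass]
  calc 2 * Real.pi * c₀ / n = 2 * Real.pi * (c₀ * (1 / n)) := by ring
    _ ≤ _ := mul_le_mul_of_nonneg_left h3 (by positivity)

theorem radialMass_pos {n k : ℕ} (hk : k < n) : 0 < radialMass χ V n k := by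
  have h3 := integral_Ioi_pos (h.integrableOn_radialWeight hk) fun r hr =>
    mul_pos (Real.rpow_pos_of_pos hr _) (Real.exp_pos _)
  rw [radialMass]
  positivity

/-- With q = 2k+2χ, the far part scales like n^(-q/α) and the circle part like 1/n. The ratio
n^(q/α-1) tends to 0, equals 1, or tends to infinity, which gives the three cases of a_k. In the
last case the lower bound c/n suffices. -/
theorem tendsto_radialMass (k : ℕ) :
    Tendsto (fun n : ℕ => (((n : ℝ) ^ (1 / α)) ^ (2 * (k : ℝ) + 2 * χ) *
      radialMass χ V n k)⁻¹) atTop (𝓝 (limitCoeff χ α γ Lminus Lplus k)) := by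
  have hα := h.alpha_pos
  have hχ := h.chi_pos
  have hγ := h.gamma_pos
  have hL := h.Lplus_pos
  have hL' := h.one_le_Lminus
  obtain ⟨R, hR, hb⟩ := h.exists_far_bound
  have hfar := h.tendsto_integral_far k (zero_lt_one.trans hR) hb
  have hnear := h.tendsto_integral_near k hR
  set q : ℝ := 2 * (k : ℝ) + 2 * χ with hq
  have hsplit : ∀ᶠ n : ℕ in atTop, 2 * Real.pi * (((n : ℝ) ^ (q / α) / n) *
      ((n : ℝ) * ∫ r in Ioc 0 R, radialWeight χ V n k r) + ((n : ℝ) ^ (1 / α)) ^ q *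
        ∫ r in Ioi R, radialWeight χ V n k r)
      = ((n : ℝ) ^ (1 / α)) ^ q * radialMass χ V n k := by
    filter_upwards [eventually_gt_atTop k] with n hn
    have hn' : (n : ℝ) ≠ 0 := by exact_mod_cast (by omega : n ≠ 0)
    have hi := h.integrableOn_radialWeight hn
    rw [radialMass, ← Ioc_union_Ioi_eq_Ioi (zero_le_one.trans hR.le),
      setIntegral_union (Ioc_disjoint_Ioi le_rfl) measurableSet_Ioi
      (hi.mono_set Ioc_subset_Ioi_self) (hi.mono_set (Ioi_subset_Ioi (zero_le_one.trans hR.le))),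
      rpow_one_div_rpow n.cast_nonneg]
    field_simp
  have hratio : ∀ n : ℕ, n ≠ 0 → (n : ℝ) ^ (q / α) / n = (n : ℝ) ^ (q / α - 1) := by
    intro n hn
    rw [Real.rpow_sub_one (by exact_mod_cast hn)]
  rcases lt_trichotomy q α with hqα | hqα | hqα
  · rw [limitCoeff, if_pos (hq ▸ hqα), ← limitMass_eq]
    refine Tendsto.inv₀ ?_ (limitMass_pos hχ hα hγ k).ne'
    have h1 : Tendsto (fun n : ℕ => (n : ℝ) ^ (q / α) / n) atTop (𝓝 0) := by
      have : 0 < 1 - q / α := by rw [sub_pos, div_lt_one hα]; exact hqα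
      have h2 := (tendsto_rpow_neg_atTop this).comp (tendsto_natCast_atTop_atTop (R := ℝ))
      refine h2.congr' ?_
      filter_upwards [eventually_ne_atTop 0] with n hn
      rw [hratio n hn, Function.comp_apply, neg_sub]
    have h2 := ((h1.mul hnear).add hfar).const_mul (2 * Real.pi)
    rw [zero_mul, zero_add] at h2
    exact h2.congr' hsplit
  · have hc : limitCoeff χ α γ Lminus Lplus k
        = (2 * Real.pi * (1 / (2 * Lminus) + 1 / (2 * Lplus)) + limitMass χ α γ k)⁻¹ := by
      rw [limitMass_of_eq hα hγ (hq ▸ hqα), limitCoeff, if_neg (by rw [← hq, hqα]; exact lt_irrefl _),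
        if_pos (hq ▸ hqα)]
      congr 1
      field_simp
      ring
    rw [hc]
    refine Tendsto.inv₀ ?_ (add_pos (by positivity) (limitMass_pos hχ hα hγ k)).ne'
    have h1 : Tendsto (fun n : ℕ => (n : ℝ) ^ (q / α) / n) atTop (𝓝 1) := by
      refine tendsto_const_nhds.congr' ?_
      filter_upwards [eventually_ne_atTop 0] with n hn
      rw [hratio n hn, hqα, div_self hα.ne', sub_self, Real.rpow_zero]
    have h2 := ((h1.mul hnear).add hfar).const_mul (2 * Real.pi)
    rw [one_mul, mul_add, ← limitMass] at h2
    exact h2.congr' hsplit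
  · rw [limitCoeff, if_neg (not_lt.2 (hq ▸ hqα.le)), if_neg (hq ▸ hqα.ne')]
    refine Tendsto.inv_tendsto_atTop ?_
    obtain ⟨c, hc, hc'⟩ := h.exists_le_radialMass
    have h1 : Tendsto (fun n : ℕ => c * (n : ℝ) ^ (q / α - 1)) atTop atTop := by
      have : 0 < q / α - 1 := by rw [sub_pos, one_lt_div hα]; exact hqα
      exact ((tendsto_rpow_atTop this).comp tendsto_natCast_atTop_atTop).const_mul_atTop hc
    refine tendsto_atTop_mono' _ ?_ h1
    filter_upwards [hc', eventually_gt_atTop k] with n hn hkn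
    have hn0 : n ≠ 0 := by omega
    rw [← hratio n hn0, rpow_one_div_rpow n.cast_nonneg]
    calc c * ((n : ℝ) ^ (q / α) / n) = (n : ℝ) ^ (q / α) * (c / n) := by ring
      _ ≤ _ := mul_le_mul_of_nonneg_left (hn k hkn) (by positivity)

end IsAdmissiblePotential

/-! ### Rotation invariance and polar coordinates -/

theorem integral_comp_norm_complex {F : Type*} [NormedAddCommGroup F] [NormedSpace ℝ F]
    (f : ℝ → F) : ∫ z : ℂ, f ‖z‖ = (2 * Real.pi) • ∫ r in Ioi (0 : ℝ), r • f r := by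
  rw [integral_fun_norm_addHaar, Complex.finrank_real_complex, measureReal_def,
    Complex.volume_ball, ← Nat.cast_smul_eq_nsmul ℝ, smul_smul]
  simp

theorem integrable_comp_norm_complex_iff {F : Type*} [NormedAddCommGroup F] [NormedSpace ℝ F]
    {f : ℝ → F} :
    Integrable (fun z : ℂ => f ‖z‖) ↔ IntegrableOn (fun r : ℝ => r • f r) (Ioi 0) := by
  rw [integrable_fun_norm_addHaar, Complex.finrank_real_complex]
  simp

theorem measurePreserving_mul_of_norm_eq_one {c : ℂ} (hc : ‖c‖ = 1) :
    MeasurePreserving (fun z : ℂ => c * z) := by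
  have h1 : c ∈ Submonoid.unitSphere ℂ := by simpa [Submonoid.unitSphere] using hc
  exact (rotation (⟨c, h1⟩ : Circle)).measurePreserving

/-- A rotation by c with c^(m-l) = -1 preserves Lebesgue measure and changes the sign of the
integrand. Integrability plays no role. -/
theorem integral_zpow_mul_star_zpow_eq_zero {m l : ℤ} (hml : m ≠ l) (g : ℝ → ℂ) :
    ∫ z : ℂ, z ^ m * star (z ^ l) * g ‖z‖ = 0 := by
  set d : ℝ := ((m - l : ℤ) : ℝ)
  have hd : d ≠ 0 := Int.cast_ne_zero.2 (sub_ne_zero.2 hml)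
  set c : ℂ := Complex.exp ((Real.pi / d : ℝ) * Complex.I)
  have hc : ‖c‖ = 1 := Complex.norm_exp_ofReal_mul_I _
  have hc0 : c ≠ 0 := Complex.exp_ne_zero _
  have hstar : star c = c⁻¹ := by
    rw [Complex.star_def, Complex.inv_def, Complex.normSq_eq_norm_sq, hc]
    simp
  have hcm : c ^ m * star (c ^ l) = -1 := by
    rw [star_zpow₀, hstar, inv_zpow', ← zpow_add₀ hc0, ← sub_eq_add_neg, ← Complex.exp_int_mul,
      ← Complex.exp_pi_mul_I]
    congr 1
    have h1 : ((m - l : ℤ) : ℂ) = (d : ℂ) := by simp [d]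
    have hd' : (d : ℂ) ≠ 0 := by exact_mod_cast hd
    rw [h1]
    push_cast
    field_simp
  have h1 := (measurePreserving_mul_of_norm_eq_one hc).integral_comp
    (measurableEmbedding_mulLeft₀ hc0) fun z : ℂ => z ^ m * star (z ^ l) * g ‖z‖
  have h2 : ∀ z : ℂ, (c * z) ^ m * star ((c * z) ^ l) * g ‖c * z‖
      = -(z ^ m * star (z ^ l) * g ‖z‖) := by
    intro z
    rw [norm_mul, hc, one_mul, mul_zpow, mul_zpow, star_mul']
    linear_combination (z ^ m * star (z ^ l) * g ‖z‖) * hcm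
  simp_rw [h2, integral_neg] at h1
  exact self_eq_neg.1 h1.symm

/-- The function `z ^ m g(|z|)`. -/
noncomputable def radialMode (m : ℤ) (g : ℝ → ℝ) (z : ℂ) : ℂ := z ^ m * (g ‖z‖ : ℂ)

theorem norm_radialMode_sq (m : ℤ) (g : ℝ → ℝ) (z : ℂ) :
    ‖radialMode m g z‖ ^ 2 = (‖z‖ ^ m * g ‖z‖) ^ 2 := by
  rw [radialMode, norm_mul, norm_zpow, Complex.norm_real, mul_pow, mul_pow, Real.norm_eq_abs,
    sq_abs]

theorem measurable_radialMode {m : ℤ} {g : ℝ → ℝ} (hg : Measurable fun z : ℂ => g ‖z‖) :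
    Measurable (radialMode m g) :=
  (measurable_id.pow_const m).mul (Complex.measurable_ofReal.comp hg)

theorem isOrthonormalFamily_radialMode {n : ℕ} {m : Fin n → ℤ} (hm : Function.Injective m)
    {g : Fin n → ℝ → ℝ} (hg : ∀ k, Measurable fun z : ℂ => g k ‖z‖)
    (hi : ∀ k, IntegrableOn (fun r : ℝ => r * (r ^ m k * g k r) ^ 2) (Ioi 0))
    (h1 : ∀ k, 2 * Real.pi * ∫ r in Ioi (0 : ℝ), r * (r ^ m k * g k r) ^ 2 = 1) :
    IsOrthonormalFamily volume fun k => radialMode (m k) (g k) := by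
  refine ⟨fun k => measurable_radialMode (hg k), fun k => ?_, fun j k => ?_⟩
  · rw [memLp_two_iff_integrable_sq_norm (measurable_radialMode (hg k)).aestronglyMeasurable]
    simp_rw [norm_radialMode_sq]
    rw [integrable_comp_norm_complex_iff (f := fun r => (r ^ m k * g k r) ^ 2)]
    exact hi k
  · split_ifs with hjk
    · subst hjk
      have e : ∀ z : ℂ, radialMode (m j) (g j) z * star (radialMode (m j) (g j) z)
          = (((‖z‖ ^ m j * g j ‖z‖) ^ 2 : ℝ) : ℂ) := by
        intro z
        rw [Complex.star_def, Complex.mul_conj, Complex.normSq_eq_norm_sq, norm_radialMode_sq]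
      simp_rw [e]
      rw [integral_complex_ofReal, integral_comp_norm_complex fun r => (r ^ m j * g j r) ^ 2]
      simp only [smul_eq_mul]
      rw [h1 j, Complex.ofReal_one]
    · have e : ∀ z : ℂ, radialMode (m j) (g j) z * star (radialMode (m k) (g k) z)
          = z ^ m j * star (z ^ m k) * ((fun r => ((g j r * g k r : ℝ) : ℂ)) ‖z‖) := by
        intro z
        simp only [radialMode, star_mul', Complex.star_def, Complex.conj_ofReal]
        push_cast
        ring
      simp_rw [e]
      exact integral_zpow_mul_star_zpow_eq_zero (fun h => hjk (hm h))
        fun r => ((g j r * g k r : ℝ) : ℂ)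

/-! ### The Coulomb gas as a projection ensemble -/

/-- The orthonormal functions of the Coulomb gas. -/
noncomputable def gasMode (χ : ℝ) (V : ℝ → ℝ) (n k : ℕ) : ℂ → ℂ :=
  radialMode ((n : ℤ) - 1 - k) fun r =>
    Real.exp (-((n : ℝ) + χ) * V r) / √(radialMass χ V n k)

/-- The orthonormal functions of the limiting process. -/
noncomputable def limitMode (χ α γ : ℝ) (k : ℕ) : ℂ → ℂ :=
  radialMode (-(k : ℤ)) fun r =>
    r ^ (-(χ + 1)) * Real.exp (-γ * r ^ (-α)) / √(limitMass χ α γ k)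

theorem limitMode_integrand_eq (χ α γ : ℝ) (k : ℕ) {r : ℝ} (hr : 0 < r) :
    r * (r ^ (-(k : ℤ)) * (r ^ (-(χ + 1)) * Real.exp (-γ * r ^ (-α)) /
      √(limitMass χ α γ k))) ^ 2
      = r ^ (-(2 * (k : ℝ) + 2 * χ + 1)) * Real.exp (-2 * γ * r ^ (-α)) *
        (√(limitMass χ α γ k) ^ 2)⁻¹ := by
  have h1 : Real.exp (-2 * γ * r ^ (-α)) = Real.exp (-γ * r ^ (-α)) ^ 2 := by
    rw [← Real.exp_nat_mul]
    push_cast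
    ring_nf
  have h2 : r ^ (-(2 * (k : ℝ) + 2 * χ + 1)) = r * (r ^ (-(k : ℤ)) * r ^ (-(χ + 1))) ^ 2 := by
    rw [← Real.rpow_intCast, ← Real.rpow_add hr, ← Real.rpow_natCast, ← Real.rpow_mul hr.le]
    nth_rw 2 [← Real.rpow_one r]
    rw [← Real.rpow_add hr]
    congr 1
    push_cast
    ring
  rw [h1, h2, mul_pow, mul_pow, div_pow, mul_pow]
  ring

theorem isOrthonormalFamily_limitMode {χ α γ : ℝ} (hχ : 0 < χ) (hα : 0 < α) (hγ : 0 < γ)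
    (n : ℕ) : IsOrthonormalFamily volume fun k : Fin n => limitMode χ α γ k := by
  have hpos := limitMass_pos hχ hα hγ
  refine isOrthonormalFamily_radialMode (m := fun k : Fin n => -((k : ℕ) : ℤ))
    (fun i j hij => by simpa [Fin.ext_iff] using hij) (fun k => ?_) (fun k => ?_) fun k => ?_
  · fun_prop
  · refine IntegrableOn.congr_fun ((integrableOn_rpow_mul_exp_neg (q := 2 * (k : ℝ) + 2 * χ)
      (c := 2 * γ) hα (by positivity) (by positivity)).mul_const
      (√(limitMass χ α γ k) ^ 2)⁻¹) (fun r hr => ?_) measurableSet_Ioi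
    rw [limitMode_integrand_eq χ α γ k hr]
    simp only [neg_mul]
  · rw [setIntegral_congr_fun measurableSet_Ioi fun r hr => limitMode_integrand_eq χ α γ k hr,
      integral_mul_const, ← mul_assoc, ← limitMass, Real.sq_sqrt (hpos k).le,
      mul_inv_cancel₀ (hpos k).ne']

theorem gasMode_integrand_eq (χ : ℝ) (V : ℝ → ℝ) (n k : ℕ) {r : ℝ} (hr : 0 < r) :
    r * (r ^ ((n : ℤ) - 1 - k) * (Real.exp (-((n : ℝ) + χ) * V r) /
      √(radialMass χ V n k))) ^ 2
      = radialWeight χ V n k r * (√(radialMass χ V n k) ^ 2)⁻¹ := by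
  have h1 : Real.exp (-2 * ((n : ℝ) + χ) * V r) = Real.exp (-((n : ℝ) + χ) * V r) ^ 2 := by
    rw [← Real.exp_nat_mul]
    push_cast
    ring_nf
  have h2 : r ^ (2 * (n : ℝ) - 2 * k - 1) = r * (r ^ ((n : ℤ) - 1 - k)) ^ 2 := by
    rw [← Real.rpow_intCast, ← Real.rpow_natCast, ← Real.rpow_mul hr.le]
    nth_rw 2 [← Real.rpow_one r]
    rw [← Real.rpow_add hr]
    congr 1
    push_cast
    ring
  rw [radialWeight_eq χ V hr, h1, h2, mul_pow, div_pow]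
  ring

namespace IsAdmissiblePotential

variable {χ : ℝ} {V : ℝ → ℝ} {α γ Lplus Lminus : ℝ}
  (h : IsAdmissiblePotential χ V α γ Lplus Lminus)

include h

theorem continuous_comp_norm : Continuous fun z : ℂ => V ‖z‖ :=
  h.circle.continuousOn.comp_continuous continuous_norm fun z => norm_nonneg z

theorem isOrthonormalFamily_gasMode (n : ℕ) :
    IsOrthonormalFamily volume fun k : Fin n => gasMode χ V n k := by
  refine isOrthonormalFamily_radialMode (m := fun k : Fin n => (n : ℤ) - 1 - (k : ℕ))
    (fun i j hij => by simpa [Fin.ext_iff] using hij) (fun k => ?_) (fun k => ?_) fun k => ?_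
  · exact ((h.continuous_comp_norm.measurable.const_mul _).exp).div_const _
  · refine IntegrableOn.congr_fun ((h.integrableOn_radialWeight k.2).mul_const
      (√(radialMass χ V n k) ^ 2)⁻¹) (fun r hr => ?_) measurableSet_Ioi
    rw [gasMode_integrand_eq χ V n k hr]
  · rw [setIntegral_congr_fun measurableSet_Ioi fun r hr => gasMode_integrand_eq χ V n k hr,
      integral_mul_const, ← mul_assoc, ← radialMass, Real.sq_sqrt (h.radialMass_pos k.2).le,
      mul_inv_cancel₀ (h.radialMass_pos k.2).ne']

theorem norm_det_gasMode_sq (n : ℕ) (x : Fin n → ℂ) :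
    ‖(Matrix.of fun i j : Fin n => gasMode χ V n j (x i)).det‖ ^ 2
      = ((∏ i, ∏ j ∈ Finset.Ioi i, ‖x i - x j‖ ^ 2) *
        Real.exp (-2 * ((n : ℝ) + χ) * ∑ i, V ‖x i‖)) * (∏ k : Fin n, radialMass χ V n k)⁻¹ := by
  have e : (Matrix.of fun i j : Fin n => gasMode χ V n j (x i))
      = Matrix.of fun i j : Fin n => (fun j : Fin n => ((√(radialMass χ V n j))⁻¹ : ℂ)) j *
        (Matrix.of fun i j : Fin n => (fun i : Fin n =>
          ((Real.exp (-((n : ℝ) + χ) * V ‖x i‖) : ℝ) : ℂ)) i *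
          Matrix.projVandermonde (fun _ => 1) x i j) i j := by
    ext i j
    -- Modes are numbered from the highest degree down, so the matrix is a Vandermonde matrix with
    -- reversed columns.
    have h1 : (n : ℤ) - 1 - (j : ℕ) = ((Fin.rev j : ℕ) : ℤ) := by
      rw [Fin.val_rev]
      have := j.2
      omega
    simp only [Matrix.of_apply, gasMode, radialMode, Matrix.projVandermonde_apply, h1,
      zpow_natCast, one_pow, one_mul]
    push_cast
    ring
  rw [e, Matrix.det_mul_row, Matrix.det_mul_column, Matrix.det_projVandermonde]
  simp only [norm_mul, norm_prod, norm_inv, Complex.norm_real, one_mul, mul_pow]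
  rw [← Finset.prod_pow, ← Finset.prod_pow, ← Finset.prod_pow, ← Finset.prod_inv_distrib,
    Finset.mul_sum, Real.exp_sum, mul_comm]
  congr 1
  · rw [mul_comm]
    congr 1
    · exact Finset.prod_congr rfl fun i _ => by rw [← Finset.prod_pow]
    · refine Finset.prod_congr rfl fun i _ => ?_
      rw [Real.norm_of_nonneg (Real.exp_nonneg _), ← Real.exp_nat_mul]
      push_cast
      ring_nf
  · refine Finset.prod_congr rfl fun i _ => ?_
    rw [inv_pow, Real.norm_of_nonneg (Real.sqrt_nonneg _), Real.sq_sqrt (h.radialMass_pos i.2).le]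

theorem coulombGas_eq (n : ℕ) :
    coulombGas χ V n = projectionEnsemble volume fun k : Fin n => gasMode χ V n k := by
  have hprob := (h.isOrthonormalFamily_gasMode n).isProbabilityMeasure
  set C : ℝ := (n.factorial : ℝ) * ∏ k : Fin n, radialMass χ V n k
  have hC : 0 < C := mul_pos (by positivity) (Finset.prod_pos fun k _ => h.radialMass_pos k.2)
  have hw : coulombWeight χ V n = ENNReal.ofReal C •
      projectionEnsemble volume fun k : Fin n => gasMode χ V n k := by
    rw [coulombWeight, projectionEnsemble,
      ← withDensity_smul _ (h.isOrthonormalFamily_gasMode n).measurable_density]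
    congr 1
    ext x
    rw [Pi.smul_apply, smul_eq_mul, ← ENNReal.ofReal_mul hC.le, h.norm_det_gasMode_sq]
    congr 1
    have h1 : (n.factorial : ℝ) ≠ 0 := by positivity
    have h2 : ∏ k : Fin n, radialMass χ V n k ≠ 0 :=
      (Finset.prod_pos fun k _ => h.radialMass_pos k.2).ne'
    simp only [C]
    field_simp
  have h0 : ENNReal.ofReal C ≠ 0 := (ENNReal.ofReal_pos.2 hC).ne'
  rw [coulombGas, hw, Measure.smul_apply, measure_univ, smul_eq_mul, mul_one, smul_smul,
    ENNReal.inv_mul_cancel h0 ENNReal.ofReal_ne_top, one_smul]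

theorem isProbabilityMeasure_coulombGas (n : ℕ) : IsProbabilityMeasure (coulombGas χ V n) := by
  rw [h.coulombGas_eq]
  exact (h.isOrthonormalFamily_gasMode n).isProbabilityMeasure

end IsAdmissiblePotential

/-! ### Scaling limit of the orthonormal functions -/

/-- The radial profile of the rescaled modes of the gas. -/
noncomputable def scaledProfile (χ : ℝ) (V : ℝ → ℝ) (n : ℕ) (s r : ℝ) : ℝ :=
  r ^ (-(χ + 1)) * Real.exp (-((n : ℝ) + χ) * (V (s * r) - Real.log (s * r)))

/-- All modes share the phase (y/|y|)^(n-1), which cancels in ψ_j ψ̄_k. Removing it turns the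
growing degree n-1-k into the fixed degree -k. The factor s is the square root of the Jacobian. -/
theorem gasMode_smul (χ : ℝ) (V : ℝ → ℝ) (n k : ℕ) {s : ℝ} (hs : 0 < s) {y : ℂ} (hy : y ≠ 0) :
    (s : ℂ) * gasMode χ V n k (s • y)
      = (√((s ^ (2 * (k : ℝ) + 2 * χ) * radialMass χ V n k)⁻¹) : ℂ) *
        ((y / ‖y‖) ^ ((n : ℤ) - 1) * radialMode (-(k : ℤ)) (scaledProfile χ V n s) y) := by
  have hy0 : 0 < ‖y‖ := norm_pos_iff.2 hy
  have hyc : (‖y‖ : ℂ) ≠ 0 := by exact_mod_cast hy0.ne'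
  have hsc : (s : ℂ) ≠ 0 := by exact_mod_cast hs.ne'
  have h1 : √((s ^ (2 * (k : ℝ) + 2 * χ) * radialMass χ V n k)⁻¹)
      = s ^ (-((k : ℝ) + χ)) / √(radialMass χ V n k) := by
    rw [Real.sqrt_inv, Real.sqrt_mul (Real.rpow_nonneg hs.le _), Real.sqrt_eq_rpow,
      ← Real.rpow_mul hs.le, mul_inv, ← Real.rpow_neg hs.le, div_eq_mul_inv]
    congr 2
    ring
  have h2 : Real.exp (-((n : ℝ) + χ) * V (s * ‖y‖))
      = (s * ‖y‖) ^ (-((n : ℝ) + χ)) *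
        Real.exp (-((n : ℝ) + χ) * (V (s * ‖y‖) - Real.log (s * ‖y‖))) := by
    rw [Real.rpow_def_of_pos (by positivity), ← Real.exp_add]
    ring_nf
  have h3 : s * s ^ ((n : ℤ) - 1 - k) * (s * ‖y‖) ^ (-((n : ℝ) + χ))
      = s ^ (-((k : ℝ) + χ)) * (‖y‖ ^ ((n : ℤ) - 1))⁻¹ * ‖y‖ ^ (-(χ + 1)) := by
    rw [Real.mul_rpow hs.le hy0.le, ← Real.rpow_intCast, ← Real.rpow_intCast,
      ← Real.rpow_neg hy0.le]
    nth_rw 1 [← Real.rpow_one s]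
    rw [← mul_assoc, ← Real.rpow_add hs, ← Real.rpow_add hs, mul_assoc (s ^ _),
      ← Real.rpow_add hy0]
    congr 2 <;> · push_cast; ring
  have h4 : (y : ℂ) ^ ((n : ℤ) - 1 - k) = y ^ ((n : ℤ) - 1) * y ^ (-(k : ℤ)) := by
    rw [← zpow_add₀ hy]
    ring_nf
  have h3' : (s : ℂ) * (s : ℂ) ^ ((n : ℤ) - 1 - k) * (((s * ‖y‖) ^ (-((n : ℝ) + χ)) : ℝ) : ℂ)
      = ((s ^ (-((k : ℝ) + χ)) : ℝ) : ℂ) * ((‖y‖ : ℂ) ^ ((n : ℤ) - 1))⁻¹ *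
        ((‖y‖ ^ (-(χ + 1)) : ℝ) : ℂ) := by
    exact_mod_cast congrArg (fun x : ℝ => (x : ℂ)) h3
  simp only [gasMode, radialMode, scaledProfile]
  rw [norm_smul, Real.norm_of_nonneg hs.le, h1, h2, Complex.real_smul, mul_zpow, h4, div_zpow]
  simp only [Complex.ofReal_mul, Complex.ofReal_div]
  linear_combination (y ^ ((n : ℤ) - 1) * y ^ (-(k : ℤ)) *
    (Real.exp (-((n : ℝ) + χ) * (V (s * ‖y‖) - Real.log (s * ‖y‖))) : ℂ) /
      (√(radialMass χ V n k) : ℂ)) * h3'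

theorem gasMode_mul_star_smul (χ : ℝ) (V : ℝ → ℝ) (n j k : ℕ) {s : ℝ} (hs : 0 < s) {y : ℂ}
    (hy : y ≠ 0) :
    ((s ^ 2 : ℝ) : ℂ) * (gasMode χ V n j (s • y) * star (gasMode χ V n k (s • y)))
      = ((√((s ^ (2 * (j : ℝ) + 2 * χ) * radialMass χ V n j)⁻¹) *
        √((s ^ (2 * (k : ℝ) + 2 * χ) * radialMass χ V n k)⁻¹) : ℝ) : ℂ) *
        (radialMode (-(j : ℤ)) (scaledProfile χ V n s) y *
          star (radialMode (-(k : ℤ)) (scaledProfile χ V n s) y)) := by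
  have hu : (y / ‖y‖) ^ ((n : ℤ) - 1) * star ((y / ‖y‖) ^ ((n : ℤ) - 1)) = 1 := by
    have hyc : (‖y‖ : ℂ) ≠ 0 := by exact_mod_cast norm_ne_zero_iff.2 hy
    rw [Complex.star_def, Complex.mul_conj, Complex.normSq_eq_norm_sq, norm_zpow, norm_div,
      Complex.norm_real, norm_norm, div_self (norm_ne_zero_iff.2 hy)]
    simp
  have e : ((s ^ 2 : ℝ) : ℂ) * (gasMode χ V n j (s • y) * star (gasMode χ V n k (s • y)))
      = (s * gasMode χ V n j (s • y)) * star (s * gasMode χ V n k (s • y)) := by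
    rw [star_mul', Complex.star_def, Complex.conj_ofReal]
    push_cast
    ring
  rw [e, gasMode_smul χ V n j hs hy, gasMode_smul χ V n k hs hy]
  simp only [star_mul', Complex.ofReal_mul]
  rw [Complex.star_def, Complex.conj_ofReal, ← Complex.star_def]
  linear_combination ((√((s ^ (2 * (j : ℝ) + 2 * χ) * radialMass χ V n j)⁻¹) : ℂ) *
        (√((s ^ (2 * (k : ℝ) + 2 * χ) * radialMass χ V n k)⁻¹) : ℂ)) *
        (radialMode (-(j : ℤ)) (scaledProfile χ V n s) y *
          star (radialMode (-(k : ℤ)) (scaledProfile χ V n s) y)) * hu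

/-- The probability that the `k`-th mode is present in the limit. -/
noncomputable def occupation (χ α γ Lminus Lplus : ℝ) (k : ℕ) : ℝ :=
  limitCoeff χ α γ Lminus Lplus k * limitMass χ α γ k

/-- The deviation from orthonormality of the modes of the limit, with respect to the
weight `h`. -/
noncomputable def limitGram (χ α γ : ℝ) (h : ℂ → ℂ) (j k : ℕ) : ℂ :=
  ∫ z, limitMode χ α γ j z * star (limitMode χ α γ k z) * (h z - 1)

theorem limitMode_eq (χ α γ : ℝ) (k : ℕ) (z : ℂ) :
    limitMode χ α γ k z = radialMode (-(k : ℤ))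
      (fun r => r ^ (-(χ + 1)) * Real.exp (-γ * r ^ (-α))) z * (√(limitMass χ α γ k) : ℂ)⁻¹ := by
  simp only [limitMode, radialMode]
  push_cast
  ring

theorem integrable_indicator_rpow {ε p : ℝ} (hε : 0 < ε) (hp : 2 < p) :
    Integrable fun z : ℂ => (Ioi ε).indicator (fun r : ℝ => r ^ (-p)) ‖z‖ := by
  rw [integrable_comp_norm_complex_iff (f := (Ioi ε).indicator fun r : ℝ => r ^ (-p))]
  have h1 : IntegrableOn (fun r : ℝ => r ^ (-(p - 1))) (Ioi ε) :=
    integrableOn_Ioi_rpow_of_lt (by linarith) hε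
  have h2 : Integrable ((Ioi ε).indicator fun r : ℝ => r ^ (-(p - 1))) :=
    (integrable_indicator_iff measurableSet_Ioi).2 h1
  refine h2.integrableOn.congr_fun (fun r hr => ?_) measurableSet_Ioi
  have hr0 : 0 < r := hr
  by_cases hmem : r ∈ Ioi ε
  · simp only [indicator_of_mem hmem, smul_eq_mul]
    nth_rw 2 [← Real.rpow_one r]
    rw [← Real.rpow_add hr0]
    ring_nf
  · simp [indicator_of_notMem hmem]

theorem integral_gasMode_comp_smul (χ : ℝ) (V : ℝ → ℝ) (n j k : ℕ) {s : ℝ} (hs : 0 < s) (f : ℂ → ℂ) :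
    ∫ x, gasMode χ V n j x * star (gasMode χ V n k x) * (f (s⁻¹ • x) - 1)
      = ((√((s ^ (2 * (j : ℝ) + 2 * χ) * radialMass χ V n j)⁻¹) *
        √((s ^ (2 * (k : ℝ) + 2 * χ) * radialMass χ V n k)⁻¹) : ℝ) : ℂ) *
        ∫ y, radialMode (-(j : ℤ)) (scaledProfile χ V n s) y *
          star (radialMode (-(k : ℤ)) (scaledProfile χ V n s) y) * (f y - 1) := by
  have h1 := Measure.integral_comp_smul (volume : Measure ℂ) (fun x : ℂ =>
    gasMode χ V n j x * star (gasMode χ V n k x) * (f (s⁻¹ • x) - 1)) s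
  rw [Complex.finrank_real_complex, abs_of_pos (by positivity)] at h1
  have h2 : ∫ x, gasMode χ V n j x * star (gasMode χ V n k x) * (f (s⁻¹ • x) - 1)
      = ((s ^ 2 : ℝ) : ℂ) * ∫ y, gasMode χ V n j (s • y) * star (gasMode χ V n k (s • y)) *
        (f (s⁻¹ • s • y) - 1) := by
    rw [h1, ← Complex.real_smul, smul_inv_smul₀ (by positivity)]
  rw [h2, ← integral_const_mul, ← integral_const_mul]
  refine integral_congr_ae ?_
  filter_upwards [compl_mem_ae_iff.2 (measure_singleton (0 : ℂ))] with y hy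
  rw [inv_smul_smul₀ hs.ne', ← mul_assoc, gasMode_mul_star_smul χ V n j k hs hy, mul_assoc]

namespace IsAdmissiblePotential

variable {χ : ℝ} {V : ℝ → ℝ} {α γ Lplus Lminus : ℝ}
  (h : IsAdmissiblePotential χ V α γ Lplus Lminus)

include h

theorem measurable_scaledProfile (n : ℕ) {s : ℝ} (hs : 0 ≤ s) :
    Measurable fun z : ℂ => scaledProfile χ V n s ‖z‖ := by
  have h1 : Measurable fun z : ℂ => V (s * ‖z‖) := by
    have h2 := h.continuous_comp_norm.comp (continuous_const_smul (T := ℂ) s)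
    have e : (fun z : ℂ => V (s * ‖z‖)) = (fun z : ℂ => V ‖z‖) ∘ fun z : ℂ => s • z := by
      ext z
      simp [abs_of_nonneg hs]
    rw [e]
    exact h2.measurable
  unfold scaledProfile
  exact (measurable_norm.pow_const _).mul ((h1.sub
    (Real.measurable_log.comp (measurable_norm.const_mul s))).const_mul _).exp

/-- After rescaling, the prefactors tend to √a_j √a_k and the profiles converge pointwise off 0.
Since f - 1 vanishes for |z| ≤ ε, the integrable bound 2|z|^(-(j+k+2χ+2)) is needed only away from
the origin. -/
theorem tendsto_integral_gasMode (j k : ℕ) {f : ℂ → ℂ} (hf : Measurable f)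
    (hf1 : ∀ z, ‖f z‖ ≤ 1) {ε : ℝ} (hε : 0 < ε) (hfε : ∀ z, ‖z‖ ≤ ε → f z = 1) :
    Tendsto (fun n : ℕ => ∫ x, gasMode χ V n j x * star (gasMode χ V n k x) *
        (f (((n : ℝ) ^ (1 / α))⁻¹ • x) - 1)) atTop
      (𝓝 (((√(occupation χ α γ Lminus Lplus j) * √(occupation χ α γ Lminus Lplus k) : ℝ) : ℂ) *
        limitGram χ α γ f j k)) := by
  have hα := h.alpha_pos
  have hχ := h.chi_pos
  have hγ := h.gamma_pos
  set g : ℝ → ℝ := fun r => r ^ (-(χ + 1)) * Real.exp (-γ * r ^ (-α)) with hg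
  have hlim : ((√(occupation χ α γ Lminus Lplus j) * √(occupation χ α γ Lminus Lplus k) : ℝ) : ℂ) *
        limitGram χ α γ f j k = ((√(limitCoeff χ α γ Lminus Lplus j) *
          √(limitCoeff χ α γ Lminus Lplus k) : ℝ) : ℂ) *
        ∫ y, radialMode (-(j : ℤ)) g y * star (radialMode (-(k : ℤ)) g y) * (f y - 1) := by
    rw [limitGram, ← integral_const_mul, ← integral_const_mul]
    refine integral_congr_ae (ae_of_all _ fun y => ?_)
    have hm : ∀ k, (√(limitMass χ α γ k) : ℂ) ≠ 0 := fun k => by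
      exact_mod_cast (Real.sqrt_pos.2 (limitMass_pos hχ hα hγ k)).ne'
    have hj := hm j
    have hk := hm k
    have e : ∀ k, limitMode χ α γ k y = radialMode (-(k : ℤ)) g y *
        (√(limitMass χ α γ k) : ℂ)⁻¹ := fun k => limitMode_eq χ α γ k y
    simp only [e, occupation]
    rw [Real.sqrt_mul' _ (limitMass_pos hχ hα hγ j).le,
      Real.sqrt_mul' _ (limitMass_pos hχ hα hγ k).le, star_mul', star_inv₀, Complex.star_def,
      Complex.conj_ofReal]
    push_cast
    field_simp
  rw [hlim]
  have hev : ∀ᶠ n : ℕ in atTop, _ := (eventually_gt_atTop 0).mono fun n hn =>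
    (integral_gasMode_comp_smul χ V n j k
      (Real.rpow_pos_of_pos (Nat.cast_pos.2 hn : (0 : ℝ) < n) (1 / α)) f).symm
  refine Tendsto.congr' hev ?_
  refine Tendsto.mul ((Complex.continuous_ofReal.tendsto _).comp
    (((h.tendsto_radialMass j).sqrt).mul (h.tendsto_radialMass k).sqrt)) ?_
  have hp : 2 < (j : ℝ) + k + 2 * χ + 2 := by
    have h1 : (0 : ℝ) ≤ j := j.cast_nonneg
    have h2 : (0 : ℝ) ≤ k := k.cast_nonneg
    linarith
  refine tendsto_integral_filter_of_dominated_convergence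
    (fun z => 2 * (Ioi ε).indicator (fun r : ℝ => r ^ (-((j : ℝ) + k + 2 * χ + 2))) ‖z‖) ?_ ?_
    ((integrable_indicator_rpow hε hp).const_mul 2) ?_
  · refine Eventually.of_forall fun n => Measurable.aestronglyMeasurable ?_
    have h1 := h.measurable_scaledProfile n
      (Real.rpow_nonneg (Nat.cast_nonneg n : (0 : ℝ) ≤ n) (1 / α))
    exact ((measurable_radialMode h1).mul (continuous_star.measurable.comp
      (measurable_radialMode h1))).mul (hf.sub_const 1)
  · filter_upwards [eventually_gt_atTop 0] with n hn
    have hs : 0 < (n : ℝ) ^ (1 / α) := Real.rpow_pos_of_pos (Nat.cast_pos.2 hn) _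
    refine ae_of_all _ fun y => ?_
    by_cases hmem : ‖y‖ ∈ Ioi ε
    swap
    · rw [hfε y (not_lt.1 hmem)]
      simp [indicator_of_notMem hmem]
    have hy0 : 0 < ‖y‖ := hε.trans hmem
    have h1 : ‖f y - 1‖ ≤ 2 := by
      refine (norm_sub_le _ _).trans ?_
      rw [norm_one]
      linarith [hf1 y]
    have h2 : ∀ k : ℕ, ‖radialMode (-(k : ℤ)) (scaledProfile χ V n ((n : ℝ) ^ (1 / α))) y‖
        ≤ ‖y‖ ^ (-((k : ℝ) + χ + 1)) := by
      intro k
      have h3 : scaledProfile χ V n ((n : ℝ) ^ (1 / α)) ‖y‖ ≤ ‖y‖ ^ (-(χ + 1)) := by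
        refine mul_le_of_le_one_right (by positivity) (Real.exp_le_one_iff.2 ?_)
        have h4 := mul_nonneg (show 0 ≤ (n : ℝ) + χ by positivity)
          (sub_nonneg.2 (h.log_le (mul_nonneg hs.le hy0.le)))
        linarith
      have h5 : 0 ≤ scaledProfile χ V n ((n : ℝ) ^ (1 / α)) ‖y‖ :=
        mul_nonneg (by positivity) (Real.exp_nonneg _)
      rw [radialMode, norm_mul, norm_zpow, Complex.norm_real, Real.norm_of_nonneg h5,
        show -((k : ℝ) + χ + 1) = -(k : ℝ) + -(χ + 1) by ring, Real.rpow_add hy0, zpow_neg,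
        zpow_natCast, Real.rpow_neg hy0.le, Real.rpow_natCast]
      exact mul_le_mul_of_nonneg_left h3 (by positivity)
    rw [indicator_of_mem hmem, norm_mul, norm_mul, norm_star,
      show -((j : ℝ) + k + 2 * χ + 2) = -((j : ℝ) + χ + 1) + -((k : ℝ) + χ + 1) by ring,
      Real.rpow_add hy0, mul_comm (2 : ℝ)]
    exact mul_le_mul (mul_le_mul (h2 j) (h2 k) (norm_nonneg _) (by positivity)) h1
      (norm_nonneg _) (by positivity)
  · filter_upwards [compl_mem_ae_iff.2 (measure_singleton (0 : ℂ))] with y hy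
    have hy0 : 0 < ‖y‖ := norm_pos_iff.2 hy
    have h1 : Tendsto (fun n : ℕ => scaledProfile χ V n ((n : ℝ) ^ (1 / α)) ‖y‖) atTop
        (𝓝 (g ‖y‖)) := by
      have h2 := (((h.tendsto_far_exponent hy0).neg).rexp).const_mul (‖y‖ ^ (-(χ + 1)))
      rw [← neg_mul] at h2
      refine h2.congr fun n => ?_
      rw [scaledProfile, neg_mul]
    have h2 : ∀ k : ℕ, Tendsto (fun n : ℕ =>
        radialMode (-(k : ℤ)) (scaledProfile χ V n ((n : ℝ) ^ (1 / α))) y) atTop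
        (𝓝 (radialMode (-(k : ℤ)) g y)) := fun k =>
      ((Complex.continuous_ofReal.tendsto _).comp h1).const_mul _
    exact ((h2 j).mul ((continuous_star.tendsto _).comp (h2 k))).mul_const _

end IsAdmissiblePotential

/-! ### Truncation of the determinant and the limit of multiplicative functionals. -/

namespace IsAdmissiblePotential

variable {χ : ℝ} {V : ℝ → ℝ} {α γ Lplus Lminus : ℝ}
  (h : IsAdmissiblePotential χ V α γ Lplus Lminus)

include h

theorem setIntegral_radialWeight_le (n k : ℕ) {a : ℝ} (ha : 0 < a) :
    ∫ r in Ioi a, radialWeight χ V n k r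
      ≤ a ^ (-(2 * (k : ℝ) + 2 * χ)) / (2 * (k : ℝ) + 2 * χ) := by
  have hχ := h.chi_pos
  have hq : -(2 * (k : ℝ) + 2 * χ + 1) < -1 := by
    have : (0 : ℝ) ≤ k := k.cast_nonneg
    linarith
  calc ∫ r in Ioi a, radialWeight χ V n k r
      ≤ ∫ r in Ioi a, r ^ (-(2 * (k : ℝ) + 2 * χ + 1)) :=
        setIntegral_mono_on (h.integrableOn_radialWeight_Ioi n k ha)
          (integrableOn_Ioi_rpow_of_lt hq ha) measurableSet_Ioi
          fun r hr => h.radialWeight_le n k (ha.trans hr)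
    _ = _ := by
        rw [integral_Ioi_rpow_of_lt hq ha,
          show -(2 * (k : ℝ) + 2 * χ + 1) + 1 = -(2 * (k : ℝ) + 2 * χ) by ring, neg_div_neg_eq]

/-- Only |x| > a contributes, and there |f - 1| ≤ 2, whence the factor 4. -/
theorem integral_norm_sq_mul_gasMode_le {n k : ℕ} (hk : k < n) {f : ℂ → ℂ}
    (hf1 : ∀ z, ‖f z‖ ≤ 1) {a : ℝ} (ha : 0 < a) (hfa : ∀ z, ‖z‖ ≤ a → f z = 1) :
    ∫ x, ‖f x - 1‖ ^ 2 * ‖gasMode χ V n k x‖ ^ 2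
      ≤ 4 * (2 * Real.pi * (∫ r in Ioi a, radialWeight χ V n k r) / radialMass χ V n k) := by
  set g : ℝ → ℝ := fun r => (r ^ ((n : ℤ) - 1 - k) * (Real.exp (-((n : ℝ) + χ) * V r) /
      √(radialMass χ V n k))) ^ 2 with hg
  have hZ := h.radialMass_pos hk
  have e1 : ∀ r ∈ Ioi (0 : ℝ), r * (Ioi a).indicator g r
      = (Ioi a).indicator (fun r => radialWeight χ V n k r * (radialMass χ V n k)⁻¹) r := by
    intro r hr
    by_cases hmem : r ∈ Ioi a
    · rw [indicator_of_mem hmem, indicator_of_mem hmem, hg, gasMode_integrand_eq χ V n k hr,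
        Real.sq_sqrt hZ.le]
    · simp [indicator_of_notMem hmem]
  have hi : Integrable fun x : ℂ => (Ioi a).indicator g ‖x‖ := by
    rw [integrable_comp_norm_complex_iff]
    simp only [smul_eq_mul]
    refine IntegrableOn.congr_fun (Integrable.integrableOn ?_) (fun r hr => (e1 r hr).symm)
      measurableSet_Ioi
    exact (integrable_indicator_iff measurableSet_Ioi).2
      ((h.integrableOn_radialWeight_Ioi n k ha).mul_const _)
  have e2 : ∫ x : ℂ, (Ioi a).indicator g ‖x‖
      = 2 * Real.pi * (∫ r in Ioi a, radialWeight χ V n k r) / radialMass χ V n k := by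
    rw [integral_comp_norm_complex]
    simp only [smul_eq_mul]
    rw [setIntegral_congr_fun measurableSet_Ioi e1, setIntegral_indicator measurableSet_Ioi,
      inter_eq_self_of_subset_right (Ioi_subset_Ioi ha.le), integral_mul_const, ← div_eq_mul_inv,
      mul_div_assoc]
  rw [← e2, ← integral_const_mul]
  refine integral_mono_of_nonneg (ae_of_all _ fun x => by positivity) (hi.const_mul 4)
    (ae_of_all _ fun x => ?_)
  simp only
  by_cases hmem : ‖x‖ ∈ Ioi a
  · rw [indicator_of_mem hmem, gasMode, norm_radialMode_sq]
    have h1 : ‖f x - 1‖ ≤ 2 := by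
      refine (norm_sub_le _ _).trans ?_
      rw [norm_one]
      linarith [hf1 x]
    refine mul_le_mul_of_nonneg_right ?_ (sq_nonneg _)
    nlinarith [norm_nonneg (f x - 1)]
  · rw [hfa x (not_lt.1 hmem)]
    simp [indicator_of_notMem hmem]

/-- The mass beyond a is at most a power a^(-(2k+2χ)) up to constants, and the total mass is at
least c/n. The square root of the ratio is geometric in k, as required for summing column errors. -/
theorem exists_tail_bound : ∃ K > 0, ∀ᶠ n : ℕ in atTop, ∀ k < n, ∀ a > 0, ∀ f : ℂ → ℂ,
    (∀ z, ‖f z‖ ≤ 1) → (∀ z, ‖z‖ ≤ a → f z = 1) →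
    ∫ x, ‖f x - 1‖ ^ 2 * ‖gasMode χ V n k x‖ ^ 2
      ≤ (√(K * n * a ^ (-(2 * χ))) * a⁻¹ ^ k) ^ 2 := by
  have hχ := h.chi_pos
  obtain ⟨c, hc, hc'⟩ := h.exists_le_radialMass
  refine ⟨4 * Real.pi / (χ * c), by positivity, ?_⟩
  filter_upwards [hc', eventually_gt_atTop 0] with n hn hn0 k hk a ha f hf1 hfa
  have hn' : (0 : ℝ) < n := by exact_mod_cast hn0
  refine (h.integral_norm_sq_mul_gasMode_le hk hf1 ha hfa).trans ?_
  have hZ := h.radialMass_pos hk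
  have h1 := h.setIntegral_radialWeight_le n k ha
  have h2 : a ^ (-(2 * (k : ℝ) + 2 * χ)) = a ^ (-(2 * χ)) * (a⁻¹ ^ k) ^ 2 := by
    rw [neg_add, Real.rpow_add ha, mul_comm, ← pow_mul, inv_pow, ← Real.rpow_natCast,
      ← Real.rpow_neg ha.le]
    push_cast
    ring_nf
  rw [mul_pow, Real.sq_sqrt (by positivity)]
  calc 4 * (2 * Real.pi * (∫ r in Ioi a, radialWeight χ V n k r) / radialMass χ V n k)
      ≤ 4 * (2 * Real.pi * (a ^ (-(2 * (k : ℝ) + 2 * χ)) / (2 * χ)) / (c / n)) := by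
        refine mul_le_mul_of_nonneg_left ?_ (by norm_num)
        refine div_le_div₀ (by positivity) (mul_le_mul_of_nonneg_left (h1.trans ?_)
          (by positivity)) (by positivity) (hn k hk)
        have : (0 : ℝ) ≤ k := k.cast_nonneg
        exact div_le_div_of_nonneg_left (by positivity) (by positivity) (by linarith)
    _ = _ := by
        rw [h2]
        field_simp

/-- With a of order n^(1/α), the quantity n a^(-2χ-2T) is of order n^(1-(2χ+2T)/α), and T > α/2 - χ
makes the exponent negative. -/
theorem tendsto_tail (K : ℝ) {ε : ℝ} (hε : 0 < ε) {T : ℕ} (hT : α / 2 - χ < T) :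
    Tendsto (fun n : ℕ => √(K * n * (ε * (n : ℝ) ^ (1 / α)) ^ (-(2 * χ))) *
      ((ε * (n : ℝ) ^ (1 / α))⁻¹ ^ T / (1 - (ε * (n : ℝ) ^ (1 / α))⁻¹))) atTop (𝓝 0) := by
  have hα := h.alpha_pos
  have h1 : Tendsto (fun n : ℕ => ε * (n : ℝ) ^ (1 / α)) atTop atTop :=
    ((tendsto_rpow_atTop (by positivity)).comp tendsto_natCast_atTop_atTop).const_mul_atTop hε
  have h2 : Tendsto (fun n : ℕ => (1 - (ε * (n : ℝ) ^ (1 / α))⁻¹)⁻¹) atTop (𝓝 (1 - 0)⁻¹) :=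
    (tendsto_const_nhds.sub h1.inv_tendsto_atTop).inv₀ (by norm_num)
  have h3 : 0 < (2 * χ + 2 * T) / α - 1 := by
    rw [sub_pos, one_lt_div hα]
    linarith
  have h4 : Tendsto (fun n : ℕ => K * ε ^ (-(2 * χ + 2 * T)) *
      (n : ℝ) ^ (-((2 * χ + 2 * T) / α - 1))) atTop (𝓝 (K * ε ^ (-(2 * χ + 2 * T)) * 0)) :=
    ((tendsto_rpow_neg_atTop h3).comp tendsto_natCast_atTop_atTop).const_mul _
  have h5 := h4.sqrt.mul h2
  rw [mul_zero, Real.sqrt_zero, zero_mul] at h5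
  refine h5.congr' ?_
  filter_upwards [eventually_gt_atTop 0] with n hn
  have hn' : (0 : ℝ) < n := by exact_mod_cast hn
  have ha : 0 < ε * (n : ℝ) ^ (1 / α) := by positivity
  rw [div_eq_mul_inv ((ε * (n : ℝ) ^ (1 / α))⁻¹ ^ T), ← mul_assoc]
  congr 1
  have e1 : (ε * (n : ℝ) ^ (1 / α))⁻¹ ^ T = √((ε * (n : ℝ) ^ (1 / α)) ^ (-(2 * (T : ℝ)))) := by
    rw [Real.sqrt_eq_rpow, ← Real.rpow_mul ha.le, inv_pow, ← Real.rpow_natCast,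
      ← Real.rpow_neg ha.le]
    congr 1
    ring
  rw [e1, ← Real.sqrt_mul' _ (by positivity), mul_assoc (K * n), ← Real.rpow_add ha,
    Real.mul_rpow hε.le (by positivity), ← Real.rpow_mul hn'.le, mul_assoc, mul_assoc]
  congr 2
  have e2 : (n : ℝ) ^ (-((2 * χ + 2 * T) / α - 1))
      = n * (n : ℝ) ^ (1 / α * (-(2 * χ) + -(2 * (T : ℝ)))) := by
    nth_rw 2 [← Real.rpow_one (n : ℝ)]
    rw [← Real.rpow_add hn']
    congr 1
    field_simp
    ring
  rw [e2, ← neg_add]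
  ring

/-- The functional is an n × n determinant. Its columns have norm at most 1 by Bessel and |f| ≤ 1,
and column k ≥ T is close to a basis vector by the tail bound. Hence it may be cut to size T, where
entrywise convergence suffices. -/
theorem tendsto_integral_prod_coulombGas {f : ℂ → ℂ} (hf : Measurable f)
    (hf1 : ∀ z, ‖f z‖ ≤ 1) {ε : ℝ} (hε : 0 < ε) (hfε : ∀ z, ‖z‖ ≤ ε → f z = 1)
    {T : ℕ} (hT : α / 2 - χ < T) :
    Tendsto (fun n : ℕ => ∫ x, ∏ i, f (((n : ℝ) ^ (1 / α))⁻¹ • x i) ∂(coulombGas χ V n)) atTop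
      (𝓝 (Matrix.of fun j k : Fin T => (if j = k then 1 else 0) +
        ((√(occupation χ α γ Lminus Lplus j) * √(occupation χ α γ Lminus Lplus k) : ℝ) : ℂ) *
        limitGram χ α γ f j k).det) := by
  have hα := h.alpha_pos
  have hsmul : ∀ n : ℕ, Measurable fun x : ℂ => f (((n : ℝ) ^ (1 / α))⁻¹ • x) := fun n =>
    hf.comp (measurable_const_smul _)
  set g : ℕ → ℕ → ℕ → ℂ := fun n j k =>
    ∫ x, gasMode χ V n j x * star (gasMode χ V n k x) * f (((n : ℝ) ^ (1 / α))⁻¹ • x) with hg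
  have hdet : ∀ n : ℕ, ∫ x, ∏ i, f (((n : ℝ) ^ (1 / α))⁻¹ • x i) ∂(coulombGas χ V n)
      = (Matrix.of fun j k : Fin n => g n j k).det := fun n => by
    rw [h.coulombGas_eq, (h.isOrthonormalFamily_gasMode n).integral_prod (hsmul n)
      fun x => hf1 _]
  have hsplit : ∀ {n j k : ℕ}, j < n → k < n → g n j k - (if j = k then 1 else 0)
      = ∫ x, gasMode χ V n j x * star (gasMode χ V n k x) *
        (f (((n : ℝ) ^ (1 / α))⁻¹ • x) - 1) := by
    intro n j k hj hk
    have hψ := h.isOrthonormalFamily_gasMode n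
    have h1 := hψ.integral_mul_star ⟨j, hj⟩ ⟨k, hk⟩
    simp only [Fin.mk.injEq] at h1
    rw [← h1, hg, ← integral_sub]
    · simp only [mul_sub, mul_one]
    · exact hψ.integrable_mul_star_mul ⟨j, hj⟩ ⟨k, hk⟩ (hsmul n) fun x => hf1 _
    · exact hψ.integrable_mul_star ⟨j, hj⟩ ⟨k, hk⟩
  have hT' : Tendsto (fun n : ℕ => (Matrix.of fun j k : Fin T => g n j k).det) atTop
      (𝓝 (Matrix.of fun j k : Fin T => (if j = k then 1 else 0) +
        ((√(occupation χ α γ Lminus Lplus j) * √(occupation χ α γ Lminus Lplus k) : ℝ) : ℂ) *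
        limitGram χ α γ f j k).det) := by
    have hc : Continuous fun A : Fin T → Fin T → ℂ => (Matrix.of A).det :=
      Continuous.matrix_det continuous_id
    refine (hc.tendsto _).comp (tendsto_pi_nhds.2 fun j => tendsto_pi_nhds.2 fun k => ?_)
    refine ((h.tendsto_integral_gasMode j k hf hf1 hε hfε).const_add
      (if j = k then 1 else 0)).congr' ?_
    filter_upwards [eventually_ge_atTop T] with n hn
    rw [← hsplit (j.2.trans_le hn) (k.2.trans_le hn)]
    simp [Fin.ext_iff]
  obtain ⟨K, hK, hK'⟩ := h.exists_tail_bound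
  have hdiff : Tendsto (fun n : ℕ => (Matrix.of fun j k : Fin n => g n j k).det -
      (Matrix.of fun j k : Fin T => g n j k).det) atTop (𝓝 0) := by
    refine squeeze_zero_norm' ?_ (h.tendsto_tail K hε hT)
    have h1 : Tendsto (fun n : ℕ => ε * (n : ℝ) ^ (1 / α)) atTop atTop :=
      ((tendsto_rpow_atTop (by positivity)).comp tendsto_natCast_atTop_atTop).const_mul_atTop hε
    filter_upwards [hK', eventually_ge_atTop T, eventually_gt_atTop 0,
      h1.eventually_gt_atTop 1] with n hn hTn hn0 ha1
    have hψ := h.isOrthonormalFamily_gasMode n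
    have hs : 0 < (n : ℝ) ^ (1 / α) := Real.rpow_pos_of_pos (Nat.cast_pos.2 hn0) _
    set s := (n : ℝ) ^ (1 / α) with hs_def
    set a := ε * s
    have ha : 0 < a := by positivity
    have ha' : a⁻¹ < 1 := inv_lt_one_of_one_lt₀ ha1
    set b : ℕ → ℝ := fun k => √(K * n * a ^ (-(2 * χ))) * a⁻¹ ^ k with hb
    have h2 := norm_det_sub_det_le (g n) n T hTn b (fun k => by positivity) ?_ ?_
    · refine h2.trans ?_
      rw [hb, ← Finset.mul_sum]
      exact mul_le_mul_of_nonneg_left (geom_sum_Ico_le_of_lt_one (by positivity) ha')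
        (Real.sqrt_nonneg _)
    · intro k hk
      rw [Finset.sum_range fun i => ‖g n i k‖ ^ 2]
      refine (hψ.sum_norm_sq_integral_le ⟨k, hk⟩ (hsmul n) fun x => hf1 _).trans ?_
      have h3 := hψ.integral_mul_star ⟨k, hk⟩ ⟨k, hk⟩
      rw [if_pos rfl] at h3
      have h4 : ∫ x, ‖gasMode χ V n k x‖ ^ 2 = 1 := by
        have e : ∀ x, gasMode χ V n k x * star (gasMode χ V n k x)
            = ((‖gasMode χ V n k x‖ ^ 2 : ℝ) : ℂ) := fun x => by
          rw [Complex.star_def, Complex.mul_conj, Complex.normSq_eq_norm_sq]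
        simp only [e] at h3
        rw [integral_complex_ofReal] at h3
        exact_mod_cast h3
      rw [← h4]
      refine integral_mono_of_nonneg (ae_of_all _ fun x => by positivity)
        ((hψ.memLp ⟨k, hk⟩).integrable_norm_pow two_ne_zero) (ae_of_all _ fun x => ?_)
      exact mul_le_of_le_one_left (by positivity) (pow_le_one₀ (norm_nonneg _) (hf1 _))
    · intro k hk hTk
      have h3 : ∑ i ∈ Finset.range n, ‖g n i k - if i = k then 1 else 0‖ ^ 2
          = ∑ i : Fin n, ‖∫ x, gasMode χ V n i x * star (gasMode χ V n k x) *
            (f (s⁻¹ • x) - 1)‖ ^ 2 := by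
        rw [Finset.sum_range fun i => ‖g n i k - if i = k then 1 else 0‖ ^ 2]
        exact Finset.sum_congr rfl fun i _ => by rw [hsplit i.2 hk]
      rw [h3]
      refine (hψ.sum_norm_sq_integral_le ⟨k, hk⟩ ((hsmul n).sub_const 1) (C := 2)
        fun x => ?_).trans (hn k hk a ha _ (fun x => hf1 _) fun z hz => hfε _ ?_)
      · refine (norm_sub_le _ _).trans ?_
        rw [norm_one]
        linarith [hf1 (s⁻¹ • x)]
      · rw [norm_smul, norm_inv, Real.norm_of_nonneg hs.le, inv_mul_le_iff₀ hs, mul_comm]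
        exact hz
  have h3 := hdiff.add hT'
  rw [zero_add] at h3
  refine h3.congr fun n => ?_
  rw [hdet]
  ring

end IsAdmissiblePotential

/-! ### The limiting determinant as a mixture. -/

theorem Matrix.det_updateRow_last_single {R : Type*} [CommRing R] {N : ℕ}
    (A : Matrix (Fin (N + 1)) (Fin (N + 1)) R) :
    (A.updateRow (Fin.last N) (Pi.single (Fin.last N) 1)).det
      = (A.submatrix Fin.castSucc Fin.castSucc).det := by
  rw [← Matrix.adjugate_apply, Matrix.adjugate_fin_succ_eq_det_submatrix, Fin.succAbove_last,
    Even.neg_one_pow ⟨_, rfl⟩, one_mul]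

/-- With D the diagonal matrix of c, det(1 + DMD) = det(1 + D²M). As D² differs from the identity
only in its last entry, the last row is the combination, with weights 1-c_N² and c_N², of a basis
vector and the last row of 1+M. -/
theorem det_one_add_mul_mul {N : ℕ} (M : ℕ → ℕ → ℂ) (c : ℕ → ℂ) (hc : ∀ k < N, c k = 1) :
    (Matrix.of fun j k : Fin (N + 1) => (if j = k then 1 else 0) + c j * c k * M j k).det
      = (1 - c N ^ 2) *
          (Matrix.of fun j k : Fin N => (if j = k then 1 else 0) + M j k).det
        + c N ^ 2 *
          (Matrix.of fun j k : Fin (N + 1) => (if j = k then 1 else 0) + M j k).det := by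
  set A : Matrix (Fin (N + 1)) (Fin (N + 1)) ℂ :=
    Matrix.of fun j k : Fin (N + 1) => (if j = k then 1 else 0) + M j k with hA
  set D : Matrix (Fin (N + 1)) (Fin (N + 1)) ℂ := Matrix.diagonal fun j => c j
  set B : Matrix (Fin (N + 1)) (Fin (N + 1)) ℂ := Matrix.of fun j k => M j k
  have e1 : (Matrix.of fun j k : Fin (N + 1) => (if j = k then 1 else 0) + c j * c k * M j k)
      = 1 + (D * B) * D := by
    ext j k
    simp only [Matrix.of_apply, Matrix.add_apply, Matrix.one_apply, Matrix.mul_diagonal,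
      Matrix.diagonal_mul, D, B]
    ring
  have e2 : 1 + D * (D * B) = A.updateRow (Fin.last N)
      ((1 - c N ^ 2) • Pi.single (Fin.last N) 1 + c N ^ 2 • A (Fin.last N)) := by
    ext j k
    simp only [Matrix.add_apply, Matrix.one_apply, Matrix.diagonal_mul, D, B, Matrix.of_apply]
    refine Fin.lastCases ?_ (fun j => ?_) j
    · simp only [Matrix.updateRow_self, Pi.add_apply, Pi.smul_apply, smul_eq_mul, hA,
        Matrix.of_apply, Fin.val_last, Pi.single_apply, eq_comm (a := k)]
      split_ifs <;> ring
    · rw [Matrix.updateRow_ne (Fin.castSucc_lt_last j).ne, hA, Matrix.of_apply, Fin.val_castSucc,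
        hc j j.2]
      ring
  have e3 : A.submatrix Fin.castSucc Fin.castSucc
      = Matrix.of fun j k : Fin N => (if j = k then 1 else 0) + M j k := by
    ext j k
    simp [hA]
  rw [e1, Matrix.det_one_add_mul_comm, e2, Matrix.det_updateRow_add, Matrix.det_updateRow_smul,
    Matrix.det_updateRow_smul, Matrix.det_updateRow_last_single, e3, Matrix.updateRow_eq_self]

/-- The number of modes `k` with `2 k + 2 χ < α`; these are present in the limiting process with
probability one. -/
noncomputable def particleNumber (χ α : ℝ) : ℕ := ⌈α / 2 - χ⌉₊

theorem two_mul_add_lt_of_lt_particleNumber {χ α : ℝ} {k : ℕ} (hk : k < particleNumber χ α) :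
    2 * (k : ℝ) + 2 * χ < α := by
  have := Nat.lt_ceil.1 hk
  linarith

theorem le_of_particleNumber_le {χ α : ℝ} {k : ℕ} (hk : particleNumber χ α ≤ k) :
    α ≤ 2 * (k : ℝ) + 2 * χ := by
  have := Nat.ceil_le.1 hk
  linarith

theorem limitCoeff_of_gt {χ α γ Lminus Lplus : ℝ} {k : ℕ} (hk : α < 2 * (k : ℝ) + 2 * χ) :
    limitCoeff χ α γ Lminus Lplus k = 0 := by
  rw [limitCoeff, if_neg (by linarith), if_neg (by linarith)]

namespace IsAdmissiblePotential

variable {χ : ℝ} {V : ℝ → ℝ} {α γ Lplus Lminus : ℝ}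
  (h : IsAdmissiblePotential χ V α γ Lplus Lminus)

include h

theorem occupation_of_lt {k : ℕ} (hk : 2 * (k : ℝ) + 2 * χ < α) :
    occupation χ α γ Lminus Lplus k = 1 := by
  rw [occupation, limitCoeff, if_pos hk, ← limitMass_eq, inv_mul_cancel₀
    (limitMass_pos h.chi_pos h.alpha_pos h.gamma_pos k).ne']

/-- In the critical case 1/a_k is the far mass π/(αγ) plus the circle mass π(1/L₊ + 1/L₋); the
complement of the far fraction is the circle fraction. -/
theorem one_sub_occupation_of_eq {k : ℕ} (hk : 2 * (k : ℝ) + 2 * χ = α) :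
    1 - occupation χ α γ Lminus Lplus k
      = Real.pi * (1 / Lplus + 1 / Lminus) * limitCoeff χ α γ Lminus Lplus k := by
  have hL := h.Lplus_pos
  have hL' := h.one_le_Lminus
  have hα := h.alpha_pos
  have hγ := h.gamma_pos
  have h1 : 1 / (α * γ) + 1 / Lplus + 1 / Lminus ≠ 0 := by positivity
  have hpi := Real.pi_ne_zero
  rw [occupation, limitMass_of_eq h.alpha_pos h.gamma_pos hk, limitCoeff, if_neg (by linarith),
    if_pos hk, mul_inv]
  have h2 : Real.pi⁻¹ * (1 / (α * γ) + 1 / Lplus + 1 / Lminus)⁻¹ * (Real.pi / (α * γ))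
      = (1 / (α * γ) + 1 / Lplus + 1 / Lminus)⁻¹ * (1 / (α * γ)) := by
    field_simp
  have h3 : Real.pi * (1 / Lplus + 1 / Lminus) *
      (Real.pi⁻¹ * (1 / (α * γ) + 1 / Lplus + 1 / Lminus)⁻¹)
      = (1 / (α * γ) + 1 / Lplus + 1 / Lminus)⁻¹ * (1 / Lplus + 1 / Lminus) := by
    field_simp
  rw [h2, h3, sub_eq_iff_eq_add, ← mul_add, add_comm (1 / Lplus + 1 / Lminus), ← add_assoc,
    inv_mul_cancel₀ h1]

theorem limitCoeff_nonneg (k : ℕ) : 0 ≤ limitCoeff χ α γ Lminus Lplus k := by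
  have hL := h.Lplus_pos
  have hL' := h.one_le_Lminus
  have hα := h.alpha_pos
  have hγ := h.gamma_pos
  rw [limitCoeff]
  split_ifs with h1 h2
  · rw [← limitMass_eq]
    exact inv_nonneg.2 (limitMass_pos h.chi_pos hα hγ k).le
  · positivity
  · exact le_rfl

theorem occupation_nonneg (k : ℕ) : 0 ≤ occupation χ α γ Lminus Lplus k :=
  mul_nonneg (h.limitCoeff_nonneg k) (limitMass_pos h.chi_pos h.alpha_pos h.gamma_pos k).le

theorem occupation_le_one (k : ℕ) : occupation χ α γ Lminus Lplus k ≤ 1 := by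
  have hL := h.Lplus_pos
  have hL' := h.one_le_Lminus
  rcases lt_trichotomy (2 * (k : ℝ) + 2 * χ) α with hk | hk | hk
  · exact (h.occupation_of_lt hk).le
  · have h1 := h.one_sub_occupation_of_eq hk
    have h2 : 0 ≤ Real.pi * (1 / Lplus + 1 / Lminus) * limitCoeff χ α γ Lminus Lplus k :=
      mul_nonneg (by positivity) (h.limitCoeff_nonneg k)
    linarith
  · rw [occupation, limitCoeff_of_gt hk, zero_mul]
    exact zero_le_one

/-- The series stops at index N = `particleNumber`, as a_k = 0 beyond it. Since a_k times
`limitMass` is 1 for k < N, those terms form a projection kernel and only the last one is damped. -/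
theorem limitKernel_eq (z w : PuncturedPlane) :
    limitKernel χ α γ Lminus Lplus z w
      = projectionKernel (fun k : Fin (particleNumber χ α) => limitMode χ α γ k) (z : ℂ) w
        + occupation χ α γ Lminus Lplus (particleNumber χ α) *
          (limitMode χ α γ (particleNumber χ α) z *
            star (limitMode χ α γ (particleNumber χ α) w)) := by
  set N := particleNumber χ α
  have hz : 0 < ‖(z : ℂ)‖ := norm_pos_iff.2 z.2
  have hw : 0 < ‖(w : ℂ)‖ := norm_pos_iff.2 w.2
  have hterm : ∀ k : ℕ, ((1 / ‖(z : ℂ) * star (w : ℂ)‖ ^ (χ + 1) : ℝ) : ℂ) *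
      ((limitCoeff χ α γ Lminus Lplus k : ℂ) / ((z : ℂ) * star (w : ℂ)) ^ k) *
      (Real.exp (-γ / ‖(z : ℂ)‖ ^ α) : ℂ) * (Real.exp (-γ / ‖(w : ℂ)‖ ^ α) : ℂ)
      = occupation χ α γ Lminus Lplus k *
        (limitMode χ α γ k z * star (limitMode χ α γ k w)) := by
    intro k
    have hm := limitMass_pos h.chi_pos h.alpha_pos h.gamma_pos k
    have hm' : (√(limitMass χ α γ k) : ℂ) ≠ 0 := by exact_mod_cast (Real.sqrt_pos.2 hm).ne'
    have hm2 : (limitMass χ α γ k : ℂ) = (√(limitMass χ α γ k) : ℂ) ^ 2 := by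
      exact_mod_cast (Real.sq_sqrt hm.le).symm
    have e1 : 1 / ‖(z : ℂ) * star (w : ℂ)‖ ^ (χ + 1)
        = ‖(z : ℂ)‖ ^ (-(χ + 1)) * ‖(w : ℂ)‖ ^ (-(χ + 1)) := by
      rw [norm_mul, norm_star, Real.mul_rpow hz.le hw.le, Real.rpow_neg hz.le,
        Real.rpow_neg hw.le, one_div, mul_inv]
    have e2 : -γ / ‖(z : ℂ)‖ ^ α = -γ * ‖(z : ℂ)‖ ^ (-α) := by
      rw [Real.rpow_neg hz.le, div_eq_mul_inv]
    have e3 : -γ / ‖(w : ℂ)‖ ^ α = -γ * ‖(w : ℂ)‖ ^ (-α) := by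
      rw [Real.rpow_neg hw.le, div_eq_mul_inv]
    rw [e1, e2, e3]
    simp only [occupation, limitMode, radialMode, star_mul', Complex.star_def, Complex.conj_ofReal,
      zpow_neg, zpow_natCast, map_inv₀, map_pow, map_mul, map_div₀, Complex.ofReal_mul, Complex.ofReal_div, hm2,
      mul_pow]
    have hz' : (z : ℂ) ≠ 0 := z.2
    have hw' : (starRingEnd ℂ) (w : ℂ) ≠ 0 := (map_ne_zero _).2 w.2
    field_simp
  have hsum : ∑' k : ℕ, (limitCoeff χ α γ Lminus Lplus k : ℂ) / ((z : ℂ) * star (w : ℂ)) ^ k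
      = ∑ k ∈ Finset.range (N + 1),
        (limitCoeff χ α γ Lminus Lplus k : ℂ) / ((z : ℂ) * star (w : ℂ)) ^ k := by
    refine tsum_eq_sum fun k hk => ?_
    have h1 : N + 1 ≤ k := not_lt.1 fun h => hk (Finset.mem_range.2 h)
    have h2 : α ≤ 2 * (N : ℝ) + 2 * χ := le_of_particleNumber_le le_rfl
    have h3 : (N : ℝ) + 1 ≤ k := by exact_mod_cast h1
    rw [limitCoeff_of_gt (by linarith), Complex.ofReal_zero, zero_div]
  rw [limitKernel, hsum, Finset.mul_sum, Finset.sum_mul, Finset.sum_mul,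
    Finset.sum_congr rfl fun k _ => hterm k, Finset.sum_range_succ, Finset.sum_range,
    projectionKernel]
  congr 1
  refine Finset.sum_congr rfl fun k _ => ?_
  rw [h.occupation_of_lt (two_mul_add_lt_of_lt_particleNumber k.2), Complex.ofReal_one, one_mul]

/-- The mixture is a determinantal process with the limiting kernel. -/
theorem isDeterminantal_mixedLaw_limitMode :
    IsDeterminantal (mixedLaw (limitMode χ α γ) (particleNumber χ α)
      (occupation χ α γ Lminus Lplus (particleNumber χ α)))
      lebesguePunctured (limitKernel χ α γ Lminus Lplus) :=
  isDeterminantal_mixedLaw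
    (isOrthonormalFamily_limitMode h.chi_pos h.alpha_pos h.gamma_pos _)
    (isOrthonormalFamily_limitMode h.chi_pos h.alpha_pos h.gamma_pos _)
    (h.occupation_nonneg _) (h.occupation_le_one _) h.limitKernel_eq

/-- Andréief's identity read backwards: orthonormality restores the identity matrix subtracted in
`limitGram`. -/
theorem det_limitGram (n : ℕ) {f : ℂ → ℂ} (hf : Measurable f) (hf1 : ∀ z, ‖f z‖ ≤ 1) :
    (Matrix.of fun j k : Fin n => (if j = k then 1 else 0) + limitGram χ α γ f j k).det
      = ∫ x, ∏ i, f (x i) ∂(projectionEnsemble volume fun k : Fin n => limitMode χ α γ k) := by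
  have hψ := isOrthonormalFamily_limitMode h.chi_pos h.alpha_pos h.gamma_pos n
  rw [hψ.integral_prod hf hf1]
  congr 2
  ext j k
  rw [← hψ.integral_mul_star, limitGram, ← integral_add (hψ.integrable_mul_star j k)]
  · refine integral_congr_ae (ae_of_all _ fun x => ?_)
    ring
  · refine hψ.integrable_mul_star_mul j k (hf.sub_const 1) (C := 2) fun x => ?_
    refine (norm_sub_le _ _).trans ?_
    rw [norm_one]
    linarith [hf1 x]

/-- Truncation at T = N+1 keeps the only mode whose occupation may lie strictly between 0 and 1; the
affine formula then separates N from N+1 particles. -/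
theorem tendsto_integral_prod_coulombGas_mixture {f : ℂ → ℂ} (hf : Measurable f)
    (hf1 : ∀ z, ‖f z‖ ≤ 1) {ε : ℝ} (hε : 0 < ε) (hfε : ∀ z, ‖z‖ ≤ ε → f z = 1) :
    Tendsto (fun n : ℕ => ∫ x, ∏ i, f (((n : ℝ) ^ (1 / α))⁻¹ • x i) ∂(coulombGas χ V n)) atTop
      (𝓝 ((1 - occupation χ α γ Lminus Lplus (particleNumber χ α) : ℝ) *
        ∫ x, ∏ i, f (x i) ∂(projectionEnsemble volume
          fun k : Fin (particleNumber χ α) => limitMode χ α γ k) +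
        (occupation χ α γ Lminus Lplus (particleNumber χ α) : ℝ) *
        ∫ x, ∏ i, f (x i) ∂(projectionEnsemble volume
          fun k : Fin (particleNumber χ α + 1) => limitMode χ α γ k))) := by
  have hT : α / 2 - χ < (particleNumber χ α + 1 : ℕ) := by
    have h1 : α ≤ 2 * (particleNumber χ α : ℝ) + 2 * χ := le_of_particleNumber_le le_rfl
    push_cast
    linarith
  have h1 := h.tendsto_integral_prod_coulombGas hf hf1 hε hfε hT
  simp only [Complex.ofReal_mul] at h1
  rw [det_one_add_mul_mul (limitGram χ α γ f)
    (fun k => (√(occupation χ α γ Lminus Lplus k) : ℂ)) (fun k hk => by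
      rw [h.occupation_of_lt (two_mul_add_lt_of_lt_particleNumber hk)]
      simp), h.det_limitGram _ hf hf1, h.det_limitGram _ hf hf1] at h1
  have e : (√(occupation χ α γ Lminus Lplus (particleNumber χ α)) : ℂ) ^ 2
      = (occupation χ α γ Lminus Lplus (particleNumber χ α) : ℝ) := by
    exact_mod_cast Real.sq_sqrt (h.occupation_nonneg _)
  rw [e] at h1
  push_cast
  exact h1

end IsAdmissiblePotential

/-! ### Maximal moduli -/

theorem maxModulus_nonneg {n : ℕ} (x : Fin n → ℂ) : 0 ≤ maxModulus x :=
  Real.iSup_nonneg fun _ => norm_nonneg _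

theorem norm_le_maxModulus {n : ℕ} (x : Fin n → ℂ) (k : Fin n) : ‖x k‖ ≤ maxModulus x :=
  le_ciSup (f := fun k => ‖x k‖) (finite_range _).bddAbove k

theorem maxModulus_le_iff {n : ℕ} (x : Fin n → ℂ) {t : ℝ} (ht : 0 ≤ t) :
    maxModulus x ≤ t ↔ ∀ k, ‖x k‖ ≤ t :=
  ⟨fun h k => (norm_le_maxModulus x k).trans h, fun h => Real.iSup_le h ht⟩

theorem measurable_maxModulus (n : ℕ) : Measurable (maxModulus : (Fin n → ℂ) → ℝ) :=
  Measurable.iSup fun k => (measurable_pi_apply k).norm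

theorem maxModulus_smul {n : ℕ} (x : Fin n → ℂ) {s : ℝ} (hs : 0 ≤ s) :
    maxModulus (fun k => s • x k) = s * maxModulus x := by
  simp only [maxModulus, norm_smul, Real.norm_of_nonneg hs, Real.mul_iSup_of_nonneg hs]

theorem integral_prod_indicator_closedBall {n : ℕ} (P : Measure (Fin n → ℂ)) {t : ℝ}
    (ht : 0 ≤ t) :
    ∫ x, ∏ i, (Metric.closedBall (0 : ℂ) t).indicator (1 : ℂ → ℂ) (x i) ∂P
      = (P.real {x | maxModulus x ≤ t} : ℂ) := by
  have e : (fun x : Fin n → ℂ => ∏ i, (Metric.closedBall (0 : ℂ) t).indicator (1 : ℂ → ℂ) (x i))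
      = {x : Fin n → ℂ | maxModulus x ≤ t}.indicator 1 := by
    ext x
    by_cases hx : maxModulus x ≤ t
    · rw [indicator_of_mem (show x ∈ {x : Fin n → ℂ | maxModulus x ≤ t} from hx)]
      refine Finset.prod_eq_one fun i _ => ?_
      rw [indicator_of_mem (by simpa using (maxModulus_le_iff x ht).1 hx i)]
      rfl
    · rw [indicator_of_notMem (show x ∉ {x : Fin n → ℂ | maxModulus x ≤ t} from hx)]
      rw [maxModulus_le_iff x ht, not_forall] at hx
      obtain ⟨i, hi⟩ := hx
      refine Finset.prod_eq_zero (Finset.mem_univ i) (indicator_of_notMem ?_ _)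
      simpa using hi
  have hm : MeasurableSet {x : Fin n → ℂ | maxModulus x ≤ t} :=
    measurableSet_le (measurable_maxModulus n) measurable_const
  rw [e, integral_indicator hm]
  simp

theorem count_univ_pointConfiguration {n : ℕ} {x : Fin n → ℂ} (hx : ∀ k, x k ≠ 0) :
    (pointConfiguration x).count univ = (n : ℝ≥0∞) := by
  rw [count_pointConfiguration x MeasurableSet.univ]
  simp [hx]

theorem count_pointConfiguration_eq_zero_iff {n : ℕ} {x : Fin n → ℂ} (hx : ∀ k, x k ≠ 0)
    {B : Set ℂ} (hB : MeasurableSet B) :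
    (pointConfiguration x).count (Subtype.val ⁻¹' B) = 0 ↔ ∀ k, x k ∉ B := by
  rw [count_pointConfiguration x (measurable_subtype_coe hB), Finset.sum_eq_zero_iff]
  simp [hx]

theorem maxModulus_pointConfiguration {n : ℕ} {x : Fin n → ℂ} (hx : ∀ k, x k ≠ 0) :
    (pointConfiguration x).maxModulus = maxModulus x := by
  have e : ∀ z : PuncturedPlane, ({z} : Set PuncturedPlane) = Subtype.val ⁻¹' {(z : ℂ)} := by
    intro z
    ext w
    simp [Subtype.ext_iff]
  rw [Configuration.maxModulus, maxModulus, iSup]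
  congr 1
  ext r
  simp only [e, ne_eq, count_pointConfiguration_eq_zero_iff hx (measurableSet_singleton _),
    not_forall, not_not, mem_singleton_iff, mem_range, mem_ofPred_eq]
  constructor
  · rintro ⟨z, ⟨k, hk⟩, rfl⟩
    exact ⟨k, by rw [hk]⟩
  · rintro ⟨k, rfl⟩
    exact ⟨⟨x k, hx k⟩, ⟨k, rfl⟩, rfl⟩

/-- A measurable version of the maximal modulus of a configuration. -/
noncomputable def Configuration.ratMaxModulus (ξ : Configuration PuncturedPlane) : ℝ :=
  open Classical in
  ⨆ q : ℚ, if ξ.count (Subtype.val ⁻¹' {z : ℂ | (q : ℝ) < ‖z‖}) = 0 then 0 else (q : ℝ)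

theorem Configuration.measurable_ratMaxModulus : Measurable Configuration.ratMaxModulus := by
  refine Measurable.iSup fun q => Measurable.ite ?_ measurable_const measurable_const
  exact Configuration.measurable_count (measurable_subtype_coe
    (measurableSet_lt measurable_const measurable_norm)) (measurableSet_singleton 0)

theorem ratMaxModulus_pointConfiguration {n : ℕ} {x : Fin n → ℂ} (hx : ∀ k, x k ≠ 0) :
    (pointConfiguration x).ratMaxModulus = maxModulus x := by
  classical
  have e : ∀ q : ℚ, (pointConfiguration x).count (Subtype.val ⁻¹' {z : ℂ | (q : ℝ) < ‖z‖}) = 0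
      ↔ ∀ k, ‖x k‖ ≤ q := by
    intro q
    rw [count_pointConfiguration_eq_zero_iff hx (measurableSet_lt measurable_const measurable_norm)]
    simp
  have hle : ∀ q : ℚ, (if (pointConfiguration x).count
      (Subtype.val ⁻¹' {z : ℂ | (q : ℝ) < ‖z‖}) = 0 then 0 else (q : ℝ)) ≤ maxModulus x := by
    intro q
    split_ifs with hq
    · exact maxModulus_nonneg x
    · rw [e, not_forall] at hq
      obtain ⟨k, hk⟩ := hq
      exact (not_le.1 hk).le.trans (norm_le_maxModulus x k)
  have hbdd : BddAbove (range fun q : ℚ => if (pointConfiguration x).count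
      (Subtype.val ⁻¹' {z : ℂ | (q : ℝ) < ‖z‖}) = 0 then 0 else (q : ℝ)) :=
    ⟨maxModulus x, by rintro _ ⟨q, rfl⟩; exact hle q⟩
  refine le_antisymm (ciSup_le hle) (le_of_forall_lt fun c hc => ?_)
  -- Any rational q between c and the maximum sees a point beyond it, unless q < 0, when the default
  -- value 0 already exceeds c.
  obtain ⟨q, hcq, hq⟩ := exists_rat_btwn hc
  refine lt_of_lt_of_le ?_ (le_ciSup hbdd q)
  by_cases h0 : (pointConfiguration x).count (Subtype.val ⁻¹' {z : ℂ | (q : ℝ) < ‖z‖}) = 0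
  · simp only [if_pos h0]
    rcases le_or_gt 0 (q : ℝ) with hq0 | hq0
    · exact absurd ((maxModulus_le_iff x hq0).2 ((e q).1 h0)) (not_le.2 hq)
    · exact hcq.trans hq0
  · simpa only [if_neg h0] using hcq

theorem exists_eq_pointConfiguration {ξ : Configuration PuncturedPlane}
    (hs : ∀ z, ξ.count {z} ≤ 1) {M : ℕ} (hξ : ξ.count univ ≤ (M : ℝ≥0∞)) :
    ∃ (m : ℕ) (x : Fin m → ℂ), (∀ k, x k ≠ 0) ∧ ξ = pointConfiguration x := by
  classical
  obtain ⟨T, -, hT⟩ := Configuration.exists_finset_of_count_univ_le hs hξ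
  refine ⟨T.card, fun k => (T.equivFin.symm k : PuncturedPlane), fun k =>
    (T.equivFin.symm k : PuncturedPlane).2, Subtype.ext ?_⟩
  rw [hT, pointConfiguration, ← Finset.sum_coe_sort]
  refine Fintype.sum_equiv T.equivFin _ _ fun z => ?_
  rw [dif_pos (T.equivFin.symm (T.equivFin z) : PuncturedPlane).2]
  simp

/-! ### Mixtures of projection processes -/

theorem ae_ne_zero_projectionEnsemble {n : ℕ} {ψ : Fin n → ℂ → ℂ} :
    ∀ᵐ x ∂(projectionEnsemble volume ψ), ∀ k, x k ≠ 0 :=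
  (withDensity_absolutelyContinuous _ _).ae_le
    (ae_all_iff.2 fun k => Measure.ae_eval_ne (fun _ : Fin n => (volume : Measure ℂ)) k 0)

section MixedLaw

variable {φ : ℕ → ℂ → ℂ} {N : ℕ} {p : ℝ}

theorem isProbabilityMeasure_mixedLaw
    (hφ : IsOrthonormalFamily volume fun k : Fin N => φ k)
    (hφ' : IsOrthonormalFamily volume fun k : Fin (N + 1) => φ k) (hp0 : 0 ≤ p) (hp1 : p ≤ 1) :
    IsProbabilityMeasure (mixedLaw φ N p) := by
  have h1 := hφ.isProbabilityMeasure
  have h2 := hφ'.isProbabilityMeasure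
  refine ⟨?_⟩
  rw [mixedLaw, Measure.add_apply, Measure.smul_apply, Measure.smul_apply,
    Measure.map_apply (measurable_pointConfiguration _) MeasurableSet.univ,
    Measure.map_apply (measurable_pointConfiguration _) MeasurableSet.univ, preimage_univ,
    preimage_univ, measure_univ, measure_univ, smul_eq_mul, smul_eq_mul, mul_one, mul_one,
    ← ENNReal.ofReal_add (sub_nonneg.2 hp1) hp0, sub_add_cancel, ENNReal.ofReal_one]

theorem ae_mixedLaw_of_forall {q : Configuration PuncturedPlane → Prop}
    (hN : ∀ x : Fin N → ℂ, (∀ k, x k ≠ 0) → q (pointConfiguration x))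
    (hN' : ∀ x : Fin (N + 1) → ℂ, (∀ k, x k ≠ 0) → q (pointConfiguration x))
    (hq : MeasurableSet {ξ | q ξ}) : ∀ᵐ ξ ∂(mixedLaw φ N p), q ξ := by
  rw [mixedLaw, ae_add_measure_iff]
  refine ⟨Measure.ae_smul_measure ?_ _, Measure.ae_smul_measure ?_ _⟩ <;>
    rw [ae_map_iff (measurable_pointConfiguration _).aemeasurable hq]
  · exact ae_ne_zero_projectionEnsemble.mono hN
  · exact ae_ne_zero_projectionEnsemble.mono hN'

theorem integral_mixedLaw (hφ : IsOrthonormalFamily volume fun k : Fin N => φ k)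
    (hφ' : IsOrthonormalFamily volume fun k : Fin (N + 1) => φ k) (hp0 : 0 ≤ p) (hp1 : p ≤ 1)
    {G : Configuration PuncturedPlane → ℂ} (hG : Measurable G) {C : ℝ} (hC : ∀ ξ, ‖G ξ‖ ≤ C) :
    ∫ ξ, G ξ ∂(mixedLaw φ N p)
      = (1 - p : ℝ) * ∫ x, G (pointConfiguration x) ∂(projectionEnsemble volume
          fun k : Fin N => φ k)
        + (p : ℝ) * ∫ x, G (pointConfiguration x) ∂(projectionEnsemble volume
          fun k : Fin (N + 1) => φ k) := by
  have h1 := hφ.isProbabilityMeasure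
  have h2 := hφ'.isProbabilityMeasure
  have h1' := Measure.isProbabilityMeasure_map (μ := projectionEnsemble volume
    fun k : Fin N => φ k) (measurable_pointConfiguration N).aemeasurable
  have h2' := Measure.isProbabilityMeasure_map (μ := projectionEnsemble volume
    fun k : Fin (N + 1) => φ k) (measurable_pointConfiguration (N + 1)).aemeasurable
  rw [mixedLaw, integral_add_measure, integral_smul_measure, integral_smul_measure,
    integral_map (measurable_pointConfiguration _).aemeasurable hG.aestronglyMeasurable,
    integral_map (measurable_pointConfiguration _).aemeasurable hG.aestronglyMeasurable,
    ENNReal.toReal_ofReal (sub_nonneg.2 hp1), ENNReal.toReal_ofReal hp0, Complex.real_smul,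
    Complex.real_smul]
  · exact (Integrable.of_bound hG.aestronglyMeasurable C (ae_of_all _ hC)).smul_measure
      ENNReal.ofReal_ne_top
  · exact (Integrable.of_bound hG.aestronglyMeasurable C (ae_of_all _ hC)).smul_measure
      ENNReal.ofReal_ne_top

/-- The projection ensembles almost surely have no point at 0, so passing to the punctured plane
loses no particle and the counts are exactly N and N+1. -/
theorem mixedLaw_count_univ (hφ : IsOrthonormalFamily volume fun k : Fin N => φ k)
    (hφ' : IsOrthonormalFamily volume fun k : Fin (N + 1) => φ k) :
    mixedLaw φ N p {ξ | ξ.count univ = (N : ℝ≥0∞)} = ENNReal.ofReal (1 - p) ∧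
      mixedLaw φ N p {ξ | ξ.count univ = ((N + 1 : ℕ) : ℝ≥0∞)} = ENNReal.ofReal p := by
  have h1 := hφ.isProbabilityMeasure
  have h2 := hφ'.isProbabilityMeasure
  have hm : ∀ m : ℕ, MeasurableSet {ξ : Configuration PuncturedPlane | ξ.count univ = (m : ℝ≥0∞)} :=
    fun m => Configuration.measurable_count MeasurableSet.univ (measurableSet_singleton _)
  have key : ∀ {n : ℕ} {ψ : Fin n → ℂ → ℂ}, IsOrthonormalFamily volume ψ → ∀ m : ℕ,
      (projectionEnsemble volume ψ).map pointConfiguration {ξ | ξ.count univ = (m : ℝ≥0∞)}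
        = if n = m then 1 else 0 := by
    intro n ψ hψ m
    have := hψ.isProbabilityMeasure
    rw [Measure.map_apply (measurable_pointConfiguration n) (hm m)]
    have hae := ae_ne_zero_projectionEnsemble (ψ := ψ)
    split_ifs with hnm
    · refine (ae_iff_prob_eq_one ?_).1 (hae.mono fun x hx => ?_)
      · exact measurable_mem.2 (measurable_pointConfiguration n (hm m))
      · exact (count_univ_pointConfiguration hx).trans (by rw [hnm])
    · refine measure_eq_zero_iff_ae_notMem.2 (hae.mono fun x hx hmem => hnm ?_)
      have h3 := (count_univ_pointConfiguration hx).symm.trans hmem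
      exact_mod_cast h3
  simp only [mixedLaw, Measure.add_apply, Measure.smul_apply, key hφ, key hφ']
  simp

theorem ae_count_univ_le_mixedLaw :
    ∀ᵐ ξ ∂(mixedLaw φ N p), ξ.count univ ≤ ((N + 1 : ℕ) : ℝ≥0∞) := by
  refine ae_mixedLaw_of_forall (fun x hx => ?_) (fun x hx => ?_)
    (measurableSet_le (Configuration.measurable_count MeasurableSet.univ) measurable_const)
  · rw [count_univ_pointConfiguration hx]
    exact_mod_cast N.le_succ
  · rw [count_univ_pointConfiguration hx]

/-- `Configuration.maxModulus` is a supremum over uncountably many candidate points, so its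
measurability is not evident. On simple configurations with boundedly many points it agrees with a
countable supremum. -/
theorem maxModulus_ae_eq_ratMaxModulus {F : Measure (Configuration PuncturedPlane)}
    (hs : ∀ᵐ ξ ∂F, ∀ z, ξ.count {z} ≤ 1) {M : ℕ} (hM : ∀ᵐ ξ ∂F, ξ.count univ ≤ (M : ℝ≥0∞)) :
    Configuration.maxModulus =ᵐ[F] Configuration.ratMaxModulus := by
  filter_upwards [hs, hM] with ξ hξ hξM
  obtain ⟨m, x, hx, rfl⟩ := exists_eq_pointConfiguration hξ hξM
  rw [maxModulus_pointConfiguration hx, ratMaxModulus_pointConfiguration hx]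

theorem measureReal_maxModulus_mixedLaw
    (hφ : IsOrthonormalFamily volume fun k : Fin N => φ k)
    (hφ' : IsOrthonormalFamily volume fun k : Fin (N + 1) => φ k) (hp0 : 0 ≤ p) (hp1 : p ≤ 1)
    (t : ℝ) :
    (mixedLaw φ N p).real {ξ | ξ.ratMaxModulus ≤ t}
      = (1 - p) * (projectionEnsemble volume fun k : Fin N => φ k).real {x | maxModulus x ≤ t}
        + p * (projectionEnsemble volume fun k : Fin (N + 1) => φ k).real
          {x | maxModulus x ≤ t} := by
  have h1 := hφ.isProbabilityMeasure
  have h2 := hφ'.isProbabilityMeasure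
  have hm : MeasurableSet {ξ : Configuration PuncturedPlane | ξ.ratMaxModulus ≤ t} :=
    measurableSet_le Configuration.measurable_ratMaxModulus measurable_const
  have key : ∀ {n : ℕ} {ψ : Fin n → ℂ → ℂ},
      (projectionEnsemble volume ψ).map pointConfiguration {ξ | ξ.ratMaxModulus ≤ t}
        = projectionEnsemble volume ψ {x | maxModulus x ≤ t} := by
    intro n ψ
    rw [Measure.map_apply (measurable_pointConfiguration n) hm]
    refine measure_congr ?_
    filter_upwards [ae_ne_zero_projectionEnsemble (ψ := ψ)] with x hx
    exact congrArg (· ≤ t) (ratMaxModulus_pointConfiguration hx)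
  rw [measureReal_def, mixedLaw, Measure.add_apply, Measure.smul_apply, Measure.smul_apply,
    key, key, smul_eq_mul, smul_eq_mul, ENNReal.toReal_add (by finiteness) (by finiteness),
    ENNReal.toReal_mul, ENNReal.toReal_mul, ENNReal.toReal_ofReal (sub_nonneg.2 hp1),
    ENNReal.toReal_ofReal hp0]
  rfl

end MixedLaw

/-! ### The distribution function of the maximum -/

/-- The substitution y = ρ^(-α) reverses (0, t] into [t^(-α), ∞), and u = cy gives the incomplete
Gamma function. -/
theorem setIntegral_Ioc_rpow_mul_exp_neg {α q c t : ℝ} (hα : 0 < α) (hc : 0 < c)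
    (ht : 0 < t) :
    ∫ ρ in Ioc 0 t, ρ ^ (-(q + 1)) * Real.exp (-c * ρ ^ (-α))
      = c ^ (-(q / α)) / α * upperGamma (q / α) (c * t ^ (-α)) := by
  have htα : 0 < t ^ (-α) := Real.rpow_pos_of_pos ht _
  set g : ℝ → ℝ := (Ici (t ^ (-α))).indicator fun y => y ^ (q / α - 1) * Real.exp (-(c * y)) with hg
  have h1 : ∫ ρ in Ioc 0 t, ρ ^ (-(q + 1)) * Real.exp (-c * ρ ^ (-α))
      = α⁻¹ * ∫ ρ in Ioi (0 : ℝ), (|-α| * ρ ^ (-α - 1)) • g (ρ ^ (-α)) := by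
    rw [← integral_const_mul]
    have e : Ioc 0 t = Ioi 0 ∩ Iic t := rfl
    rw [e, ← setIntegral_indicator measurableSet_Iic]
    refine setIntegral_congr_fun measurableSet_Ioi fun ρ hρ => ?_
    have hρ0 : 0 < ρ := hρ
    have hiff : ρ ∈ Iic t ↔ ρ ^ (-α) ∈ Ici (t ^ (-α)) :=
      (Real.rpow_le_rpow_iff_of_neg ht hρ0 (neg_lt_zero.2 hα)).symm
    by_cases hmem : ρ ∈ Iic t
    · rw [indicator_of_mem hmem, hg]
      simp only [indicator_of_mem (hiff.1 hmem), abs_neg, abs_of_pos hα, smul_eq_mul]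
      rw [← Real.rpow_mul hρ0.le,
        show -(q + 1) = (-α - 1) + -α * (q / α - 1) by field_simp; ring, Real.rpow_add hρ0,
        neg_mul]
      field_simp
    · rw [indicator_of_notMem hmem, hg]
      simp only [indicator_of_notMem (fun h => hmem (hiff.2 h)), smul_zero, mul_zero]
  have h2 : ∫ y in Ioi (0 : ℝ), g y = ∫ y in Ioi (t ^ (-α)),
      c ^ (-(q / α - 1)) * ((c * y) ^ (q / α - 1) * Real.exp (-(c * y))) := by
    rw [hg, setIntegral_indicator measurableSet_Ici,
      inter_eq_self_of_subset_right (Ici_subset_Ioi.2 htα), integral_Ici_eq_integral_Ioi]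
    refine setIntegral_congr_fun measurableSet_Ioi fun y hy => ?_
    have hy0 : 0 < y := htα.trans hy
    rw [Real.mul_rpow hc.le hy0.le, Real.rpow_neg hc.le]
    have := (Real.rpow_pos_of_pos hc (q / α - 1)).ne'
    field_simp
  rw [h1, integral_comp_rpow_Ioi g (neg_ne_zero.2 hα.ne'), h2, integral_const_mul,
    integral_comp_mul_left_Ioi (fun u => u ^ (q / α - 1) * Real.exp (-u)) _ hc, upperGamma,
    smul_eq_mul, show -(q / α) = -(q / α - 1) + -1 by ring, Real.rpow_add hc,
    Real.rpow_neg_one]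
  ring

theorem limitMass_eq_Gamma {χ α γ : ℝ} (hχ : 0 < χ) (hα : 0 < α) (hγ : 0 < γ) (k : ℕ) :
    limitMass χ α γ k = 2 * Real.pi * ((2 * γ) ^ (-((2 * (k : ℝ) + 2 * χ) / α)) / α *
      Real.Gamma ((2 * (k : ℝ) + 2 * χ) / α)) := by
  have hq : 0 < 2 * (k : ℝ) + 2 * χ := by positivity
  have h1 := integral_rpow_mul_exp_neg_mul_rpow (p := α) (q := 2 * (k : ℝ) + 2 * χ - 1)
    (b := 2 * γ) hα (by linarith) (by positivity)
  simp only [← neg_mul] at h1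
  rw [limitMass_eq, h1, sub_add_cancel, neg_div]
  ring

theorem integral_limitMode_closedBall {χ α γ : ℝ} (hχ : 0 < χ) (hα : 0 < α) (hγ : 0 < γ)
    (j k : ℕ) {t : ℝ} (ht : 0 < t) :
    ∫ z, limitMode χ α γ j z * star (limitMode χ α γ k z) *
        (Metric.closedBall (0 : ℂ) t).indicator (1 : ℂ → ℂ) z
      = if j = k then ((upperGamma ((2 * (k : ℝ) + 2 * χ) / α) (2 * γ * t ^ (-α)) /
          Real.Gamma ((2 * (k : ℝ) + 2 * χ) / α) : ℝ) : ℂ) else 0 := by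
  have hind : ∀ z : ℂ, (Metric.closedBall (0 : ℂ) t).indicator (1 : ℂ → ℂ) z
      = (((Iic t).indicator (1 : ℝ → ℝ) ‖z‖ : ℝ) : ℂ) := by
    intro z
    by_cases hz : ‖z‖ ≤ t
    · rw [indicator_of_mem (by simpa using hz), indicator_of_mem (show ‖z‖ ∈ Iic t from hz)]
      simp
    · rw [indicator_of_notMem (by simpa using hz), indicator_of_notMem (show ‖z‖ ∉ Iic t from hz)]
      simp
  simp only [hind]
  split_ifs with hjk
  · subst hjk
    have hm := limitMass_pos hχ hα hγ j
    set G : ℝ → ℝ := fun r => (r ^ (-(j : ℤ)) * (r ^ (-(χ + 1)) * Real.exp (-γ * r ^ (-α)) /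
      √(limitMass χ α γ j))) ^ 2 * (Iic t).indicator 1 r
    have e : ∀ z, limitMode χ α γ j z * star (limitMode χ α γ j z) *
        (((Iic t).indicator (1 : ℝ → ℝ) ‖z‖ : ℝ) : ℂ) = ((G ‖z‖ : ℝ) : ℂ) := by
      intro z
      rw [Complex.star_def, Complex.mul_conj, Complex.normSq_eq_norm_sq, limitMode,
        norm_radialMode_sq, ← Complex.ofReal_mul]
    simp only [e]
    rw [integral_complex_ofReal, integral_comp_norm_complex G]
    congr 1
    have e2 : ∀ r ∈ Ioi (0 : ℝ), r • G r = (Iic t).indicator (fun r =>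
        r ^ (-(2 * (j : ℝ) + 2 * χ + 1)) * Real.exp (-(2 * γ) * r ^ (-α)) *
          (limitMass χ α γ j)⁻¹) r := by
      intro r hr
      have h1 := limitMode_integrand_eq χ α γ j (show 0 < r from hr)
      rw [Real.sq_sqrt hm.le, show -2 * γ = -(2 * γ) by ring] at h1
      by_cases hmem : r ∈ Iic t
      · simp only [G, indicator_of_mem hmem, Pi.one_apply, mul_one, smul_eq_mul]
        exact h1
      · simp only [G, indicator_of_notMem hmem, mul_zero, smul_zero]
    have e3 : Ioi 0 ∩ Iic t = Ioc 0 t := rfl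
    rw [setIntegral_congr_fun measurableSet_Ioi e2, setIntegral_indicator measurableSet_Iic, e3,
      integral_mul_const, setIntegral_Ioc_rpow_mul_exp_neg hα (by positivity) ht,
      limitMass_eq_Gamma hχ hα hγ, smul_eq_mul]
    have h1 : Real.Gamma ((2 * (j : ℝ) + 2 * χ) / α) ≠ 0 :=
      (Real.Gamma_pos_of_pos (by positivity)).ne'
    have h2 : (2 * γ) ^ (-((2 * (j : ℝ) + 2 * χ) / α)) ≠ 0 :=
      (Real.rpow_pos_of_pos (by positivity) _).ne'
    have h3 := Real.pi_ne_zero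
    field_simp
  · set g : ℕ → ℝ → ℝ := fun k r => r ^ (-(χ + 1)) * Real.exp (-γ * r ^ (-α)) /
      √(limitMass χ α γ k)
    have e : ∀ z, limitMode χ α γ j z * star (limitMode χ α γ k z) *
        (((Iic t).indicator (1 : ℝ → ℝ) ‖z‖ : ℝ) : ℂ)
        = z ^ (-(j : ℤ)) * star (z ^ (-(k : ℤ))) *
          (fun r => ((g j r * g k r * (Iic t).indicator 1 r : ℝ) : ℂ)) ‖z‖ := by
      intro z
      simp only [limitMode, radialMode, star_mul', Complex.star_def, Complex.conj_ofReal, g]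
      push_cast
      ring
    simp only [e]
    exact integral_zpow_mul_star_zpow_eq_zero (by simpa using hjk)
      fun r => ((g j r * g k r * (Iic t).indicator 1 r : ℝ) : ℂ)

theorem norm_indicator_one_le (s : Set ℂ) (z : ℂ) : ‖s.indicator (1 : ℂ → ℂ) z‖ ≤ 1 :=
  (norm_indicator_le_norm_self _ _).trans (by simp)

/-- The indicator of a disc is radial, so rotation invariance makes the Gram matrix diagonal, and
its determinant is the product of the diagonal entries. -/
theorem measureReal_maxModulus_le_limitMode {χ α γ : ℝ} (hχ : 0 < χ) (hα : 0 < α) (hγ : 0 < γ)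
    (n : ℕ) {t : ℝ} (ht : 0 < t) :
    (projectionEnsemble volume fun k : Fin n => limitMode χ α γ k).real {x | maxModulus x ≤ t}
      = ∏ k ∈ Finset.range n, upperGamma ((2 * (k : ℝ) + 2 * χ) / α) (2 * γ * t ^ (-α)) /
          Real.Gamma ((2 * (k : ℝ) + 2 * χ) / α) := by
  have h1 := (isOrthonormalFamily_limitMode hχ hα hγ n).integral_prod
    (measurable_one.indicator (Metric.isClosed_closedBall (x := (0 : ℂ)) (ε := t)).measurableSet)
    (norm_indicator_one_le _)
  rw [integral_prod_indicator_closedBall _ ht.le] at h1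
  have e : (Matrix.of fun j k : Fin n => ∫ z, limitMode χ α γ j z * star (limitMode χ α γ k z) *
        (Metric.closedBall (0 : ℂ) t).indicator (1 : ℂ → ℂ) z)
      = Matrix.diagonal fun k : Fin n =>
        ((upperGamma ((2 * (k : ℝ) + 2 * χ) / α) (2 * γ * t ^ (-α)) /
          Real.Gamma ((2 * (k : ℝ) + 2 * χ) / α) : ℝ) : ℂ) := by
    ext j k
    rw [Matrix.of_apply, integral_limitMode_closedBall hχ hα hγ j k ht, Matrix.diagonal_apply]
    by_cases hjk : j = k
    · subst hjk
      simp
    · rw [if_neg (by simpa [Fin.ext_iff] using hjk), if_neg hjk]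
  rw [e, Matrix.det_diagonal, ← Complex.ofReal_prod] at h1
  rw [Finset.prod_range]
  exact_mod_cast h1

theorem upperGamma_one (x : ℝ) : upperGamma 1 x = Real.exp (-x) := by
  simp only [upperGamma, sub_self, Real.rpow_zero, one_mul]
  exact integral_exp_neg_Ioi x

namespace IsAdmissiblePotential

variable {χ : ℝ} {V : ℝ → ℝ} {α γ Lplus Lminus : ℝ}
  (h : IsAdmissiblePotential χ V α γ Lplus Lminus)

include h

theorem tendsto_coulombGas_maxModulus_le {t : ℝ} (ht : 0 < t) :
    Tendsto (fun n : ℕ => (coulombGas χ V n).real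
        {x | (n : ℝ) ^ (-(1 / α)) * maxModulus x ≤ t}) atTop
      (𝓝 ((1 - occupation χ α γ Lminus Lplus (particleNumber χ α)) *
        (projectionEnsemble volume fun k : Fin (particleNumber χ α) =>
          limitMode χ α γ k).real {x | maxModulus x ≤ t} +
        occupation χ α γ Lminus Lplus (particleNumber χ α) *
        (projectionEnsemble volume fun k : Fin (particleNumber χ α + 1) =>
          limitMode χ α γ k).real {x | maxModulus x ≤ t})) := by
  have h1 := h.tendsto_integral_prod_coulombGas_mixture
    (measurable_one.indicator (Metric.isClosed_closedBall (x := (0 : ℂ)) (ε := t)).measurableSet)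
    (norm_indicator_one_le _) ht fun z hz => by
      rw [indicator_of_mem (by simpa using hz)]
      rfl
  rw [integral_prod_indicator_closedBall _ ht.le, integral_prod_indicator_closedBall _ ht.le] at h1
  have h2 : ∀ n : ℕ, ∫ x, ∏ i, (Metric.closedBall (0 : ℂ) t).indicator (1 : ℂ → ℂ)
      (((n : ℝ) ^ (1 / α))⁻¹ • x i) ∂(coulombGas χ V n)
      = (((coulombGas χ V n).real {x | (n : ℝ) ^ (-(1 / α)) * maxModulus x ≤ t} : ℝ) : ℂ) := by
    intro n
    have hs : 0 ≤ ((n : ℝ) ^ (1 / α))⁻¹ := by positivity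
    have hmap : Measurable fun (x : Fin n → ℂ) k => ((n : ℝ) ^ (1 / α))⁻¹ • x k :=
      measurable_pi_lambda _ fun k => (measurable_const_smul _).comp (measurable_pi_apply k)
    have hm : MeasurableSet {x : Fin n → ℂ | maxModulus x ≤ t} :=
      measurableSet_le (measurable_maxModulus n) measurable_const
    have h3 := integral_prod_indicator_closedBall
      ((coulombGas χ V n).map fun (x : Fin n → ℂ) k => ((n : ℝ) ^ (1 / α))⁻¹ • x k) ht.le
    rw [integral_map hmap.aemeasurable, map_measureReal_apply hmap hm] at h3
    · rw [h3]
      congr 3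
      ext x
      simp only [mem_preimage, mem_ofPred_eq, maxModulus_smul x hs]
      rw [Real.rpow_neg (by positivity)]
    · exact (Finset.measurable_prod _ fun i _ => (measurable_one.indicator
        Metric.isClosed_closedBall.measurableSet).comp (measurable_pi_apply i)).aestronglyMeasurable
  simp only [h2, ← Complex.ofReal_mul, ← Complex.ofReal_add] at h1
  exact (Complex.continuous_re.tendsto _).comp h1

end IsAdmissiblePotential

/-! ### Convergence in law -/

/-- Half-open intervals with nonzero endpoints form a π-system that still contains small
neighbourhoods of each point. The point t = 0 is left out because the limiting maximum may have an
atom there, from the empty configuration. -/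
theorem tendsto_probabilityMeasure_of_tendsto_measureReal_Iic {μs : ℕ → ProbabilityMeasure ℝ}
    {μ : ProbabilityMeasure ℝ}
    (h : ∀ t : ℝ, t ≠ 0 → Tendsto (fun n => (μs n : Measure ℝ).real (Iic t)) atTop
      (𝓝 ((μ : Measure ℝ).real (Iic t)))) : Tendsto μs atTop (𝓝 μ) := by
  have hIoc : ∀ (ν : ProbabilityMeasure ℝ) {a b : ℝ}, a ≤ b → (ν : Measure ℝ).real (Ioc a b)
      = (ν : Measure ℝ).real (Iic b) - (ν : Measure ℝ).real (Iic a) := by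
    intro ν a b hab
    rw [← measureReal_sdiff (Iic_subset_Iic.2 hab) measurableSet_Iic, Iic_sdiff_Iic]
  have hpi : IsPiSystem {s : Set ℝ | ∃ a b : ℝ, a ≠ 0 ∧ b ≠ 0 ∧ s = Ioc a b} := by
    rintro _ ⟨a, b, ha, hb, rfl⟩ _ ⟨c, d, hc, hd, rfl⟩ -
    refine ⟨max a c, min b d, ?_, ?_, Ioc_inter_Ioc⟩
    · rcases max_choice a c with e | e <;> rwa [e]
    · rcases min_choice b d with e | e <;> rwa [e]
  refine hpi.tendsto_probabilityMeasure_of_tendsto_of_mem ?_ ?_ ?_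
  · rintro _ ⟨a, b, -, -, rfl⟩
    exact measurableSet_Ioc
  · intro u hu x hx
    obtain ⟨ε, hε, hball⟩ := Metric.isOpen_iff.1 hu x hx
    -- At most one shift lands on 0, so one of ε/2 and ε/3 avoids it.
    have hne : ∀ c : ℝ, c ≠ 0 → ∃ d, 0 < d ∧ d < ε ∧ x + c * d ≠ 0 := by
      intro c hc
      by_cases h0 : x + c * (ε / 2) = 0
      · refine ⟨ε / 3, by linarith, by linarith, fun h1 => ?_⟩
        have h2 : c * ε = 0 := by linarith
        exact hc ((mul_eq_zero.1 h2).resolve_right hε.ne')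
      · exact ⟨ε / 2, by linarith, by linarith, h0⟩
    obtain ⟨d₁, hd₁, hd₁ε, hd₁x⟩ := hne (-1) (by norm_num)
    obtain ⟨d₂, hd₂, hd₂ε, hd₂x⟩ := hne 1 one_ne_zero
    refine ⟨Ioc (x + -1 * d₁) (x + 1 * d₂), ⟨_, _, hd₁x, hd₂x, rfl⟩,
      Ioc_mem_nhds (by linarith) (by linarith), fun y hy => hball ?_⟩
    rw [Metric.mem_ball, Real.dist_eq, abs_lt]
    constructor <;> linarith [hy.1, hy.2]
  · rintro _ ⟨a, b, ha, hb, rfl⟩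
    rw [← NNReal.tendsto_coe]
    change Tendsto (fun n => (μs n : Measure ℝ).real (Ioc a b)) atTop
      (𝓝 ((μ : Measure ℝ).real (Ioc a b)))
    rcases le_or_gt a b with hab | hab
    · simp only [hIoc _ hab]
      exact (h b hb).sub (h a ha)
    · simp [Ioc_eq_empty_of_le hab.le]

theorem occupation_particleNumber_of_ne {χ α γ Lplus Lminus : ℝ}
    (hne : ∀ m : ℤ, α / 2 - χ ≠ m) :
    occupation χ α γ Lminus Lplus (particleNumber χ α) = 0 := by
  have h1 : α ≤ 2 * (particleNumber χ α : ℝ) + 2 * χ := le_of_particleNumber_le le_rfl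
  have h2 : α ≠ 2 * (particleNumber χ α : ℝ) + 2 * χ := fun h2 => by
    refine hne (particleNumber χ α) ?_
    push_cast
    linarith
  rw [occupation, limitCoeff_of_gt (lt_of_le_of_ne h1 h2), zero_mul]

namespace IsAdmissiblePotential

variable {χ : ℝ} {V : ℝ → ℝ} {α γ Lplus Lminus : ℝ}
  (h : IsAdmissiblePotential χ V α γ Lplus Lminus)

include h

theorem isProbabilityMeasure_mixedLaw_limitMode :
    IsProbabilityMeasure (mixedLaw (limitMode χ α γ) (particleNumber χ α)
      (occupation χ α γ Lminus Lplus (particleNumber χ α))) :=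
  isProbabilityMeasure_mixedLaw
    (isOrthonormalFamily_limitMode h.chi_pos h.alpha_pos h.gamma_pos _)
    (isOrthonormalFamily_limitMode h.chi_pos h.alpha_pos h.gamma_pos _)
    (h.occupation_nonneg _) (h.occupation_le_one _)

/-- The mixture has at most N+1 points, so uniqueness applies; any property of a process with the
limiting kernel can be checked on the mixture. -/
theorem eq_mixedLaw {F : Measure (Configuration PuncturedPlane)} [IsProbabilityMeasure F]
    (hF : IsDeterminantal F lebesguePunctured (limitKernel χ α γ Lminus Lplus)) :
    F = mixedLaw (limitMode χ α γ) (particleNumber χ α)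
      (occupation χ α γ Lminus Lplus (particleNumber χ α)) := by
  have := h.isProbabilityMeasure_mixedLaw_limitMode
  exact hF.eq_of_ae_count_le h.isDeterminantal_mixedLaw_limitMode _
    ae_count_univ_le_mixedLaw

/-- The characteristic functional at f is the multiplicative functional of exp(if), extended by 1 at
the origin, whose limit is already known to be that of the mixture. -/
theorem tendstoInDistribution_pointConfiguration {Ω : ℕ → Type*} [∀ n, MeasurableSpace (Ω n)]
    {P : ∀ n, Measure (Ω n)} [∀ n, IsProbabilityMeasure (P n)] {x : ∀ n, Ω n → Fin n → ℂ}
    (hx : ∀ n, HasLaw (x n) (coulombGas χ V n) (P n))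
    {F : Measure (Configuration PuncturedPlane)} [IsProbabilityMeasure F]
    (hF : IsDeterminantal F lebesguePunctured (limitKernel χ α γ Lminus Lplus)) :
    TendstoInDistribution
      (fun (n : ℕ) (ω : Ω n) => pointConfiguration (fun k => (n : ℝ) ^ (-(1 / α)) • x n ω k))
      atTop (fun ξ : Configuration PuncturedPlane => ξ) P F := by
  have hmap : ∀ n : ℕ, Measurable fun x : Fin n → ℂ =>
      pointConfiguration (fun k => (n : ℝ) ^ (-(1 / α)) • x k) := fun n =>
    (measurable_pointConfiguration n).comp (measurable_pi_lambda _ fun k =>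
      (measurable_const_smul _).comp (measurable_pi_apply k))
  have hX : ∀ n : ℕ, AEMeasurable (fun ω =>
      pointConfiguration (fun k => (n : ℝ) ^ (-(1 / α)) • x n ω k)) (P n) :=
    fun n => (hmap n).comp_aemeasurable (hx n).aemeasurable
  refine ⟨hX, aemeasurable_id, ?_⟩
  refine Configuration.tendsto_of_tendsto_integral_exp fun f => ?_
  have hG : Measurable fun ξ : Configuration PuncturedPlane =>
      Complex.exp (Complex.I * (∫ x, f x ∂ξ.1 : ℝ)) := by
    have := (Configuration.continuous_integral f).measurable
    fun_prop
  have hGC : ∀ ξ : Configuration PuncturedPlane,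
      ‖Complex.exp (Complex.I * (∫ x, f x ∂ξ.1 : ℝ))‖ ≤ 1 := fun ξ => by
    rw [mul_comm, Complex.norm_exp_ofReal_mul_I]
  set g : ℂ → ℂ := fun z => Complex.exp (Complex.I * extendZero f z) with hg
  have hgm : Measurable g := by
    have := (continuous_extendZero f).measurable
    fun_prop
  have hg1 : ∀ z, ‖g z‖ ≤ 1 := fun z => by
    rw [hg]
    simp only
    rw [mul_comm, Complex.norm_exp_ofReal_mul_I]
  obtain ⟨ε, hε, hfε⟩ := exists_extendZero_eq_zero f
  have hprod : ∀ {n : ℕ} (y : Fin n → ℂ),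
      Complex.exp (Complex.I * (∫ x, f x ∂(pointConfiguration y).1 : ℝ)) = ∏ k, g (y k) := by
    intro n y
    rw [integral_pointConfiguration, ← Complex.exp_sum, Complex.ofReal_sum, Finset.mul_sum]
  have hlim := h.tendsto_integral_prod_coulombGas_mixture hgm hg1 hε fun z hz => by
    simp [hg, hfε z hz]
  simp only [ProbabilityMeasure.coe_mk, Measure.map_id']
  rw [h.eq_mixedLaw hF, integral_mixedLaw
    (isOrthonormalFamily_limitMode h.chi_pos h.alpha_pos h.gamma_pos _)
    (isOrthonormalFamily_limitMode h.chi_pos h.alpha_pos h.gamma_pos _)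
    (h.occupation_nonneg _) (h.occupation_le_one _) hG hGC]
  simp only [hprod]
  refine hlim.congr fun n => ?_
  rw [integral_map (hX n) hG.aestronglyMeasurable]
  have h1 := (hx n).integral_comp (f := fun x : Fin n → ℂ =>
    ∏ i, g (((n : ℝ) ^ (1 / α))⁻¹ • x i)) (Finset.measurable_prod _ fun i _ =>
      hgm.comp ((measurable_const_smul _).comp (measurable_pi_apply i))).aestronglyMeasurable
  rw [← h1]
  refine integral_congr_ae (ae_of_all _ fun ω => ?_)
  simp only [Function.comp_apply, hprod, Real.rpow_neg (Nat.cast_nonneg n)]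

theorem measureReal_maxModulus_le {F : Measure (Configuration PuncturedPlane)}
    [IsProbabilityMeasure F]
    (hF : IsDeterminantal F lebesguePunctured (limitKernel χ α γ Lminus Lplus)) (t : ℝ) :
    F.real {ξ | ξ.maxModulus ≤ t}
      = (1 - occupation χ α γ Lminus Lplus (particleNumber χ α)) *
        (projectionEnsemble volume fun k : Fin (particleNumber χ α) =>
          limitMode χ α γ k).real {x | maxModulus x ≤ t} +
        occupation χ α γ Lminus Lplus (particleNumber χ α) *
        (projectionEnsemble volume fun k : Fin (particleNumber χ α + 1) =>
          limitMode χ α γ k).real {x | maxModulus x ≤ t} := by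
  rw [← measureReal_maxModulus_mixedLaw
    (isOrthonormalFamily_limitMode h.chi_pos h.alpha_pos h.gamma_pos _)
    (isOrthonormalFamily_limitMode h.chi_pos h.alpha_pos h.gamma_pos _)
    (h.occupation_nonneg _) (h.occupation_le_one _) t]
  have hae : Configuration.maxModulus =ᵐ[F] Configuration.ratMaxModulus := by
    refine maxModulus_ae_eq_ratMaxModulus hF.simple (M := particleNumber χ α + 1) ?_
    rw [h.eq_mixedLaw hF]
    exact ae_count_univ_le_mixedLaw
  rw [← h.eq_mixedLaw hF]
  refine measureReal_congr ?_
  filter_upwards [hae] with ξ hξ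
  exact congrArg (· ≤ t) hξ

theorem tendstoInDistribution_maxModulus {Ω : ℕ → Type*} [∀ n, MeasurableSpace (Ω n)]
    {P : ∀ n, Measure (Ω n)} [∀ n, IsProbabilityMeasure (P n)] {x : ∀ n, Ω n → Fin n → ℂ}
    (hx : ∀ n, HasLaw (x n) (coulombGas χ V n) (P n))
    {F : Measure (Configuration PuncturedPlane)} [IsProbabilityMeasure F]
    (hF : IsDeterminantal F lebesguePunctured (limitKernel χ α γ Lminus Lplus)) :
    TendstoInDistribution (fun (n : ℕ) (ω : Ω n) => (n : ℝ) ^ (-(1 / α)) * maxModulus (x n ω))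
      atTop Configuration.maxModulus P F := by
  have hmap : ∀ n : ℕ, Measurable fun x : Fin n → ℂ => (n : ℝ) ^ (-(1 / α)) * maxModulus x :=
    fun n => (measurable_maxModulus n).const_mul _
  have hX : ∀ n : ℕ, AEMeasurable (fun ω => (n : ℝ) ^ (-(1 / α)) * maxModulus (x n ω)) (P n) :=
    fun n => (hmap n).comp_aemeasurable (hx n).aemeasurable
  have hae : Configuration.maxModulus =ᵐ[F] Configuration.ratMaxModulus := by
    refine maxModulus_ae_eq_ratMaxModulus hF.simple (M := particleNumber χ α + 1) ?_
    rw [h.eq_mixedLaw hF]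
    exact ae_count_univ_le_mixedLaw
  have hm : AEMeasurable Configuration.maxModulus F :=
    ⟨_, Configuration.measurable_ratMaxModulus, hae⟩
  refine ⟨hX, hm, tendsto_probabilityMeasure_of_tendsto_measureReal_Iic fun t ht => ?_⟩
  simp only [ProbabilityMeasure.coe_mk]
  rw [map_measureReal_apply_of_aemeasurable hm measurableSet_Iic]
  simp only [map_measureReal_apply_of_aemeasurable (hX _) measurableSet_Iic]
  -- Maxima are nonnegative, so both distribution functions vanish for t < 0.
  rcases lt_or_gt_of_ne ht with ht | ht
  · have h1 : ∀ n : ℕ, (fun ω => (n : ℝ) ^ (-(1 / α)) * maxModulus (x n ω)) ⁻¹' Iic t = ∅ :=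
      fun n => eq_empty_of_forall_notMem fun ω hω => absurd
        (mul_nonneg (Real.rpow_nonneg (Nat.cast_nonneg n) _) (maxModulus_nonneg (x n ω)))
        (not_le.2 ((show _ ≤ t from hω).trans_lt ht))
    have h2 : Configuration.maxModulus ⁻¹' Iic t = ∅ :=
      eq_empty_of_forall_notMem fun ξ hξ => absurd
        (Real.sSup_nonneg (by rintro _ ⟨z, -, rfl⟩; exact norm_nonneg _))
        (not_le.2 ((show ξ.maxModulus ≤ t from hξ).trans_lt ht))
    simp only [h1, h2, measureReal_empty]
    exact tendsto_const_nhds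
  · have h1 := h.measureReal_maxModulus_le hF t
    have h2 := h.tendsto_coulombGas_maxModulus_le ht
    rw [← h1] at h2
    refine h2.congr fun n => ?_
    rw [← (hx n).measureReal_eq (measurableSet_le (hmap n) measurable_const)]
    rfl

theorem tendsto_measureReal_maxModulus_le {Ω : ℕ → Type*} [∀ n, MeasurableSpace (Ω n)]
    {P : ∀ n, Measure (Ω n)} {x : ∀ n, Ω n → Fin n → ℂ}
    (hx : ∀ n, HasLaw (x n) (coulombGas χ V n) (P n)) {t : ℝ} (ht : 0 < t) :
    Tendsto (fun n : ℕ => (P n).real {ω | (n : ℝ) ^ (-(1 / α)) * maxModulus (x n ω) ≤ t}) atTop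
      (𝓝 ((∏ k ∈ Finset.range (particleNumber χ α),
          upperGamma ((2 * (k : ℝ) + 2 * χ) / α) (2 * γ * t ^ (-α)) /
            Real.Gamma ((2 * (k : ℝ) + 2 * χ) / α)) *
        (1 - occupation χ α γ Lminus Lplus (particleNumber χ α) +
          occupation χ α γ Lminus Lplus (particleNumber χ α) *
          (upperGamma ((2 * (particleNumber χ α : ℝ) + 2 * χ) / α) (2 * γ * t ^ (-α)) /
            Real.Gamma ((2 * (particleNumber χ α : ℝ) + 2 * χ) / α))))) := by
  have h2 := h.tendsto_coulombGas_maxModulus_le ht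
  rw [measureReal_maxModulus_le_limitMode h.chi_pos h.alpha_pos h.gamma_pos _ ht,
    measureReal_maxModulus_le_limitMode h.chi_pos h.alpha_pos h.gamma_pos _ ht,
    Finset.prod_range_succ] at h2
  have e : ∀ A B p : ℝ, A * (1 - p + p * B) = (1 - p) * A + p * (A * B) := fun A B p => by ring
  rw [e]
  refine h2.congr fun n => ?_
  rw [← (hx n).measureReal_eq (measurableSet_le ((measurable_maxModulus n).const_mul _)
    measurable_const)]

end IsAdmissiblePotential

/-! ### Assembly of the theorem. -/

theorem particleNumber_of_ne {χ α : ℝ} (hα : 2 * χ ≤ α) (hne : ∀ m : ℤ, α / 2 - χ ≠ m) :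
    particleNumber χ α = ⌊α / 2 - χ⌋₊ + 1 := by
  have h0 : 0 ≤ α / 2 - χ := by linarith
  rw [particleNumber, Nat.ceil_eq_iff (Nat.succ_ne_zero _)]
  refine ⟨lt_of_le_of_ne ?_ ?_, ?_⟩
  · simpa using Nat.floor_le h0
  · have := hne ⌊α / 2 - χ⌋₊
    push_cast at this
    simpa using this.symm
  · push_cast
    exact (Nat.lt_floor_add_one _).le

theorem particleNumber_of_eq {χ α : ℝ} {N : ℕ} (hN : α / 2 - χ = N) : particleNumber χ α = N := by
  rw [particleNumber, hN, Nat.ceil_natCast]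

theorem mainTheorem4
    (χ : ℝ) (hχ : 0 < χ) (V : ℝ → ℝ) (hV : IsCirclePotential V)
    (α : ℝ) (hα : 2 * χ ≤ α)
    (hVlog : ∀ r : ℝ, 1 < r → Real.log r < V r)
    (γ : ℝ) (hγ : 0 < γ)
    (hVinf : Tendsto (fun r : ℝ => r ^ α * (V r - Real.log r)) atTop (𝓝 γ))
    (Lplus Lminus : ℝ) (hLplus : 0 < Lplus) (hLminus : 1 ≤ Lminus)
    (hVplus : Tendsto (fun r : ℝ => V r / (r - 1)) (𝓝[>] 1) (𝓝 (Lplus + 1)))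
    (hVminus : Tendsto (fun r : ℝ => V r / (1 - r)) (𝓝[<] 1) (𝓝 (Lminus - 1))) :
    -- the law of the gas is well defined
    (∀ n, IsProbabilityMeasure (coulombGas χ V n)) ∧
    -- a determinantal process with the limiting kernel exists
    (∃ F : Measure (Configuration PuncturedPlane), IsProbabilityMeasure F ∧
      IsDeterminantal F lebesguePunctured (limitKernel χ α γ Lminus Lplus)) ∧
    -- particles following this law, on arbitrary probability spaces
    (∀ (Ω : ℕ → Type*) [∀ n, MeasurableSpace (Ω n)] (P : ∀ n, Measure (Ω n))
      [∀ n, IsProbabilityMeasure (P n)] (x : ∀ n, Ω n → Fin n → ℂ),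
      (∀ n, HasLaw (x n) (coulombGas χ V n) (P n)) →
    -- every (law `F` of a) determinantal process with this kernel has the claimed properties
    (∀ (F : Measure (Configuration PuncturedPlane)) [IsProbabilityMeasure F],
      IsDeterminantal F lebesguePunctured (limitKernel χ α γ Lminus Lplus) →
      -- convergence of the point processes
      TendstoInDistribution
        (fun (n : ℕ) (ω : Ω n) => pointConfiguration (fun k => (n : ℝ) ^ (-(1 / α)) • x n ω k))
        atTop (fun ξ : Configuration PuncturedPlane => ξ) P F ∧
      -- the number of particles of the limit
      ((∀ m : ℤ, α / 2 - χ ≠ m) → F {ξ | ξ.count Set.univ = (⌈α / 2 - χ⌉₊ : ℝ≥0∞)} = 1) ∧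
      (∀ N : ℕ, α / 2 - χ = N →
        F {ξ | ξ.count Set.univ = (N : ℝ≥0∞)} = ENNReal.ofReal
          (Real.pi * (1 / Lplus + 1 / Lminus) * limitCoeff χ α γ Lminus Lplus N) ∧
        F {ξ | ξ.count Set.univ = ((N + 1 : ℕ) : ℝ≥0∞)} = ENNReal.ofReal
          (1 - Real.pi * (1 / Lplus + 1 / Lminus) * limitCoeff χ α γ Lminus Lplus N)) ∧
      -- convergence of the maxima
      TendstoInDistribution (fun (n : ℕ) (ω : Ω n) => (n : ℝ) ^ (-(1 / α)) * maxModulus (x n ω))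
        atTop Configuration.maxModulus P F) ∧
    -- the explicit limits of the distribution functions of the maxima
    ((∀ m : ℤ, α / 2 - χ ≠ m) → ∀ t : ℝ, 0 < t →
      Tendsto (fun n : ℕ => (P n).real
          {ω | (n : ℝ) ^ (-(1 / α)) * maxModulus (x n ω) ≤ t}) atTop
        (𝓝 (∏ k ∈ Finset.range (⌊α / 2 - χ⌋₊ + 1),
          upperGamma ((2 * (k : ℝ) + 2 * χ) / α) (2 * γ * t ^ (-α)) /
            Real.Gamma ((2 * (k : ℝ) + 2 * χ) / α)))) ∧
    (∀ N : ℕ, α / 2 - χ = N → ∀ t : ℝ, 0 < t →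
      Tendsto (fun n : ℕ => (P n).real
          {ω | (n : ℝ) ^ (-(1 / α)) * maxModulus (x n ω) ≤ t}) atTop
        (𝓝 ((∏ k ∈ Finset.range N,
          upperGamma ((2 * (k : ℝ) + 2 * χ) / α) (2 * γ * t ^ (-α)) /
            Real.Gamma ((2 * (k : ℝ) + 2 * χ) / α)) *
          (Real.exp (-2 * γ * t ^ (-α)) + (1 - Real.exp (-2 * γ * t ^ (-α))) *
            (1 / Lplus + 1 / Lminus) * (1 / (α * γ) + 1 / Lplus + 1 / Lminus)⁻¹))))) := by
  have h : IsAdmissiblePotential χ V α γ Lplus Lminus :=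
    ⟨hχ, hV, hα, hVlog, hγ, hVinf, hLplus, hLminus, hVplus, hVminus⟩
  have hα0 := h.alpha_pos
  refine ⟨h.isProbabilityMeasure_coulombGas,
    ⟨_, h.isProbabilityMeasure_mixedLaw_limitMode, h.isDeterminantal_mixedLaw_limitMode⟩,
    fun Ω _ P _ x hx => ⟨fun F _ hF => ⟨h.tendstoInDistribution_pointConfiguration hx hF,
      fun hne => ?_, fun N hN => ?_, h.tendstoInDistribution_maxModulus hx hF⟩,
      fun hne t ht => ?_, fun N hN t ht => ?_⟩⟩
  · have h1 := (mixedLaw_count_univ (p := occupation χ α γ Lminus Lplus (particleNumber χ α))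
      (isOrthonormalFamily_limitMode hχ hα0 hγ (particleNumber χ α))
      (isOrthonormalFamily_limitMode hχ hα0 hγ (particleNumber χ α + 1))).1
    rw [← h.eq_mixedLaw hF, occupation_particleNumber_of_ne hne] at h1
    simpa [particleNumber] using h1
  · have hp := particleNumber_of_eq hN
    have h1 := mixedLaw_count_univ (p := occupation χ α γ Lminus Lplus (particleNumber χ α))
      (isOrthonormalFamily_limitMode hχ hα0 hγ (particleNumber χ α))
      (isOrthonormalFamily_limitMode hχ hα0 hγ (particleNumber χ α + 1))
    rw [← h.eq_mixedLaw hF, hp] at h1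
    rw [← h.one_sub_occupation_of_eq (by linarith), sub_sub_cancel]
    exact h1
  · have h1 := h.tendsto_measureReal_maxModulus_le hx ht
    rw [occupation_particleNumber_of_ne hne, sub_zero, zero_mul, add_zero, mul_one,
      particleNumber_of_ne hα hne] at h1
    exact h1
  -- In the critical case mode N has Gamma parameter (2N+2χ)/α = 1, so its ratio of Gamma functions
  -- is exp(-2γt^(-α)). It enters with weight p, and the weight 1-p belongs to the absence of that
  -- particle.
  · have hk : 2 * (N : ℝ) + 2 * χ = α := by linarith
    have h1 := h.tendsto_measureReal_maxModulus_le hx ht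
    rw [particleNumber_of_eq hN, hk, div_self hα0.ne', upperGamma_one, Real.Gamma_one,
      div_one] at h1
    refine h1.trans_eq ?_
    have h2 := h.one_sub_occupation_of_eq hk
    have h3 : limitCoeff χ α γ Lminus Lplus N
        = (Real.pi * (1 / (α * γ) + 1 / Lplus + 1 / Lminus))⁻¹ := by
      rw [limitCoeff, if_neg (by linarith), if_pos hk]
    have h4 : 1 - occupation χ α γ Lminus Lplus N
        = (1 / Lplus + 1 / Lminus) * (1 / (α * γ) + 1 / Lplus + 1 / Lminus)⁻¹ := by
      rw [h2, h3, mul_inv]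
      have := Real.pi_ne_zero
      field_simp
    have h5 : occupation χ α γ Lminus Lplus N
        = 1 - (1 / Lplus + 1 / Lminus) * (1 / (α * γ) + 1 / Lplus + 1 / Lminus)⁻¹ := by
      linarith
    rw [h5]
    congr 2
    simp only [neg_mul]
    ring
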